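/- **Setting.** Let $0\le m\le M$ and $N\ge 0$ be integers and let $\eta,\xi_+,\xi_1,\dots,\xi_M,\lambda_1,\dots,\lambda_N\in\mathbb C$. On $V\otimes V$, $V=\mathbb C^2$, let $R(u)$ be the matrix which in the basis $11,12,21,22$ has diagonal $(\sinh(u+\eta),\sinh u,\sinh u,\sinh(u+\eta))$, entries $\sinh\eta$ at the positions $(12,21)$ and $(21,12)$, and zeros elsewhere. Let $K_+(u)=\mathrm{diag}\big(\sinh(u+\tfrac\eta2+\xi_+),\ \sinh(\xi_+-u-\tfrac\eta2)\big)$. On $V_0\otimes\mathcal H$, $\mathcal H=(\mathbb C^2)^{\otimes M}$, put $$T(u)=R_{0M}(u-\xi_M)\cdots R_{01}(u-\xi_1),\qquad \widehat T(u)=R_{10}(u+\xi_1-\eta)\cdots R_{M0}(u+\xi_M-\eta),$$ define $\mathcal U_+$ by $\mathcal U_+^{t_0}(u)=T^{t_0}(u)\,K_+^{t_0}(u)\,\widehat T^{t_0}(u)$ (with $t_0$ the transposition in $V_0$ only), and let $\mathcal B_+(u)\in\mathrm{End}\,\mathcal H$ be the $(1,2)$ entry of $\mathcal U_+(u)$ as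 a $2\times2$ matrix over $V_0$. Let $|0\rangle=\binom10^{\otimes M}$, and let $E_j^{\mu\mu'}$ be the matrix unit with its $1$ in row $\mu$ and column $\mu'$, acting at site $j$. Put $$a(u)=\prod_{i=1}^M\sinh(u-\xi_i+\eta),\qquad d(u)=\prod_{i=1}^M\sinh(u-\xi_i),$$ and, for variables $x_j$ and signs $\sigma_j$ indexed by a finite ordered set $S$, with $x_j^\sigma=\sigma_jx_j$, $$H_\sigma(\{x_j\}_{j\in S})=\prod_{j\in S}\Big[\sigma_j(-1)^M d(-x_j^\sigma)\frac{\sinh(2x_j+\eta)}{\sinh(2x_j)}\sinh\!\big(x_j^\sigma+\xi_+-\tfrac\eta2\big)\Big]\prod_{\substack{r<t\\ r,t\in S}}\frac{\sinh(x_r^\sigma+x_t^\sigma-\eta)}{\sinh(x_r^\sigma+x_t^\sigma)} ;$$ $H_1$ means that all signs are $+$. Let $\varepsilon_j,\varepsilon'_j\in\{1,2\}$ for $1\le j\le m$, and let $s$ be the number of $j$ with $\varepsilon'_j=2$ and $s'$ the number of $j$ with $\varepsilon_j=1$. Assume $s+s'=m$. Let $i_1<\dots<i_s$ be the $j$ with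 $\varepsilon'_j=2$ and $i_{s+1}>\dots>i_m$ the $j$ with $\varepsilon_j=1$. Put $\lambda_{N+j}=\xi_{m+1-j}$ for $1\le j\le m$. Assume that the parameters are generic, in the sense that the following numbers are nonzero for all choices of the signs $e,f=\pm1$ and all $1\le j,l\le m$, $1\le k,n\le N$, $1\le i\le M$ (these conditions ensure that no denominator below vanishes): $\sinh 2\lambda_k$; $\sinh(\lambda_k+e\lambda_n)$ for $k\ne n$; $\sinh(\xi_j+e\lambda_k)$; $\sinh(\xi_j+e\lambda_k-\eta)$; $\sinh(\xi_j-\xi_l)$ and $\sinh(\xi_j+\xi_l-\eta)$ for $j\ne l$; $\sinh(\xi_j-\xi_i+\eta)$; $\sinh(\xi_j+\xi_i)$; $\sinh(2\xi_j+\eta)$; $\sinh(\xi_j+\xi_+-\tfrac\eta2)$; and, if $m\ge2$, also $\sinh(\lambda_k+e\lambda_n+f\eta)$ for $k\ne n$ and $\sinh(\xi_j+e\lambda_k+\eta)$. **Proposition.** Then $$\prod_{j=1}^mE_j^{\varepsilon_j\varepsilon'_j}\prod_{k=1}^N\mathcal B_+(\lambda_k)\,|0\rangle=\sum_{\beta_m}\mathcal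 F^+_{\beta_m}\prod_{\substack{1\le k\le N+m\\ k\notin\beta_m}}\mathcal B_+(\lambda_k)\,|0\rangle ,$$ where the sum is over all tuples $\beta_m=(b_1,\dots,b_m)$ of pairwise distinct indices with $b_p\in\{1,\dots,N\}$ for $p\le s$ and $b_p\in\{1,\dots,N+m+1-i_p\}$ for $p>s$ (in the notation $k\notin\beta_m$ and below, $\beta_m$ also denotes the set $\{b_1,\dots,b_m\}$), and, with $$\alpha_+=\beta_m\cap\{1,\dots,N\},\quad \alpha_-=\{1,\dots,N\}\setminus\alpha_+,\quad \gamma_+=\{1,\dots,m\}\setminus\{N+m+1-j:\ j\in\beta_m,\ j>N\},$$ the coefficient is the following sum over the signs $\sigma_j=\pm1$, $j\in\alpha_+$, where $\lambda_j^\sigma=\sigma_j\lambda_j$ for $j\in\alpha_+$ and $\lambda_j^\sigma=\lambda_j$ for $j>N$: $$\begin{aligned}\mathcal F^+_{\beta_m}=\sum_{\sigma}\ &\prod_{j=1}^m\frac{a(\lambda^\sigma_{b_j})}{a(\xi_j)}\cdot\frac{H_\sigma(\{\lambda_j\}_{j\in\alpha_+})}{H_1(\{\xi_j\}_{j\in\gamma_+})}\prod_{1\le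 p<q\le m}\frac{\sinh(\lambda^\sigma_{b_p}-\lambda^\sigma_{b_q})}{\sinh(\lambda^\sigma_{b_p}-\lambda^\sigma_{b_q}+\eta)}\\ &\times\prod_{i\in\alpha_-}\prod_{e=\pm1}\Big\{\prod_{j\in\alpha_+}\frac{\sinh(\lambda^\sigma_j+e\lambda_i-\eta)}{\sinh(\lambda^\sigma_j+e\lambda_i)}\prod_{j\in\gamma_+}\frac{\sinh(\xi_j+e\lambda_i)}{\sinh(\xi_j+e\lambda_i-\eta)}\Big\}\\ &\times\prod_{i\in\alpha_+}\Big\{\prod_{j\in\gamma_+}\frac{\sinh(\xi_j-\lambda^\sigma_i)}{\sinh(\xi_j-\lambda^\sigma_i-\eta)}\cdot\frac{\prod_{j\in\alpha_+}\sinh(\lambda^\sigma_j-\lambda^\sigma_i+\eta)}{\prod_{j\in\alpha_+\setminus\{i\}}\sinh(\lambda^\sigma_j-\lambda^\sigma_i)}\Big\}\\ &\times\prod_{p=1}^s\frac{\prod_{k=i_p+1}^m\sinh(\lambda^\sigma_{b_p}-\xi_k+\eta)}{\prod_{k=i_p}^m\sinh(\lambda^\sigma_{b_p}-\xi_k)}\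 \prod_{p=s+1}^m\frac{\prod_{k=i_p+1}^m\sinh(\xi_k-\lambda^\sigma_{b_p}+\eta)}{\prod_{k=i_p,\ k\ne N+m+1-b_p}^m\sinh(\xi_k-\lambda^\sigma_{b_p})}.\end{aligned}$$ -/

import Mathlib

open scoped BigOperators

namespace OpenXXZ

/-- Operators on the quantum space `(ℂ²)^{⊗ M}` of a chain of `M` sites, written as matrices in
the standard basis, which is indexed by the configurations `Fin M → Fin 2`
(at each site `0` is spin up and `1` is spin down). -/
abbrev Op (M : ℕ) := Matrix (Fin M → Fin 2) (Fin M → Fin 2) ℂ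

/-- The operator acting as the `2 × 2` matrix `X` at site `j` and as the identity elsewhere. -/
def siteOp {M : ℕ} (j : Fin M) (X : Matrix (Fin 2) (Fin 2) ℂ) : Op M :=
  fun s t => if ∀ k, k ≠ j → s k = t k then X (s j) (t j) else 0

/-- The elementary operator `E_j^{μ μ'}`: the matrix unit with its only entry in row `μ` and
column `μ'`, acting at site `j`. The values `0` and `1` stand for the indices `1` and `2`. -/
def elemOp {M : ℕ} (j : Fin M) (μ μ' : Fin 2) : Op M :=
  siteOp j (Matrix.single μ μ' 1)

/-- The reference state `|0⟩` with all spins up. -/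
def vacuum (M : ℕ) : (Fin M → Fin 2) → ℂ := Pi.single (fun _ => 0) 1

/-- The `R`-matrix of the XXZ model on `ℂ² ⊗ ℂ²`: in the basis `11, 12, 21, 22` it has diagonal
`sinh (u + η), sinh u, sinh u, sinh (u + η)` and the entry `sinh η` at `(12, 21)`, `(21, 12)`. -/
noncomputable def Rmat (η u : ℂ) : Matrix (Fin 2 × Fin 2) (Fin 2 × Fin 2) ℂ :=
  fun x y =>
    if x = y then (if x.1 = x.2 then Complex.sinh (u + η) else Complex.sinh u)
    else if x = y.swap then Complex.sinh η else 0

/-- `R_{0j}(u)`, as a `2 × 2` matrix over the auxiliary space `V_0` whose entries are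
operators on the quantum space; the first factor of the `R`-matrix is `V_0`. -/
noncomputable def Raux {M : ℕ} (η : ℂ) (j : Fin M) (u : ℂ) : Matrix (Fin 2) (Fin 2) (Op M) :=
  fun a b => siteOp j (fun c d => Rmat η u (a, c) (b, d))

/-- `R_{j0}(u)`, where the second factor of the `R`-matrix is the auxiliary space `V_0`. -/
noncomputable def RauxFlip {M : ℕ} (η : ℂ) (j : Fin M) (u : ℂ) : Matrix (Fin 2) (Fin 2) (Op M) :=
  fun a b => siteOp j (fun c d => Rmat η u (c, a) (d, b))

/-- The boundary matrix `K(u; x) = diag (sinh (u + x), sinh (x - u))` on the auxiliary space. -/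
noncomputable def Kmat (M : ℕ) (x u : ℂ) : Matrix (Fin 2) (Fin 2) (Op M) :=
  Matrix.diagonal ![Complex.sinh (u + x) • (1 : Op M), Complex.sinh (x - u) • (1 : Op M)]

/-- The bulk monodromy matrix `T(u) = R_{0M}(u - ξ_M) ⋯ R_{01}(u - ξ_1)`. -/
noncomputable def monodromy {M : ℕ} (η : ℂ) (ξ : Fin M → ℂ) (u : ℂ) : Matrix (Fin 2) (Fin 2) (Op M) :=
  (List.ofFn fun j : Fin M => Raux η j (u - ξ j)).reverse.prod

/-- The matrix `T̂(u) = R_{10}(u + ξ_1 - η) ⋯ R_{M0}(u + ξ_M - η)`. -/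
noncomputable def monodromyHat {M : ℕ} (η : ℂ) (ξ : Fin M → ℂ) (u : ℂ) : Matrix (Fin 2) (Fin 2) (Op M) :=
  (List.ofFn fun j : Fin M => RauxFlip η j (u + ξ j - η)).prod

/-- The double-row monodromy matrix `U_+(u)`, given by
`U_+^{t₀}(u) = T^{t₀}(u) K_+^{t₀}(u) T̂^{t₀}(u)` with `K_+(u) = K(u + η/2; ξ_+)`. The transposition
`t₀` is in the auxiliary space only: it does not transpose the operator entries. -/
noncomputable def Uplus {M : ℕ} (η ξp : ℂ) (ξ : Fin M → ℂ) (u : ℂ) : Matrix (Fin 2) (Fin 2) (Op M) :=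
  ((monodromy η ξ u).transpose * (Kmat M ξp (u + η / 2)).transpose
    * (monodromyHat η ξ u).transpose).transpose

/-- The boundary creation operator `𝓑_+(u)`, the upper right entry of `U_+(u)`. -/
noncomputable def Bplus {M : ℕ} (η ξp : ℂ) (ξ : Fin M → ℂ) (u : ℂ) : Op M := Uplus η ξp ξ u 0 1

/-- `a(u) = ∏_{i=1}^M sinh (u - ξ_i + η)`. -/
noncomputable def aFun {M : ℕ} (η : ℂ) (ξ : Fin M → ℂ) (u : ℂ) : ℂ :=
  ∏ i, Complex.sinh (u - ξ i + η)

/-- `d(u) = ∏_{i=1}^M sinh (u - ξ_i)`. -/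
noncomputable def dFun {M : ℕ} (ξ : Fin M → ℂ) (u : ℂ) : ℂ :=
  ∏ i, Complex.sinh (u - ξ i)

/-- A variable with a sign: `x_k^σ = σ_k x_k`. -/
noncomputable def sgn {ι : Type} (σ : ι → ℤˣ) (x : ι → ℂ) (k : ι) : ℂ := ((σ k : ℤ) : ℂ) * x k

/-- The boundary-bulk coefficient `H_σ^{𝓑_+}({x_j}_{j ∈ S}; ξ_+)` of the variables labelled by a
finite set `S`, with `γ = (-1)^M`. -/
noncomputable def HBplus {M : ℕ} (η ξp : ℂ) (ξ : Fin M → ℂ) {ι : Type} [LinearOrder ι]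
    (S : Finset ι) (σ : ι → ℤˣ) (x : ι → ℂ) : ℂ :=
  (∏ j ∈ S, (((σ j : ℤ) : ℂ) * (-1) ^ M * dFun ξ (-sgn σ x j)
      * (Complex.sinh (2 * x j + η) / Complex.sinh (2 * x j))
      * Complex.sinh (sgn σ x j + ξp - η / 2)))
    * ∏ r ∈ S, ∏ s ∈ S with r < s,
        Complex.sinh (sgn σ x r + sgn σ x s - η) / Complex.sinh (sgn σ x r + sgn σ x s)

/-- `β_- = {j : ε'_j = 2}`. -/
def betaMinus {m : ℕ} (ε' : Fin m → Fin 2) : Finset (Fin m) := {j | ε' j = 1}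

/-- `β_+ = {j : ε_j = 1}`. -/
def betaPlus {m : ℕ} (ε : Fin m → Fin 2) : Finset (Fin m) := {j | ε j = 0}

/-- The sequence `i_1, …, i_m` of sites: the `s` elements of `β_-` in increasing order, followed
by the `s' = m - s` elements of `β_+` in decreasing order. -/
def siteSeq {m : ℕ} (ε ε' : Fin m → Fin 2)
    (h : (betaMinus ε').card + (betaPlus ε).card = m) (p : Fin m) : Fin m :=
  if hp : (p : ℕ) < (betaMinus ε').card then
    (betaMinus ε').orderEmbOfFin rfl ⟨p, hp⟩
  else
    (betaPlus ε).orderEmbOfFin rfl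
      (Fin.rev ⟨(p : ℕ) - (betaMinus ε').card, by have := p.isLt; omega⟩)

/-- The variables `λ_1, …, λ_N` extended by `λ_{N+j} = ξ_{m+1-j}` for `1 ≤ j ≤ m`. -/
def extVar {M N m : ℕ} (hm : m ≤ M) (ξ : Fin M → ℂ) (lam : Fin N → ℂ) : Fin (N + m) → ℂ :=
  Fin.append lam (fun j => ξ (Fin.castLE hm j.rev))

/-- The position, in the extended family of variables, at which `ξ_j` stands
(position `N + m + 1 - j`, both `j` and the position being counted from `1`). -/
def xiPos {m : ℕ} (N : ℕ) (j : Fin m) : Fin (N + m) := Fin.natAdd N j.rev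

/-- The families `β_m = (b_1, …, b_m)` of distinct indices over which one sums: with all numbers
counted from `1`, `b_p ≤ N` for `p ≤ s` and `b_p ≤ N + m + 1 - i_p` for `p > s`.
(In the code all indices are counted from `0`.) -/
def indexFamilies (N : ℕ) {m : ℕ} (ε ε' : Fin m → Fin 2)
    (h : (betaMinus ε').card + (betaPlus ε).card = m) : Finset (Fin m → Fin (N + m)) :=
  {b | (∀ p q, b p = b q → p = q) ∧
    ∀ p : Fin m,
      if (p : ℕ) < (betaMinus ε').card then (b p : ℕ) < N
      else (b p : ℕ) + (siteSeq ε ε' h p : ℕ) < N + m}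

/-- The underlying set `{b_1, …, b_m}`. -/
def bSet {N m : ℕ} (b : Fin m → Fin (N + m)) : Finset (Fin (N + m)) := Finset.univ.image b

/-- `α_+ = β_m ∩ {1, …, N}`. -/
def alphaPlus {N m : ℕ} (b : Fin m → Fin (N + m)) : Finset (Fin (N + m)) :=
  {k | (k : ℕ) < N ∧ k ∈ bSet b}

/-- `α_- = {1, …, N} \ α_+`. -/
def alphaMinus {N m : ℕ} (b : Fin m → Fin (N + m)) : Finset (Fin (N + m)) :=
  {k | (k : ℕ) < N ∧ k ∉ bSet b}

/-- `γ_+ = {1, …, m} \ γ_-`, where `γ_-` is the set of the `j` such that the position of `ξ_j`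
belongs to `β_m`. -/
def gammaPlus {N m : ℕ} (b : Fin m → Fin (N + m)) : Finset (Fin m) :=
  {j | xiPos N j ∉ bSet b}

/-- The choices of signs `σ_k = ±` for `k ∈ α_+`, extended by `σ_k = 1` to the other `k`. -/
def signChoices {N m : ℕ} (b : Fin m → Fin (N + m)) : Finset (Fin (N + m) → ℤˣ) :=
  {σ | ∀ k, k ∉ alphaPlus b → σ k = 1}

/-- The coefficient `𝓕⁺_{β_m}({λ})`, a sum over the signs `σ_k`, `k ∈ α_+`. In its body `x k` is
`λ_k` (with `λ_{N+j} = ξ_{m+1-j}`), `y k` is `λ_k^σ` and `z j` is `ξ_j`. -/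
noncomputable def Fplus {M N m : ℕ} (hm : m ≤ M) (η ξp : ℂ) (ξ : Fin M → ℂ) (lam : Fin N → ℂ)
    (ε ε' : Fin m → Fin 2) (h : (betaMinus ε').card + (betaPlus ε).card = m)
    (b : Fin m → Fin (N + m)) : ℂ :=
  let x : Fin (N + m) → ℂ := extVar hm ξ lam
  let z : Fin m → ℂ := fun j => ξ (Fin.castLE hm j)
  let i : Fin m → Fin m := siteSeq ε ε' h
  ∑ σ ∈ signChoices b,
    let y : Fin (N + m) → ℂ := sgn σ x
    (∏ j, aFun η ξ (y (b j)) / aFun η ξ (z j))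
    * (HBplus η ξp ξ (alphaPlus b) σ x / HBplus η ξp ξ (gammaPlus b) (fun _ => 1) z)
    * (∏ p, ∏ q with p < q,
        Complex.sinh (y (b p) - y (b q)) / Complex.sinh (y (b p) - y (b q) + η))
    * (∏ k ∈ alphaMinus b, ∏ e : ℤˣ,
        ((∏ j ∈ alphaPlus b,
            Complex.sinh (y j + ((e : ℤ) : ℂ) * x k - η)
              / Complex.sinh (y j + ((e : ℤ) : ℂ) * x k))
        * ∏ j ∈ gammaPlus b,
            Complex.sinh (z j + ((e : ℤ) : ℂ) * x k)
              / Complex.sinh (z j + ((e : ℤ) : ℂ) * x k - η)))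
    * (∏ k ∈ alphaPlus b,
        ((∏ j ∈ gammaPlus b, Complex.sinh (z j - y k) / Complex.sinh (z j - y k - η))
        * ((∏ j ∈ alphaPlus b, Complex.sinh (y j - y k + η))
            / ∏ j ∈ (alphaPlus b).erase k, Complex.sinh (y j - y k))))
    * (∏ p ∈ Finset.univ.filter (fun p : Fin m => (p : ℕ) < (betaMinus ε').card),
        (∏ k ∈ Finset.Ioi (i p), Complex.sinh (y (b p) - z k + η))
          / ∏ k ∈ Finset.Ici (i p), Complex.sinh (y (b p) - z k))
    * ∏ p ∈ Finset.univ.filter (fun p : Fin m => (betaMinus ε').card ≤ (p : ℕ)),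
        (∏ k ∈ Finset.Ioi (i p), Complex.sinh (z k - y (b p) + η))
          / ∏ k ∈ Finset.Ici (i p) with b p ≠ xiPos N k, Complex.sinh (z k - y (b p))

end OpenXXZ

/-!
The proof reduces the action on boundary vectors to one on bulk Bethe vectors and then identifies
the coefficients.

*Boundary-bulk relation.* By crossing, `T̂(u)` is expressed by the bulk entries at `-u`, and
`𝓑_+(u)` becomes a sum over `e = ±` of multiples of `B(eu) D(-eu)` (`Bplus_eq_sum`). Applied to a
sum of bulk Bethe vectors over signs, the terms in which `D` has given its argument away cancel in
pairs of signs (`unwanted_sum_eq_zero`), so `∏ 𝓑_+(λ_k) |0⟩ = ∑_σ H_σ ∏ B(λ_k^σ) |0⟩`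
(`boundary_bulk`).

*Bulk action.* Since `E^{εε'} = E^{ε1} E^{1ε'}`, the product of local operators first flips the
spins `1, …, m` up and then sets them. The monodromy matrix of the chain without its first site
commutes with the operators at that site. Flipping site `j` up therefore turns a Bethe vector of
the chain from `j` on into a combination of Bethe vectors of the chain from `j + 1` on, with one
`B` less if `ε'_j` is down (`elemOp_zero_zero_bethe`, `elemOp_zero_one_bethe`). Conversely
`E_j^{21}` on the shorter chain is, up to a factor, the operator `B(ξ_j)` on the longer one,
because at `u = ξ_j` the `R`-matrix of site `j` is a multiple of a permutation
(`elemOp_one_zero_bethe`). With `1 = E^{11} + E^{21} E^{12}` one also expands a vector with spin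
up at `j` in Bethe vectors of the longer chain (`bethe_eq_sum_cons`). The choices of the removed
`B` at the sites `i_1, …, i_m` are the families `β_m`, and the coefficient is a product over the
sites (`setSpins_betheFrom`).

*Coefficients.* Sorting the factors by variable (`prod_flipFactor`, `prod_restoreFactor`) and
cancelling gives the closed form `bulkCoeff`. Finally the sum over the signs of `λ_1, …, λ_N` is a
sum over those of `α_+`, which stays in the coefficient, and those of `α_-`, which recombine the
bulk vectors into boundary vectors. The factors of pairs in `H` between `α_-` and `α_+` or `γ_+`
supply the factors with the sign `e` that is absent in the bulk coefficient
(`GenericParams.coeff_eq`). In the boundary vectors on the right the signs of the `ξ_j` are frozen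
because `d(ξ_j) = 0`.
-/

namespace OpenXXZ
open Complex Matrix

/-! ### Operators at single sites and the Yang-Baxter equation -/

section

variable {M : ℕ}

theorem siteOp_mulVec (j : Fin M) (X : Matrix (Fin 2) (Fin 2) ℂ) (v : (Fin M → Fin 2) → ℂ)
    (s : Fin M → Fin 2) :
    (siteOp j X *ᵥ v) s = ∑ c, X (s j) c * v (Function.update s j c) := by
  classical
  unfold siteOp Matrix.mulVec dotProduct
  symm
  refine Finset.sum_of_injOn (fun c => Function.update s j c) ?_ ?_ ?_ ?_
  · intro c _ d _ h
    simpa using congrFun h j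
  · intro c _; simp
  · intro t _ ht
    dsimp only
    rw [if_neg, zero_mul]
    intro h
    refine ht ⟨t j, by simp, ?_⟩
    funext k
    by_cases hk : k = j
    · subst hk; simp
    · simp [hk, h k hk]
  · intro c _
    dsimp only
    rw [if_pos]
    · simp
    · intro k hk; simp [hk]

/-- Operators are compared through their action on vectors, where site operators have a simple
form. -/
theorem op_ext {X Y : Op M} (h : ∀ v, X *ᵥ v = Y *ᵥ v) : X = Y :=
  Matrix.mulVec_injective (funext h)

theorem siteOp_mul (j : Fin M) (X Y : Matrix (Fin 2) (Fin 2) ℂ) :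
    siteOp j X * siteOp j Y = siteOp j (X * Y) := by
  refine op_ext fun v => ?_
  funext s
  rw [← Matrix.mulVec_mulVec]
  simp only [siteOp_mulVec, Function.update_self, Function.update_idem, Matrix.mul_apply,
    Fin.sum_univ_two]
  ring

theorem siteOp_commute {i j : Fin M} (h : i ≠ j) (X Y : Matrix (Fin 2) (Fin 2) ℂ) :
    Commute (siteOp i X) (siteOp j Y) := by
  refine op_ext fun v => ?_
  funext s
  rw [← Matrix.mulVec_mulVec, ← Matrix.mulVec_mulVec]
  simp only [siteOp_mulVec, Fin.sum_univ_two, Function.update_of_ne h, Function.update_of_ne h.symm,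
    Function.update_comm h]
  ring

theorem siteOp_add (j : Fin M) (X Y : Matrix (Fin 2) (Fin 2) ℂ) :
    siteOp j (X + Y) = siteOp j X + siteOp j Y := by
  ext s t; simp only [siteOp, Matrix.add_apply]; split_ifs <;> simp

theorem siteOp_smul (j : Fin M) (c : ℂ) (X : Matrix (Fin 2) (Fin 2) ℂ) :
    siteOp j (c • X) = c • siteOp j X := by
  ext s t; simp only [siteOp, Matrix.smul_apply]; split_ifs <;> simp

theorem siteOp_zero (j : Fin M) : siteOp j (0 : Matrix (Fin 2) (Fin 2) ℂ) = 0 := by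
  ext s t; simp [siteOp]

theorem siteOp_one (j : Fin M) : siteOp j (1 : Matrix (Fin 2) (Fin 2) ℂ) = 1 := by
  refine op_ext fun v => ?_
  funext s
  simp [siteOp_mulVec, Matrix.one_apply]

theorem siteOp_vacuum (j : Fin M) {X : Matrix (Fin 2) (Fin 2) ℂ} (hX : X 1 0 = 0) :
    siteOp j X *ᵥ vacuum M = X 0 0 • vacuum M := by
  funext s
  rw [siteOp_mulVec, Fin.sum_univ_two]
  have h1 : vacuum M (Function.update s j 1) = 0 := by
    unfold vacuum
    rw [Pi.single_apply, if_neg]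
    intro h
    have := congrFun h j
    simp at this
  rw [h1, mul_zero, add_zero, Pi.smul_apply, smul_eq_mul]
  have hs : s j = 0 ∨ s j = 1 := by
    generalize s j = c
    revert c; decide
  rcases hs with hs | hs
  · rw [hs]
    congr 2
    rw [← hs, Function.update_eq_self]
  · rw [hs, hX, zero_mul]
    have : vacuum M s = 0 := by
      unfold vacuum
      rw [Pi.single_apply, if_neg]
      intro h
      have := congrFun h j
      simp [hs] at this
    rw [this, mul_zero]

theorem elemOp_mul (j : Fin M) (a b c d : Fin 2) :
    elemOp j a b * elemOp j c d = if b = c then elemOp j a d else 0 := by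
  unfold elemOp
  rw [siteOp_mul]
  split_ifs with h
  · subst h; simp
  · rw [Matrix.single_mul_single_of_ne _ _ _ _ h, siteOp_zero]

theorem elemOp_commute {i j : Fin M} (h : i ≠ j) (a b c d : Fin 2) :
    Commute (elemOp i a b) (elemOp j c d) := siteOp_commute h _ _

/-- The monodromy matrix of the part of the chain formed by the sites in the list `l`. -/
noncomputable def mono (η : ℂ) (ξ : Fin M → ℂ) (l : List (Fin M)) (u : ℂ) :
    Matrix (Fin 2) (Fin 2) (Op M) :=
  (l.map fun j => Raux η j (u - ξ j)).reverse.prod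

theorem mono_nil (η : ℂ) (ξ : Fin M → ℂ) (u : ℂ) : mono η ξ [] u = 1 := by simp [mono]

theorem mono_cons (η : ℂ) (ξ : Fin M → ℂ) (j : Fin M) (l : List (Fin M)) (u : ℂ) (a b : Fin 2) :
    mono η ξ (j :: l) u a b = ∑ c, mono η ξ l u a c * Raux η j (u - ξ j) c b := by
  simp [mono, List.prod_append, Matrix.mul_apply]

theorem monodromy_eq_mono (η : ℂ) (ξ : Fin M → ℂ) (u : ℂ) :
    monodromy η ξ u = mono η ξ (List.finRange M) u := by
  rw [monodromy, mono, List.ofFn_eq_map]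

theorem commute_mono (η : ℂ) (ξ : Fin M → ℂ) {l : List (Fin M)} {k : Fin M} (hk : k ∉ l)
    (X : Matrix (Fin 2) (Fin 2) ℂ) (u : ℂ) (a b : Fin 2) :
    Commute (siteOp k X) (mono η ξ l u a b) := by
  induction l generalizing a b with
  | nil =>
    rw [mono_nil, Matrix.one_apply]
    split_ifs
    · exact Commute.one_right _
    · exact Commute.zero_right _
  | cons j l ih =>
    rw [List.mem_cons, not_or] at hk
    rw [mono_cons]
    exact Commute.sum_right _ _ _ fun c _ => (ih hk.2 a c).mul_right (siteOp_commute hk.1 _ _)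

/-- The Yang-Baxter equation for the `R`-matrix, in components. -/
theorem RLL (η u v : ℂ) (a b c d x y : Fin 2) :
    ∑ a', ∑ b', ∑ z, Rmat η (u - v) (a, b) (a', b') *
        (Rmat η u (a', x) (c, z) * Rmat η v (b', z) (d, y))
      = ∑ a', ∑ b', ∑ z, Rmat η (u - v) (a', b') (c, d) *
          (Rmat η v (b, x) (b', z) * Rmat η u (a, z) (a', y)) := by
  have h1 : u = (u - v) + v := by ring
  generalize u - v = w at *
  subst h1
  fin_cases a <;> fin_cases b <;> fin_cases c <;> fin_cases d <;> fin_cases x <;> fin_cases y <;>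
    simp [Fin.sum_univ_two, Rmat, Prod.swap, sinh_add, cosh_add, -mul_eq_mul_left_iff,
      -mul_eq_mul_right_iff] <;>
    first
    | ring1
    | (ring_nf; simp only [cosh_sq]; ring1)

end

/-! ### The bulk monodromy matrix and its exchange relations -/

section

variable {M : ℕ}

theorem siteOp_sum {ι : Type*} (j : Fin M) (s : Finset ι) (X : ι → Matrix (Fin 2) (Fin 2) ℂ) :
    siteOp j (∑ i ∈ s, X i) = ∑ i ∈ s, siteOp j (X i) := by
  classical
  induction s using Finset.induction_on with
  | empty => simp [siteOp_zero]
  | insert a s ha ih => rw [Finset.sum_insert ha, Finset.sum_insert ha, siteOp_add, ih]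

/-- The entry `(a, b)` of `R(u)` over the auxiliary space, as a matrix on the quantum site. -/
noncomputable def auxMat (η u : ℂ) (a b : Fin 2) : Matrix (Fin 2) (Fin 2) ℂ :=
  Matrix.of fun c d => Rmat η u (a, c) (b, d)

theorem Raux_eq (η : ℂ) (j : Fin M) (u : ℂ) (a b : Fin 2) :
    Raux η j u a b = siteOp j (auxMat η u a b) := rfl

theorem Raux_zero_zero (η : ℂ) (j : Fin M) (u : ℂ) :
    Raux η j u 0 0 = sinh (u + η) • elemOp j 0 0 + sinh u • elemOp j 1 1 := by
  rw [Raux_eq, elemOp, elemOp, ← siteOp_smul, ← siteOp_smul, ← siteOp_add]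
  congr 1
  ext c d
  fin_cases c <;> fin_cases d <;> simp [auxMat, Rmat]

theorem Raux_zero_one (η : ℂ) (j : Fin M) (u : ℂ) :
    Raux η j u 0 1 = sinh η • elemOp j 1 0 := by
  rw [Raux_eq, elemOp, ← siteOp_smul]
  congr 1
  ext c d
  fin_cases c <;> fin_cases d <;> simp [auxMat, Rmat]

theorem Raux_one_zero (η : ℂ) (j : Fin M) (u : ℂ) :
    Raux η j u 1 0 = sinh η • elemOp j 0 1 := by
  rw [Raux_eq, elemOp, ← siteOp_smul]
  congr 1
  ext c d
  fin_cases c <;> fin_cases d <;> simp [auxMat, Rmat]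

theorem Raux_one_one (η : ℂ) (j : Fin M) (u : ℂ) :
    Raux η j u 1 1 = sinh u • elemOp j 0 0 + sinh (u + η) • elemOp j 1 1 := by
  rw [Raux_eq, elemOp, elemOp, ← siteOp_smul, ← siteOp_smul, ← siteOp_add]
  congr 1
  ext c d
  fin_cases c <;> fin_cases d <;> simp [auxMat, Rmat]

theorem elemOp_vacuum (j : Fin M) (a b : Fin 2) (h : a = 0 ∨ b = 1) :
    elemOp j a b *ᵥ vacuum M = (if a = 0 ∧ b = 0 then (1 : ℂ) else 0) • vacuum M := by
  rw [elemOp, siteOp_vacuum]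
  · fin_cases a <;> fin_cases b <;> simp
  · rcases h with h | h <;> simp [h]

/-- The Yang-Baxter relation of the monodromy matrix of a single site. -/
theorem Raux_RTT (η u v : ℂ) (j : Fin M) (a b c d : Fin 2) :
    ∑ a', ∑ b', Rmat η (u - v) (a, b) (a', b') • (Raux η j u a' c * Raux η j v b' d)
      = ∑ a', ∑ b', Rmat η (u - v) (a', b') (c, d) • (Raux η j v b b' * Raux η j u a a') := by
  simp only [Raux_eq, siteOp_mul, ← siteOp_smul, ← siteOp_sum]
  congr 1
  ext x y
  have h := RLL η u v a b c d x y
  simp only [Matrix.sum_apply, Matrix.smul_apply, Matrix.mul_apply, smul_eq_mul, Finset.mul_sum]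
  exact h

/-- The Yang-Baxter relation of the monodromy matrix: the relation of the single sites
propagates along the chain, since operators at distinct sites commute. -/
theorem mono_RTT (η : ℂ) (ξ : Fin M → ℂ) {l : List (Fin M)} (hl : l.Nodup) (u v : ℂ)
    (a b c d : Fin 2) :
    ∑ a', ∑ b', Rmat η (u - v) (a, b) (a', b') • (mono η ξ l u a' c * mono η ξ l v b' d)
      = ∑ a', ∑ b', Rmat η (u - v) (a', b') (c, d) • (mono η ξ l v b b' * mono η ξ l u a a') := by
  induction l generalizing a b c d with
  | nil =>
    simp only [mono_nil, Matrix.one_apply]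
    fin_cases a <;> fin_cases b <;> fin_cases c <;> fin_cases d <;> simp
  | cons j l ih =>
    rw [List.nodup_cons] at hl
    have hc : ∀ w w' p q r t, Raux η j w p q * mono η ξ l w' r t
        = mono η ξ l w' r t * Raux η j w p q := fun w w' p q r t => commute_mono η ξ hl.1 _ _ _ _
    have swap : ∀ w w' p q r t x y, mono η ξ l w p q * Raux η j (w - ξ j) q r *
        (mono η ξ l w' t x * Raux η j (w' - ξ j) x y) = (mono η ξ l w p q * mono η ξ l w' t x) *
        (Raux η j (w - ξ j) q r * Raux η j (w' - ξ j) x y) := by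
      intro w w' p q r t x y
      rw [mul_assoc, ← mul_assoc (Raux η j _ q r), hc, mul_assoc, mul_assoc]
    calc _ = ∑ x, ∑ y, (∑ a', ∑ b', Rmat η (u - v) (a, b) (a', b') •
          (mono η ξ l u a' x * mono η ξ l v b' y)) *
          (Raux η j (u - ξ j) x c * Raux η j (v - ξ j) y d) := by
            simp only [mono_cons, Fin.sum_univ_two, add_mul, mul_add, swap, smul_add,
              smul_mul_assoc]
            abel
      _ = ∑ a', ∑ b', (mono η ξ l v b b' * mono η ξ l u a a') * ∑ x, ∑ y,
          Rmat η (u - v) (a', b') (x, y) •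
            (Raux η j (u - ξ j) x c * Raux η j (v - ξ j) y d) := by
            simp only [ih hl.2]
            simp only [Fin.sum_univ_two, add_mul, mul_add, smul_mul_assoc,
              mul_smul_comm]
            abel
      _ = _ := by
            have h := fun p q => Raux_RTT η (u - ξ j) (v - ξ j) j p q c d
            rw [show u - ξ j - (v - ξ j) = u - v by ring] at h
            simp only [h, mono_cons]
            simp only [Fin.sum_univ_two, add_mul, mul_add, swap, smul_add,
              mul_smul_comm]
            abel

theorem continuous_mono (η : ℂ) (ξ : Fin M → ℂ) (l : List (Fin M)) (a b : Fin 2) :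
    Continuous fun u => mono η ξ l u a b := by
  induction l generalizing a b with
  | nil => simp only [mono_nil]; exact continuous_const
  | cons j l ih =>
    simp only [mono_cons]
    refine continuous_finsetSum _ fun c _ => (ih a c).mul ?_
    fin_cases c <;> fin_cases b <;>
      simp only [Fin.zero_eta, Fin.mk_one, Raux_zero_zero, Raux_zero_one, Raux_one_zero,
        Raux_one_one] <;> fun_prop

theorem eventually_sinh_ne_zero (c u : ℂ) :
    ∀ᶠ w in nhdsWithin u {u}ᶜ, sinh (w + c) ≠ 0 := by
  by_cases h : sinh (u + c) = 0
  · have hd : HasDerivAt (fun w => sinh (w + c)) (cosh (u + c)) u := by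
      simpa using (Complex.hasDerivAt_sinh (u + c)).comp_add_const u c
    refine hd.eventually_ne (c := 0) fun hc => ?_
    have := Complex.cosh_sq (u + c)
    rw [h, hc] at this
    norm_num at this
  · exact ((by fun_prop : Continuous fun w => sinh (w + c)).continuousAt.eventually_ne h).filter_mono
      nhdsWithin_le_nhds

variable (η : ℂ) (ξ : Fin M → ℂ) {l : List (Fin M)}

theorem monoB_commute (hl : l.Nodup) (u v : ℂ) :
    Commute (mono η ξ l u 0 1) (mono η ξ l v 0 1) := by
  -- The Yang-Baxter relation has the factor `sinh (u - v + η)` on both sides. It can be cancelled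
  -- for `u` in a punctured neighbourhood of any point; the rest follows by continuity.
  have key : ∀ᶠ w in nhdsWithin u {u}ᶜ,
      mono η ξ l w 0 1 * mono η ξ l v 0 1 = mono η ξ l v 0 1 * mono η ξ l w 0 1 := by
    filter_upwards [eventually_sinh_ne_zero (-v + η) u] with w hw
    have h := mono_RTT η ξ hl w v 0 0 1 1
    simp only [Fin.sum_univ_two, Rmat] at h
    simp only [Prod.mk.injEq, Prod.swap, zero_ne_one, one_ne_zero, and_false, false_and, and_self,
      if_true, if_false, zero_smul, add_zero, zero_add] at h
    rw [show w + (-v + η) = w - v + η by ring] at hw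
    exact smul_right_injective _ hw h
  have h1 : Filter.Tendsto (fun w => mono η ξ l w 0 1 * mono η ξ l v 0 1) (nhdsWithin u {u}ᶜ)
      (nhds (mono η ξ l u 0 1 * mono η ξ l v 0 1)) :=
    (((continuous_mono η ξ l 0 1).mul continuous_const).tendsto u).mono_left nhdsWithin_le_nhds
  have h2 : Filter.Tendsto (fun w => mono η ξ l v 0 1 * mono η ξ l w 0 1) (nhdsWithin u {u}ᶜ)
      (nhds (mono η ξ l v 0 1 * mono η ξ l u 0 1)) :=
    ((continuous_const.mul (continuous_mono η ξ l 0 1)).tendsto u).mono_left nhdsWithin_le_nhds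
  exact tendsto_nhds_unique (h1.congr' key) h2

theorem smul_eq_of_mul {a b c : ℂ} (ha : a ≠ 0) {X Y Z : Op M} (h : b • Y = a • X + c • Z) :
    X = (b / a) • Y - (c / a) • Z := by
  have : a • X = b • Y - c • Z := by rw [h]; abel
  calc X = a⁻¹ • (a • X) := by rw [smul_smul, inv_mul_cancel₀ ha, one_smul]
    _ = _ := by rw [this, smul_sub, smul_smul, smul_smul]; congr 2 <;> field_simp

theorem monoA_monoB (hl : l.Nodup) {u v : ℂ} (h : sinh (u - v) ≠ 0) :
    mono η ξ l u 0 0 * mono η ξ l v 0 1 =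
      (sinh (u - v + -η) / sinh (u - v)) • (mono η ξ l v 0 1 * mono η ξ l u 0 0)
      - (sinh (-η) / sinh (u - v)) • (mono η ξ l u 0 1 * mono η ξ l v 0 0) := by
  have h' := mono_RTT η ξ hl v u 0 0 1 0
  simp only [Fin.sum_univ_two, Rmat] at h'
  simp only [Prod.mk.injEq, Prod.swap, zero_ne_one, one_ne_zero, and_false, and_self, and_true,
      if_true, if_false, zero_smul, add_zero, zero_add] at h'
  have e1 : sinh (u - v + -η) = -sinh (v - u + η) := by rw [← sinh_neg]; congr 1; ring
  have e2 : sinh (u - v) = -sinh (v - u) := by rw [← sinh_neg]; congr 1; ring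
  have e3 : sinh (v - u) ≠ 0 := by rw [e2] at h; simpa using h
  rw [e1, e2, sinh_neg, neg_div_neg_eq, neg_div_neg_eq]
  refine smul_eq_of_mul e3 ?_
  rw [h']; abel

theorem monoD_monoB (hl : l.Nodup) {u v : ℂ} (h : sinh (u - v) ≠ 0) :
    mono η ξ l u 1 1 * mono η ξ l v 0 1 =
      (sinh (u - v + η) / sinh (u - v)) • (mono η ξ l v 0 1 * mono η ξ l u 1 1)
      - (sinh η / sinh (u - v)) • (mono η ξ l u 0 1 * mono η ξ l v 1 1) := by
  have h' := mono_RTT η ξ hl u v 1 0 1 1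
  simp only [Fin.sum_univ_two, Rmat] at h'
  simp only [Prod.mk.injEq, Prod.swap, zero_ne_one, one_ne_zero, and_false, and_self, and_true,
      if_true, if_false, zero_smul, add_zero, zero_add] at h'
  refine smul_eq_of_mul h ?_
  rw [← h']; abel

/-- `∏ sinh (u - ξ_j + η)` over the sites in `l`: the eigenvalue of `A` on the reference state. -/
noncomputable def aList (η : ℂ) (ξ : Fin M → ℂ) (l : List (Fin M)) (u : ℂ) : ℂ :=
  (l.map fun j => sinh (u - ξ j + η)).prod

theorem monoA_vacuum (l : List (Fin M)) (u : ℂ) :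
    mono η ξ l u 0 0 *ᵥ vacuum M = aList η ξ l u • vacuum M := by
  induction l with
  | nil => simp [mono_nil, aList]
  | cons j l ih =>
    rw [mono_cons, Fin.sum_univ_two, Matrix.add_mulVec, ← Matrix.mulVec_mulVec,
      ← Matrix.mulVec_mulVec, Raux_zero_zero, Raux_one_zero]
    simp [Matrix.add_mulVec, Matrix.smul_mulVec, elemOp_vacuum, Matrix.mulVec_smul, ih, aList,
      smul_smul]

theorem monoC_vacuum (l : List (Fin M)) (u : ℂ) : mono η ξ l u 1 0 *ᵥ vacuum M = 0 := by
  induction l with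
  | nil => simp [mono_nil]
  | cons j l ih =>
    rw [mono_cons, Fin.sum_univ_two, Matrix.add_mulVec, ← Matrix.mulVec_mulVec,
      ← Matrix.mulVec_mulVec, Raux_zero_zero, Raux_one_zero]
    simp [Matrix.add_mulVec, Matrix.smul_mulVec, elemOp_vacuum, Matrix.mulVec_smul, ih]

theorem monoD_vacuum (hl : l.Nodup) (u : ℂ) :
    mono η ξ l u 1 1 *ᵥ vacuum M = (l.map fun j => sinh (u - ξ j)).prod • vacuum M := by
  induction l with
  | nil => simp [mono_nil]
  | cons j l ih =>
    rw [List.nodup_cons] at hl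
    have hc : mono η ξ l u 1 0 * Raux η j (u - ξ j) 0 1 = _ :=
      (commute_mono η ξ hl.1 (auxMat η (u - ξ j) 0 1) u 1 0).symm.eq
    rw [mono_cons, Fin.sum_univ_two, hc, Matrix.add_mulVec, ← Matrix.mulVec_mulVec,
      ← Matrix.mulVec_mulVec, monoC_vacuum, Raux_one_one]
    simp [Matrix.add_mulVec, Matrix.smul_mulVec, elemOp_vacuum, Matrix.mulVec_smul, ih hl.2,
      smul_smul]

end

/-! ### Bulk Bethe vectors and local operators at the end of the chain -/

section

variable {M : ℕ} {η : ℂ} {ξ : Fin M → ℂ} {l : List (Fin M)} {ι : Type}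

/-- The entry `A(u)` of the bulk monodromy matrix. -/
noncomputable def bulkA (η : ℂ) (ξ : Fin M → ℂ) (l : List (Fin M)) (u : ℂ) : Op M :=
  mono η ξ l u 0 0

/-- The bulk creation operator `B(u)`. -/
noncomputable def bulkB (η : ℂ) (ξ : Fin M → ℂ) (l : List (Fin M)) (u : ℂ) : Op M :=
  mono η ξ l u 0 1

/-- The entry `D(u)` of the bulk monodromy matrix. -/
noncomputable def bulkD (η : ℂ) (ξ : Fin M → ℂ) (l : List (Fin M)) (u : ℂ) : Op M :=
  mono η ξ l u 1 1

theorem elemOp_mul_bulkA {j : Fin M} (hj : j ∉ l) (a b : Fin 2) (u : ℂ) :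
    elemOp j a b * bulkA η ξ l u = bulkA η ξ l u * elemOp j a b :=
  commute_mono η ξ hj _ u 0 0

theorem elemOp_mul_bulkB {j : Fin M} (hj : j ∉ l) (a b : Fin 2) (u : ℂ) :
    elemOp j a b * bulkB η ξ l u = bulkB η ξ l u * elemOp j a b :=
  commute_mono η ξ hj _ u 0 1

theorem bulkB_commute (hl : l.Nodup) (u v : ℂ) : Commute (bulkB η ξ l u) (bulkB η ξ l v) :=
  monoB_commute η ξ hl u v

theorem bulkA_mul_bulkB (hl : l.Nodup) {u v : ℂ} (h : sinh (u - v) ≠ 0) :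
    bulkA η ξ l u * bulkB η ξ l v =
      (sinh (u - v + -η) / sinh (u - v)) • (bulkB η ξ l v * bulkA η ξ l u)
      - (sinh (-η) / sinh (u - v)) • (bulkB η ξ l u * bulkA η ξ l v) :=
  monoA_monoB η ξ hl h

theorem bulkD_mul_bulkB (hl : l.Nodup) {u v : ℂ} (h : sinh (u - v) ≠ 0) :
    bulkD η ξ l u * bulkB η ξ l v =
      (sinh (u - v + η) / sinh (u - v)) • (bulkB η ξ l v * bulkD η ξ l u)
      - (sinh η / sinh (u - v)) • (bulkB η ξ l u * bulkD η ξ l v) :=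
  monoD_monoB η ξ hl h

theorem bulkB_pairwise (hl : l.Nodup) (x : ι → ℂ) (S : Finset ι) :
    (S : Set ι).Pairwise (Function.onFun Commute fun k => bulkB η ξ l (x k)) :=
  fun _ _ _ _ _ => bulkB_commute hl _ _

/-- The factor `sinh (u - v + κ) / sinh (u - v)` of the exchange relations of `A` (for `κ = -η`)
and `D` (for `κ = η`) with `B`. -/
noncomputable def exch (κ u v : ℂ) : ℂ := sinh (u - v + κ) / sinh (u - v)

/-- The bulk Bethe vector `∏_{k ∈ S} B(x_k) |0⟩` of the part of the chain formed by the sites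
in `l`. -/
noncomputable def bethe (η : ℂ) (ξ : Fin M → ℂ) (hl : l.Nodup) (x : ι → ℂ) (S : Finset ι) :
    (Fin M → Fin 2) → ℂ :=
  S.noncommProd (fun k => bulkB η ξ l (x k)) (bulkB_pairwise hl x S) *ᵥ
    vacuum M

theorem bethe_empty (hl : l.Nodup) (x : ι → ℂ) : bethe η ξ hl x ∅ = vacuum M := by
  unfold bethe
  rw [Finset.noncommProd_empty, Matrix.one_mulVec]

theorem bethe_insert [DecidableEq ι] (hl : l.Nodup) (x : ι → ℂ)
    {S : Finset ι} {k : ι} (hk : k ∉ S) :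
    bethe η ξ hl x (insert k S) = bulkB η ξ l (x k) *ᵥ bethe η ξ hl x S := by
  rw [bethe, Finset.noncommProd_insert_of_notMem _ _ _ _ hk, ← Matrix.mulVec_mulVec, bethe]

theorem bethe_congr (hl : l.Nodup) {x y : ι → ℂ} {S : Finset ι} (h : ∀ k ∈ S, x k = y k) :
    bethe η ξ hl x S = bethe η ξ hl y S := by
  unfold bethe
  congr 1
  exact Finset.noncommProd_congr rfl (fun k hk => by rw [h k hk]) _

variable {j : Fin M}

theorem commute_bethe (hl : l.Nodup) (hj : j ∉ l) (X : Matrix (Fin 2) (Fin 2) ℂ)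
    (x : ι → ℂ) (S : Finset ι) :
    siteOp j X *ᵥ bethe η ξ hl x S = S.noncommProd (fun k => bulkB η ξ l (x k))
      (bulkB_pairwise hl x S) *ᵥ (siteOp j X *ᵥ vacuum M) := by
  have h : Commute (siteOp j X) (S.noncommProd (fun k => bulkB η ξ l (x k))
      (bulkB_pairwise hl x S)) :=
    Finset.noncommProd_commute S _ _ _ fun k _ => commute_mono η ξ hj X (x k) 0 1
  rw [bethe, Matrix.mulVec_mulVec, Matrix.mulVec_mulVec, h.eq]

theorem elemOp_zero_zero_bethe_of_notMem (hl : l.Nodup) (hj : j ∉ l) (x : ι → ℂ) (S : Finset ι) :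
    elemOp j 0 0 *ᵥ bethe η ξ hl x S = bethe η ξ hl x S := by
  rw [elemOp, commute_bethe hl hj, ← elemOp, elemOp_vacuum]
  · simp [bethe]
  · simp

variable [DecidableEq ι]

/-- The addition formula by which two unwanted terms combine into one when an operator passes
two factors `B`. -/
theorem exch_identity (κ : ℂ) {u v w : ℂ} (h1 : sinh (u - v) ≠ 0) (h2 : sinh (u - w) ≠ 0)
    (h3 : sinh (v - w) ≠ 0) :
    exch κ u v * (sinh κ / sinh (u - w)) - sinh κ / sinh (u - v) * (sinh κ / sinh (v - w)) =
      sinh κ / sinh (u - w) * exch κ w v := by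
  unfold exch
  have e : sinh (w - v) = -sinh (v - w) := by rw [← sinh_neg]; congr 1; ring
  have e' : sinh (w - v + κ) = sinh (κ - (v - w)) := by congr 1; ring
  have e2 : u - w = (u - v) + (v - w) := by ring
  rw [e, e']
  rw [e2] at h2 ⊢
  generalize u - v = p at *
  generalize v - w = q at *
  field_simp
  simp only [sinh_add, sinh_sub]
  ring

/-- The action on a Bethe vector of a family of operators that satisfies the exchange relation
of `D` with `B` (with `κ` for `η`) and has the reference state as an eigenvector. -/
theorem exchange_action (hl : l.Nodup) {X : ℂ → Op M} {κ : ℂ} {χ : ℂ → ℂ}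
    (hX : ∀ u v, sinh (u - v) ≠ 0 → X u * bulkB η ξ l v =
      (sinh (u - v + κ) / sinh (u - v)) • (bulkB η ξ l v * X u)
        - (sinh κ / sinh (u - v)) • (bulkB η ξ l u * X v))
    (hχ : ∀ u, X u *ᵥ vacuum M = χ u • vacuum M) (x : ι → ℂ) (S : Finset ι) (u : ℂ)
    (hu : ∀ k ∈ S, sinh (u - x k) ≠ 0)
    (hx : ∀ k ∈ S, ∀ k' ∈ S, k ≠ k' → sinh (x k - x k') ≠ 0) :
    X u *ᵥ bethe η ξ hl x S = (χ u * ∏ k ∈ S, exch κ u (x k)) • bethe η ξ hl x S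
      - ∑ b ∈ S, (sinh κ / sinh (u - x b) * (χ (x b) * ∏ k ∈ S.erase b, exch κ (x b) (x k))) •
          (bulkB η ξ l u *ᵥ bethe η ξ hl x (S.erase b)) := by
  induction S using Finset.induction_on generalizing u with
  | empty => simp [bethe_empty, hχ]
  | insert j S hj ih =>
    have hu' : ∀ k ∈ S, sinh (u - x k) ≠ 0 := fun k hk => hu k (Finset.mem_insert_of_mem hk)
    have hx' : ∀ k ∈ S, ∀ k' ∈ S, k ≠ k' → sinh (x k - x k') ≠ 0 := fun k hk k' hk' =>
      hx k (Finset.mem_insert_of_mem hk) k' (Finset.mem_insert_of_mem hk')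
    have hjk : ∀ k ∈ S, sinh (x j - x k) ≠ 0 := fun k hk =>
      hx j (Finset.mem_insert_self _ _) k (Finset.mem_insert_of_mem hk)
        (fun h => hj (h ▸ hk))
    have hju := hu j (Finset.mem_insert_self _ _)
    have hB : bulkB η ξ l (x j) * bulkB η ξ l u = bulkB η ξ l u * bulkB η ξ l (x j) :=
      bulkB_commute hl _ _
    have hrest : ∀ b ∈ S, (sinh κ / sinh (u - x b) * (χ (x b) *
          ∏ k ∈ (insert j S).erase b, exch κ (x b) (x k))) •
          (bulkB η ξ l u *ᵥ bethe η ξ hl x ((insert j S).erase b)) =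
        (exch κ u (x j) * (sinh κ / sinh (u - x b) * (χ (x b) *
          ∏ k ∈ S.erase b, exch κ (x b) (x k)))) •
          (bulkB η ξ l (x j) *ᵥ (bulkB η ξ l u *ᵥ bethe η ξ hl x (S.erase b))) -
        (sinh κ / sinh (u - x j) * (sinh κ / sinh (x j - x b) * (χ (x b) *
          ∏ k ∈ S.erase b, exch κ (x b) (x k)))) •
          (bulkB η ξ l u *ᵥ (bulkB η ξ l (x j) *ᵥ bethe η ξ hl x (S.erase b))) := by
      intro b hb
      have hbj : b ≠ j := fun h => hj (h ▸ hb)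
      have hj' : j ∉ S.erase b := fun h => hj (Finset.mem_of_mem_erase h)
      rw [Finset.erase_insert_of_ne hbj.symm, Finset.prod_insert hj', bethe_insert hl x hj',
        Matrix.mulVec_mulVec (M := bulkB η ξ l (x j)), hB, ← Matrix.mulVec_mulVec, ← sub_smul]
      congr 1
      linear_combination (-(χ (x b) * ∏ k ∈ S.erase b, exch κ (x b) (x k))) *
        exch_identity κ hju (hu' b hb) (hjk b hb)
    rw [bethe_insert hl x hj, Matrix.mulVec_mulVec, hX _ _ hju, Matrix.sub_mulVec,
      Matrix.smul_mulVec, Matrix.smul_mulVec, ← Matrix.mulVec_mulVec, ← Matrix.mulVec_mulVec,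
      ih u hu' hx', ih (x j) hjk hx', Finset.sum_insert hj, Finset.sum_congr rfl hrest,
      Finset.sum_sub_distrib, Finset.prod_insert hj, Finset.erase_insert hj]
    simp only [Matrix.mulVec_sub, Matrix.mulVec_smul, Matrix.mulVec_sum, smul_sub, smul_smul,
      Finset.smul_sum]
    change _ • _ - _ - _ = _
    rw [show sinh (u - x j + κ) / sinh (u - x j) = exch κ u (x j) from rfl,
      show exch κ u (x j) * (χ u * ∏ k ∈ S, exch κ u (x k))
        = χ u * (exch κ u (x j) * ∏ k ∈ S, exch κ u (x k)) by ring]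
    abel

theorem bulkB_cons (hj : j ∉ l) (u : ℂ) : bulkB η ξ (j :: l) u =
    sinh η • (elemOp j 1 0 * bulkA η ξ l u)
      + (sinh (u - ξ j) • elemOp j 0 0 + sinh (u - ξ j + η) • elemOp j 1 1) *
        bulkB η ξ l u := by
  rw [bulkB, mono_cons, Fin.sum_univ_two, Raux_zero_one, Raux_one_one]
  have h1 : ∀ a b c d, mono η ξ l u a b * elemOp j c d = elemOp j c d * mono η ξ l u a b :=
    fun a b _ _ => (commute_mono η ξ hj _ u a b).symm.eq
  simp only [mul_add, add_mul, mul_smul_comm, smul_mul_assoc, h1, bulkA, bulkB]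

/-- Projecting the site `j` on spin up takes `j` off the chain. -/
theorem elemOp_zero_zero_bethe (hl : (j :: l).Nodup) (x : ι → ℂ) (S : Finset ι) :
    elemOp j 0 0 *ᵥ bethe η ξ hl x S =
      (∏ k ∈ S, sinh (x k - ξ j)) • bethe η ξ (List.nodup_cons.1 hl).2 x S := by
  have hj := (List.nodup_cons.1 hl).1
  induction S using Finset.induction_on with
  | empty => rw [bethe_empty, bethe_empty, elemOp_vacuum] <;> simp
  | insert k S hk ih =>
    have h : elemOp j 0 0 * bulkB η ξ (j :: l) (x k) =
        sinh (x k - ξ j) • (bulkB η ξ l (x k) * elemOp j 0 0) := by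
      rw [bulkB_cons hj, ← elemOp_mul_bulkB hj]
      simp [mul_add, add_mul, ← mul_assoc, elemOp_mul]
    rw [bethe_insert hl x hk, Matrix.mulVec_mulVec, h, Matrix.smul_mulVec, ← Matrix.mulVec_mulVec,
      ih, Matrix.mulVec_smul, smul_smul, Finset.prod_insert hk, bethe_insert _ x hk]

/-- The addition formula by which the wanted term of `A` and the term in which `B` is untouched
combine when a site is flipped up. -/
theorem lower_identity {s c η u v : ℂ} (h : sinh (u - v) ≠ 0) (hs : s = sinh (v - c)) :
    -(s * (sinh (-η) / sinh (u - v))) + sinh (u - c + η) = sinh (u - c) * exch (-η) v u := by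
  unfold exch
  have e1 : sinh (v - u) = - sinh (u - v) := by rw [← sinh_neg]; congr 1; ring
  have e2 : u - v = (u - c) - (v - c) := by ring
  have e3 : v - u + -η = (v - c) - (u - c) - η := by ring
  rw [hs, e1, e3]
  rw [e2] at h ⊢
  generalize u - c = p at *
  generalize v - c = q at *
  field_simp
  simp only [sinh_add, sinh_sub, cosh_sub, sinh_neg]
  ring_nf
  simp only [cosh_sq]
  ring

/-- Flipping the site `j` up removes one `B` from a Bethe vector and takes `j` off the chain. -/
theorem elemOp_zero_one_bethe (hl : (j :: l).Nodup) (x : ι → ℂ) (S : Finset ι)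
    (hx : ∀ k ∈ S, ∀ k' ∈ S, k ≠ k' → sinh (x k - x k') ≠ 0) :
    elemOp j 0 1 *ᵥ bethe η ξ hl x S = ∑ b ∈ S, (sinh η * aList η ξ l (x b) *
        ((∏ k ∈ S.erase b, sinh (x k - ξ j)) * ∏ k ∈ S.erase b, exch (-η) (x b) (x k))) •
      bethe η ξ (List.nodup_cons.1 hl).2 x (S.erase b) := by
  have hj := (List.nodup_cons.1 hl).1
  induction S using Finset.induction_on with
  | empty => rw [bethe_empty, elemOp_vacuum] <;> simp
  | insert k S hk ih =>
    have hx' : ∀ k ∈ S, ∀ k' ∈ S, k ≠ k' → sinh (x k - x k') ≠ 0 := fun k hk k' hk' =>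
      hx k (Finset.mem_insert_of_mem hk) k' (Finset.mem_insert_of_mem hk')
    have hjk : ∀ b ∈ S, sinh (x k - x b) ≠ 0 := fun b hb =>
      hx k (Finset.mem_insert_self _ _) b (Finset.mem_insert_of_mem hb)
        (fun h => hk (h ▸ hb))
    have h : elemOp j 0 1 * bulkB η ξ (j :: l) (x k) =
        sinh η • (bulkA η ξ l (x k) * elemOp j 0 0) +
        sinh (x k - ξ j + η) • (bulkB η ξ l (x k) * elemOp j 0 1) := by
      rw [bulkB_cons hj, ← elemOp_mul_bulkB hj, ← elemOp_mul_bulkA hj]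
      simp [mul_add, add_mul, ← mul_assoc, elemOp_mul]
    have hl' := (List.nodup_cons.1 hl).2
    rw [bethe_insert hl x hk, Matrix.mulVec_mulVec, h, Matrix.add_mulVec, Matrix.smul_mulVec,
      Matrix.smul_mulVec, ← Matrix.mulVec_mulVec, ← Matrix.mulVec_mulVec, elemOp_zero_zero_bethe,
      ih hx', Matrix.mulVec_smul,
      exchange_action hl' (fun u v h => bulkA_mul_bulkB hl' h)
        (fun u => monoA_vacuum η ξ l u) x S (x k) hjk hx', Finset.sum_insert hk,
      Finset.erase_insert hk, Matrix.mulVec_sum, smul_sub, smul_sub, smul_smul, smul_smul,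
      sub_add]
    rw [sub_eq_add_neg]
    congr 1
    · congr 1; ring
    · rw [Finset.smul_sum, Finset.smul_sum, Finset.smul_sum, ← Finset.sum_sub_distrib,
        ← Finset.sum_neg_distrib]
      refine Finset.sum_congr rfl fun b hb => ?_
      have hbk : b ≠ k := fun h => hk (h ▸ hb)
      have hk' : k ∉ S.erase b := fun h => hk (Finset.mem_of_mem_erase h)
      rw [Finset.erase_insert_of_ne hbk.symm, Finset.prod_insert hk', Finset.prod_insert hk',
        bethe_insert hl' x hk', Matrix.mulVec_smul, smul_smul, smul_smul, smul_smul, ← sub_smul,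
        ← neg_smul]
      congr 1
      have key := lower_identity (η := η) (c := ξ j) (hjk b hb) rfl
      rw [← Finset.mul_prod_erase S _ hb]
      linear_combination (sinh η * aList η ξ l (x b) * ((∏ k ∈ S.erase b, sinh (x k - ξ j)) *
        ∏ k ∈ S.erase b, exch (-η) (x b) (x k))) * key

/-- Flipping the site `j` down adds `j` to the chain and `B(ξ_j)` to the Bethe vector. -/
theorem elemOp_one_zero_bethe (hl : (j :: l).Nodup) (x : ι → ℂ) {S : Finset ι} {p : ι}
    (hp : p ∉ S) (hxp : x p = ξ j) :
    bethe η ξ hl x (insert p S) = (aList η ξ (j :: l) (ξ j) * ∏ k ∈ S, sinh (x k - ξ j + η)) •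
      (elemOp j 1 0 *ᵥ bethe η ξ (List.nodup_cons.1 hl).2 x S) := by
  have hj := (List.nodup_cons.1 hl).1
  induction S using Finset.induction_on with
  | empty =>
    have hA : bulkA η ξ l (ξ j) *ᵥ vacuum M = aList η ξ l (ξ j) • vacuum M :=
      monoA_vacuum η ξ l (ξ j)
    rw [bethe_insert hl x hp, bethe_empty, bethe_empty, bulkB_cons hj, hxp, sub_self, add_mul,
      smul_mul_assoc, smul_mul_assoc, elemOp_mul_bulkB hj 1 1]
    simp [Matrix.add_mulVec, Matrix.smul_mulVec, ← Matrix.mulVec_mulVec, elemOp_vacuum,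
      hA, Matrix.mulVec_smul, smul_smul, aList]
  | insert k S hk ih =>
    have hp' : p ∉ S := fun h => hp (Finset.mem_insert_of_mem h)
    have hkp : k ∉ insert p S := by
      rw [Finset.mem_insert, not_or]
      exact ⟨fun h => hp (h ▸ Finset.mem_insert_self _ _), hk⟩
    have h : bulkB η ξ (j :: l) (x k) * elemOp j 1 0 =
        sinh (x k - ξ j + η) • (elemOp j 1 0 * bulkB η ξ l (x k)) := by
      rw [bulkB_cons hj, add_mul, smul_mul_assoc, mul_assoc, mul_assoc, ← elemOp_mul_bulkB hj,
        ← elemOp_mul_bulkA hj]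
      simp [add_mul, ← mul_assoc, elemOp_mul]
    rw [Finset.insert_comm, bethe_insert hl x hkp, ih hp', Matrix.mulVec_smul,
      Matrix.mulVec_mulVec, h, Matrix.smul_mulVec, ← Matrix.mulVec_mulVec, smul_smul,
      Finset.prod_insert hk, bethe_insert _ x hk]
    congr 1
    ring

theorem elemOp_sum (j : Fin M) : elemOp j 0 0 + elemOp j 1 1 = 1 := by
  rw [elemOp, elemOp, ← siteOp_add, ← siteOp_one j]
  congr 1
  ext c d
  fin_cases c <;> fin_cases d <;> simp

/-- A Bethe vector of the chain without the site `j`, expanded in those of the chain with it: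
either `B(ξ_j)` is added and some `B(x_b)` is removed, or (for `b = p`) nothing changes. -/
theorem bethe_eq_sum_cons (hl : (j :: l).Nodup) (x : ι → ℂ) {S : Finset ι} {p : ι}
    (hp : p ∉ S) (hxp : x p = ξ j)
    (hx : ∀ k ∈ insert p S, ∀ k' ∈ insert p S, k ≠ k' → sinh (x k - x k') ≠ 0)
    (hη : ∀ k ∈ S, sinh (x k - ξ j + η) ≠ 0) (ha : aList η ξ (j :: l) (ξ j) ≠ 0) :
    bethe η ξ (List.nodup_cons.1 hl).2 x S = ∑ b ∈ insert p S,
      ((aList η ξ (j :: l) (ξ j))⁻¹ * (∏ k ∈ S.erase b, (sinh (x k - ξ j + η))⁻¹) *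
        (sinh η * aList η ξ l (x b) * (if b = p then 1 else (sinh (ξ j - x b))⁻¹) *
          ∏ k ∈ S.erase b, exch (-η) (x b) (x k))) •
        bethe η ξ hl x ((insert p S).erase b) := by
  have hx' : ∀ k ∈ S, ∀ k' ∈ S, k ≠ k' → sinh (x k - x k') ≠ 0 := fun k hk k' hk' =>
    hx k (Finset.mem_insert_of_mem hk) k' (Finset.mem_insert_of_mem hk')
  have hξ : ∀ k ∈ S, sinh (x k - ξ j) ≠ 0 := fun k hk => by
    rw [← hxp]
    exact hx k (Finset.mem_insert_of_mem hk) p (Finset.mem_insert_self _ _)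
      (fun h => hp (h ▸ hk))
  have hneg : ∀ u v, sinh (u - v) = -sinh (v - u) := fun u v => by
    rw [← sinh_neg]; congr 1; ring
  have hP : ∏ k ∈ S, sinh (x k - ξ j) ≠ 0 := Finset.prod_ne_zero_iff.2 hξ
  -- Split the identity at site `j` as `E^{11} + E^{21} E^{12}`: the first part is the vector of the
  -- short chain, the second one is known from flipping `j` up and then down again.
  have h1 : bethe η ξ hl x S = (∏ k ∈ S, sinh (x k - ξ j)) •
      bethe η ξ (List.nodup_cons.1 hl).2 x S + elemOp j 1 0 *ᵥ (elemOp j 0 1 *ᵥ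
        bethe η ξ hl x S) := by
    rw [← elemOp_zero_zero_bethe, Matrix.mulVec_mulVec, elemOp_mul, if_pos rfl,
      ← Matrix.add_mulVec, elemOp_sum, Matrix.one_mulVec]
  have h2 : ∀ b ∈ S, elemOp j 1 0 *ᵥ bethe η ξ (List.nodup_cons.1 hl).2 x (S.erase b) =
      ((aList η ξ (j :: l) (ξ j))⁻¹ * ∏ k ∈ S.erase b, (sinh (x k - ξ j + η))⁻¹) •
        bethe η ξ hl x ((insert p S).erase b) := by
    intro b hb
    have hpb : p ≠ b := fun h => hp (h ▸ hb)
    have hpS : p ∉ S.erase b := fun h => hp (Finset.mem_of_mem_erase h)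
    rw [Finset.erase_insert_of_ne hpb, elemOp_one_zero_bethe hl x hpS hxp, smul_smul,
      Finset.prod_inv_distrib, ← mul_inv, inv_mul_cancel₀, one_smul]
    exact mul_ne_zero ha (Finset.prod_ne_zero_iff.2 fun k hk => hη k (Finset.mem_of_mem_erase hk))
  have h3 : bethe η ξ (List.nodup_cons.1 hl).2 x S = (∏ k ∈ S, sinh (x k - ξ j))⁻¹ •
      bethe η ξ hl x S - (∏ k ∈ S, sinh (x k - ξ j))⁻¹ • (elemOp j 1 0 *ᵥ (elemOp j 0 1 *ᵥ
        bethe η ξ hl x S)) := by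
    rw [← smul_sub, eq_inv_smul_iff₀ hP]
    exact eq_sub_of_add_eq h1.symm
  rw [h3, elemOp_zero_one_bethe hl x S hx', Finset.sum_insert hp, Finset.erase_insert hp,
    Finset.erase_eq_of_notMem hp, if_pos rfl, Matrix.mulVec_sum, sub_eq_add_neg,
    Finset.smul_sum, ← Finset.sum_neg_distrib]
  congr 1
  · congr 1
    have e : ∀ k ∈ S, (sinh (x k - ξ j))⁻¹ = (sinh (x k - ξ j + η))⁻¹ * exch (-η) (x p) (x k) := by
      intro k hk
      have e1 : sinh (ξ j - x k + -η) = -sinh (x k - ξ j + η) := by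
        rw [← sinh_neg]; congr 1; ring
      have := hξ k hk
      have := hη k hk
      rw [exch, hxp, e1, hneg (ξ j)]
      field_simp
    rw [← Finset.prod_inv_distrib, Finset.prod_congr rfl e, Finset.prod_mul_distrib]
    have ha' : aList η ξ (j :: l) (ξ j) = sinh η * aList η ξ l (x p) := by simp [aList, hxp]
    rw [ha'] at ha ⊢
    have := left_ne_zero_of_mul ha
    have := right_ne_zero_of_mul ha
    field_simp
  · refine Finset.sum_congr rfl fun b hb => ?_
    have hpb : b ≠ p := fun h => hp (h ▸ hb)
    rw [Matrix.mulVec_smul, h2 b hb, smul_smul, smul_smul, ← neg_smul, if_neg hpb, hneg (ξ j),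
      ← Finset.mul_prod_erase S _ hb]
    congr 1
    have := hξ b hb
    have : ∏ k ∈ S.erase b, sinh (x k - ξ j) ≠ 0 :=
      Finset.prod_ne_zero_iff.2 fun k hk => hξ k (Finset.mem_of_mem_erase hk)
    field_simp

theorem bulkD_vacuum (u : ℂ) :
    bulkD η ξ (List.finRange M) u *ᵥ vacuum M = dFun ξ u • vacuum M := by
  have h := monoD_vacuum η ξ (List.nodup_finRange M) u
  rw [← List.ofFn_eq_map, List.prod_ofFn] at h
  exact h

end

/-! ### The boundary-bulk relation -/

section

variable {M : ℕ} {η : ℂ} {ξ : Fin M → ℂ} {l : List (Fin M)} {ι : Type}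

theorem sinh_mul_sinh (a b : ℂ) : sinh a * sinh b = (cosh (a + b) - cosh (a - b)) / 2 := by
  rw [cosh_add, cosh_sub]; ring

theorem RauxFlip_eq (η : ℂ) (j : Fin M) (u : ℂ) (a b : Fin 2) :
    RauxFlip η j u a b = Raux η j u a b := by
  unfold RauxFlip Raux
  congr 1
  funext c d
  fin_cases a <;> fin_cases b <;> fin_cases c <;> fin_cases d <;> rfl

theorem RauxFlip_crossing (η : ℂ) (j : Fin M) (u x : ℂ) (a b : Fin 2) :
    RauxFlip η j (u + x - η) a b =
      (if a = b then (-1 : ℂ) else 1) • Raux η j (-u - x) b.rev a.rev := by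
  have e1 : sinh (-u - x) = -sinh (u + x - η + η) := by rw [← sinh_neg]; congr 1; ring
  have e2 : sinh (-u - x + η) = -sinh (u + x - η) := by rw [← sinh_neg]; congr 1; ring
  rw [RauxFlip_eq]
  fin_cases a <;> fin_cases b <;>
    simp [Raux_zero_zero, Raux_zero_one, Raux_one_zero, Raux_one_one, e1, e2, Fin.rev]

/-- Crossing: the entries of `T̂(u)` are, up to signs, those of `σ^y T^{t₀}(-u) σ^y`. -/
theorem hat_crossing (η : ℂ) (ξ : Fin M → ℂ) (hl : l.Nodup) (u : ℂ) (a b : Fin 2) :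
    (l.map fun j => RauxFlip η j (u + ξ j - η)).prod a b =
      ((-1) ^ l.length * if a = b then (1 : ℂ) else -1) • mono η ξ l (-u) b.rev a.rev := by
  induction l generalizing a b with
  | nil =>
    fin_cases a <;> fin_cases b <;> simp [mono_nil, Fin.rev]
  | cons j l ih =>
    rw [List.nodup_cons] at hl
    have hc : ∀ a b c d, Raux η j (-u - ξ j) a b * mono η ξ l (-u) c d =
        mono η ξ l (-u) c d * Raux η j (-u - ξ j) a b :=
      fun a b c d => (commute_mono η ξ hl.1 (auxMat η (-u - ξ j) a b) (-u) c d).eq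
    rw [List.map_cons, List.prod_cons, Matrix.mul_apply, mono_cons, Fin.sum_univ_two,
      Fin.sum_univ_two]
    simp only [ih hl.2, RauxFlip_crossing, smul_mul_smul_comm, hc, List.length_cons, smul_add,
      pow_succ]
    fin_cases a <;> fin_cases b <;> simp [Fin.rev] <;> abel

/-- The boundary creation operator in terms of the bulk operators. -/
theorem Bplus_eq (η ξp : ℂ) (ξ : Fin M → ℂ) (u : ℂ) :
    Bplus η ξp ξ u =
      ((-1) ^ M * sinh (u + η / 2 + ξp)) •
        (bulkB η ξ (List.finRange M) u * bulkD η ξ (List.finRange M) (-u))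
      - ((-1) ^ M * sinh (ξp - (u + η / 2))) •
        (bulkD η ξ (List.finRange M) u * bulkB η ξ (List.finRange M) (-u)) := by
  have h := hat_crossing η ξ (List.nodup_finRange M) u
  rw [← List.ofFn_eq_map] at h
  rw [Bplus, Uplus, Matrix.transpose_apply, Matrix.mul_apply, Fin.sum_univ_two,
    Matrix.mul_apply, Matrix.mul_apply, Fin.sum_univ_two, Fin.sum_univ_two]
  simp only [Matrix.transpose_apply, monodromy_eq_mono, monodromyHat, h, Kmat, bulkB, bulkD]
  simp [Fin.rev, smul_smul, mul_comm, sub_eq_add_neg]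

/-- The boundary creation operator in terms of the bulk operators, symmetrized in `u ↔ -u`. -/
theorem Bplus_eq_sum (η ξp : ℂ) (ξ : Fin M → ℂ) {u : ℂ} (hu : sinh (2 * u) ≠ 0) :
    Bplus η ξp ξ u = ∑ e : ℤˣ, (((e : ℤ) : ℂ) * (-1) ^ M * (sinh (2 * u + η) / sinh (2 * u)) *
      sinh (((e : ℤ) : ℂ) * u + ξp - η / 2)) •
        (bulkB η ξ (List.finRange M) (((e : ℤ) : ℂ) * u) *
          bulkD η ξ (List.finRange M) (-(((e : ℤ) : ℂ) * u))) := by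
  have e2 : u - -u = 2 * u := by ring
  have h := bulkD_mul_bulkB (η := η) (ξ := ξ) (List.nodup_finRange M) (u := u) (v := -u)
    (by rwa [e2])
  have key : sinh (u + η / 2 + ξp) * sinh (2 * u) + sinh (ξp - (u + η / 2)) * sinh η =
      sinh (2 * u + η) * sinh (u + ξp - η / 2) := by
    rw [sinh_mul_sinh, sinh_mul_sinh, sinh_mul_sinh,
      show ξp - (u + η / 2) + η = u + η / 2 + ξp - 2 * u by ring,
      show 2 * u + η + (u + ξp - η / 2) = u + η / 2 + ξp + 2 * u by ring,
      show 2 * u + η - (u + ξp - η / 2) = -(ξp - (u + η / 2) - η) by ring, cosh_neg]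
    ring
  have hu2 : (Finset.univ : Finset ℤˣ) = {1, -1} := rfl
  rw [Bplus_eq, h, hu2, Finset.sum_pair (by decide), e2, smul_sub, smul_smul, smul_smul]
  simp only [Units.val_one, Int.cast_one, one_mul, Units.val_neg, Int.cast_neg, neg_one_mul,
    neg_neg]
  rw [show -u + ξp - η / 2 = ξp - (u + η / 2) by ring]
  generalize bulkB η ξ (List.finRange M) u * _ = Y
  generalize bulkB η ξ (List.finRange M) (-u) * _ = Z
  have key' : sinh (u + η / 2 + ξp) + sinh (ξp - (u + η / 2)) * (sinh η / sinh (2 * u)) =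
      sinh (2 * u + η) / sinh (2 * u) * sinh (u + ξp - η / 2) := by
    rw [div_mul_eq_mul_div, eq_div_iff hu, add_mul, mul_assoc, div_mul_cancel₀ _ hu, key]
  match_scalars
  · linear_combination (-1) ^ M * key'
  · ring

/-- The families of signs that are `1` outside `S`. -/
def signsOn [Fintype ι] [DecidableEq ι] (S : Finset ι) : Finset (ι → ℤˣ) :=
  {σ | ∀ k, k ∉ S → σ k = 1}

theorem sum_signsOn_insert [Fintype ι] [DecidableEq ι] {E : Type*} [AddCommMonoid E]
    {S : Finset ι} {k : ι} (hk : k ∉ S) (F : (ι → ℤˣ) → E) :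
    ∑ σ ∈ signsOn (insert k S), F σ = ∑ σ ∈ signsOn S, ∑ e, F (Function.update σ k e) := by
  rw [← Finset.sum_product']
  symm
  refine Finset.sum_bij' (fun p _ => Function.update p.1 k p.2)
    (fun σ _ => (Function.update σ k 1, σ k)) ?_ ?_ ?_ ?_ ?_
  · rintro ⟨σ, e⟩ h
    simp only [signsOn, Finset.mem_product, Finset.mem_filter, Finset.mem_univ, true_and,
      and_true, Finset.mem_insert, not_or] at h ⊢
    intro i hi
    rw [Function.update_of_ne hi.1, h i hi.2]
  · intro σ h
    simp only [signsOn, Finset.mem_product, Finset.mem_filter, Finset.mem_univ, true_and,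
      and_true, Finset.mem_insert, not_or] at h ⊢
    intro i hi
    by_cases hik : i = k
    · subst hik; simp
    · rw [Function.update_of_ne hik, h i ⟨hik, hi⟩]
  · rintro ⟨σ, e⟩ h
    simp only [signsOn, Finset.mem_product, Finset.mem_filter, Finset.mem_univ, true_and,
      and_true] at h
    have := h k hk
    simp only [Function.update_idem, Function.update_self, Prod.mk.injEq, and_true]
    rw [← this, Function.update_eq_self]
  · intro σ _
    simp
  · rintro ⟨σ, e⟩ _
    rfl

theorem prod_pairs_insert [LinearOrder ι] {S : Finset ι} {k : ι} (hk : k ∉ S) {w : ι → ι → ℂ}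
    (hw : ∀ r s, w r s = w s r) :
    ∏ r ∈ insert k S, ∏ s ∈ insert k S with r < s, w r s =
      (∏ r ∈ S, w k r) * ∏ r ∈ S, ∏ s ∈ S with r < s, w r s := by
  rw [Finset.prod_insert hk, Finset.filter_insert, if_neg (lt_irrefl k)]
  have h : ∀ r ∈ S, ∏ s ∈ insert k S with r < s, w r s =
      (if r < k then w k r else 1) * ∏ s ∈ S with r < s, w r s := by
    intro r _
    rw [Finset.filter_insert]
    split_ifs with h
    · rw [Finset.prod_insert (fun h' => hk (Finset.mem_of_mem_filter _ h')), hw]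
    · rw [one_mul]
  rw [Finset.prod_congr rfl h, Finset.prod_mul_distrib, Finset.prod_filter, ← mul_assoc,
    ← Finset.prod_mul_distrib]
  congr 1
  refine Finset.prod_congr rfl fun r hr => ?_
  rcases lt_trichotomy k r with h | h | h
  · rw [if_pos h, if_neg h.asymm, mul_one]
  · exact absurd (h ▸ hr) hk
  · rw [if_neg h.asymm, if_pos h, one_mul]

/-- The factor of one variable `u` with sign `e` in the coefficient `H_σ`. -/
noncomputable def bdryFactor (η ξp : ℂ) (ξ : Fin M → ℂ) (e : ℤˣ) (u : ℂ) : ℂ :=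
  ((e : ℤ) : ℂ) * (-1) ^ M * dFun ξ (-(((e : ℤ) : ℂ) * u)) * (sinh (2 * u + η) / sinh (2 * u)) *
    sinh (((e : ℤ) : ℂ) * u + ξp - η / 2)

/-- The factor of a pair of variables in the coefficient `H_σ`. -/
noncomputable def pairFactor (η u v : ℂ) : ℂ := sinh (u + v - η) / sinh (u + v)

theorem pairFactor_comm (η u v : ℂ) : pairFactor η u v = pairFactor η v u := by
  rw [pairFactor, pairFactor, add_comm]

theorem HBplus_empty [LinearOrder ι] (ξp : ℂ) (σ : ι → ℤˣ) (x : ι → ℂ) :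
    HBplus η ξp ξ ∅ σ x = 1 := by simp [HBplus]

theorem HBplus_insert [LinearOrder ι] (ξp : ℂ) {S : Finset ι} {k : ι} (hk : k ∉ S)
    (σ : ι → ℤˣ) (x : ι → ℂ) :
    HBplus η ξp ξ (insert k S) σ x = bdryFactor η ξp ξ (σ k) (x k) *
      (∏ r ∈ S, pairFactor η (sgn σ x k) (sgn σ x r)) * HBplus η ξp ξ S σ x := by
  have h := prod_pairs_insert hk (w := fun r s => pairFactor η (sgn σ x r) (sgn σ x s))
    fun r s => pairFactor_comm _ _ _
  simp only [pairFactor] at h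
  rw [HBplus, HBplus, h, Finset.prod_insert hk]
  simp only [pairFactor, bdryFactor, sgn]
  ring

theorem HBplus_congr [LinearOrder ι] (ξp : ℂ) {S : Finset ι} {σ τ : ι → ℤˣ} (x : ι → ℂ)
    (h : ∀ k ∈ S, σ k = τ k) : HBplus η ξp ξ S σ x = HBplus η ξp ξ S τ x := by
  induction S using Finset.induction_on with
  | empty => rw [HBplus_empty, HBplus_empty]
  | insert k S hk ih =>
    rw [HBplus_insert ξp hk, HBplus_insert ξp hk, h k (Finset.mem_insert_self _ _),
      ih fun r hr => h r (Finset.mem_insert_of_mem hr)]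
    congr 2
    refine Finset.prod_congr rfl fun r hr => ?_
    rw [sgn, sgn, sgn, sgn, h k (Finset.mem_insert_self _ _), h r (Finset.mem_insert_of_mem hr)]

theorem sum_signs {E : Type*} [AddCommMonoid E] (F : ℤˣ → E) : ∑ e, F e = F 1 + F (-1) := by
  rw [show (Finset.univ : Finset ℤˣ) = {1, -1} from rfl, Finset.sum_pair (by decide)]

/-- The identity behind the cancellation of the unwanted terms. -/
theorem boundary_identity {u v c : ℂ} (h1 : sinh (u + v) ≠ 0) (h2 : sinh (u - v) ≠ 0) :
    ∑ e' : ℤˣ, ∑ e : ℤˣ, ((e : ℤ) : ℂ) * ((e' : ℤ) : ℂ) * sinh (((e : ℤ) : ℂ) * u + c) *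
      sinh (((e' : ℤ) : ℂ) * v + c) / sinh (((e : ℤ) : ℂ) * u + ((e' : ℤ) : ℂ) * v) = 0 := by
  simp only [sum_signs, Units.val_one, Int.cast_one, one_mul, Units.val_neg, Int.cast_neg,
    neg_one_mul, neg_neg]
  rw [show -u + -v = -(u + v) by ring, show u + -v = u - v by ring,
    show -u + v = -(u - v) by ring, sinh_neg, sinh_neg]
  field_simp
  simp only [sinh_add, sinh_sub, cosh_neg, sinh_neg]
  ring

/-- This product does not see the sign of its first variable. -/
theorem pairFactor_mul_exch_neg (a b : ℂ) :
    pairFactor η (-a) b * exch η (-a) b = pairFactor η a b * exch η a b := by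
  rw [pairFactor, pairFactor, exch, exch,
    show -a + b - η = -(a - b + η) by ring, show -a + b = -(a - b) by ring,
    show -a - b + η = -(a + b - η) by ring, show -a - b = -(a + b) by ring]
  simp only [sinh_neg, neg_div_neg_eq]
  ring

theorem pairFactor_eq_exch (a b : ℂ) : pairFactor η a b = exch η (-a) b := by
  rw [pairFactor, exch, show -a - b + η = -(a + b - η) by ring, show -a - b = -(a + b) by ring]
  simp only [sinh_neg, neg_div_neg_eq]

theorem sgn_update_self [DecidableEq ι] (σ : ι → ℤˣ) (x : ι → ℂ) (k : ι) (e : ℤˣ) :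
    sgn (Function.update σ k e) x k = ((e : ℤ) : ℂ) * x k := by simp [sgn]

theorem sgn_update_of_ne [DecidableEq ι] (σ : ι → ℤˣ) (x : ι → ℂ) {k r : ι} (h : r ≠ k) (e : ℤˣ) :
    sgn (Function.update σ k e) x r = sgn σ x r := by simp [sgn, h]

theorem sinh_sign_ne_zero {u v : ℂ} (h : ∀ e : ℤˣ, sinh (u + ((e : ℤ) : ℂ) * v) ≠ 0)
    (e e' : ℤˣ) : sinh (((e : ℤ) : ℂ) * u + ((e' : ℤ) : ℂ) * v) ≠ 0 := by
  rcases Int.units_eq_one_or e with rfl | rfl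
  · simpa using h e'
  · have h1 := h (-e')
    rw [← neg_ne_zero, ← sinh_neg] at h1
    convert h1 using 2
    push_cast
    ring

/-- In the action of `𝓑_+(u)` on the bulk expansion, the terms in which `D` has exchanged its
argument with `B(x_b)` cancel when summed over the signs of `u` and `x_b`. -/
theorem unwanted_sum_eq_zero [LinearOrder ι] [Fintype ι] (ξp : ℂ) (x : ι → ℂ) {S : Finset ι}
    {b : ι} (hb : b ∈ S) (u : ℂ) (hub : ∀ e : ℤˣ, sinh (u + ((e : ℤ) : ℂ) * x b) ≠ 0) :
    ∑ σ ∈ signsOn S, ∑ e : ℤˣ,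
      (((e : ℤ) : ℂ) * (-1) ^ M * (sinh (2 * u + η) / sinh (2 * u)) *
        sinh (((e : ℤ) : ℂ) * u + ξp - η / 2) * HBplus η ξp ξ S σ x *
        (sinh η / sinh (-(((e : ℤ) : ℂ) * u) - sgn σ x b) * (dFun ξ (sgn σ x b) *
          ∏ r ∈ S.erase b, exch η (sgn σ x b) (sgn σ x r)))) •
      (bulkB η ξ (List.finRange M) (((e : ℤ) : ℂ) * u) *ᵥ
        (bulkB η ξ (List.finRange M) (-(((e : ℤ) : ℂ) * u)) *ᵥ
        bethe η ξ (List.nodup_finRange M) (sgn σ x) (S.erase b))) = 0 := by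
  obtain ⟨T, hT, rfl⟩ : ∃ T, b ∉ T ∧ insert b T = S :=
    ⟨S.erase b, Finset.notMem_erase _ _, Finset.insert_erase hb⟩
  rw [sum_signsOn_insert hT, Finset.erase_insert hT]
  refine Finset.sum_eq_zero fun σ _ => ?_
  have hne : ∀ r ∈ T, r ≠ b := fun r hr h => hT (h ▸ hr)
  have hBB : ∀ e : ℤˣ, bulkB η ξ (List.finRange M) (((e : ℤ) : ℂ) * u) *
      bulkB η ξ (List.finRange M) (-(((e : ℤ) : ℂ) * u)) =
      bulkB η ξ (List.finRange M) u * bulkB η ξ (List.finRange M) (-u) := by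
    intro e
    rcases Int.units_eq_one_or e with rfl | rfl
    · simp
    · simpa using (bulkB_commute (List.nodup_finRange M) (-u) u).eq
  have hψ : ∀ e', bethe η ξ (List.nodup_finRange M) (sgn (Function.update σ b e') x) T =
      bethe η ξ (List.nodup_finRange M) (sgn σ x) T := fun e' =>
    bethe_congr _ fun r hr => sgn_update_of_ne σ x (hne r hr) e'
  have hH : ∀ e', HBplus η ξp ξ (insert b T) (Function.update σ b e') x =
      bdryFactor η ξp ξ e' (x b) *
        (∏ r ∈ T, pairFactor η (((e' : ℤ) : ℂ) * x b) (sgn σ x r)) * HBplus η ξp ξ T σ x := by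
    intro e'
    rw [HBplus_insert ξp hT, Function.update_self, sgn_update_self,
      HBplus_congr ξp x fun r hr => Function.update_of_ne (hne r hr) _ _]
    congr 2
    exact Finset.prod_congr rfl fun r hr => by rw [sgn_update_of_ne σ x (hne r hr)]
  have hE : ∀ e' : ℤˣ, ∏ r ∈ T, exch η (((e' : ℤ) : ℂ) * x b) (sgn (Function.update σ b e') x r) =
      ∏ r ∈ T, exch η (((e' : ℤ) : ℂ) * x b) (sgn σ x r) := fun e' =>
    Finset.prod_congr rfl fun r hr => by rw [sgn_update_of_ne σ x (hne r hr)]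
  have hpe : ∀ e' : ℤˣ, (∏ r ∈ T, pairFactor η (((e' : ℤ) : ℂ) * x b) (sgn σ x r)) *
      ∏ r ∈ T, exch η (((e' : ℤ) : ℂ) * x b) (sgn σ x r) =
      ∏ r ∈ T, pairFactor η (x b) (sgn σ x r) * exch η (x b) (sgn σ x r) := by
    intro e'
    rw [← Finset.prod_mul_distrib]
    refine Finset.prod_congr rfl fun r _ => ?_
    rcases Int.units_eq_one_or e' with rfl | rfl
    · simp
    · simp [pairFactor_mul_exch_neg]
  have hd : ∀ e' : ℤˣ, dFun ξ (-(((e' : ℤ) : ℂ) * x b)) * dFun ξ (((e' : ℤ) : ℂ) * x b) =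
      dFun ξ (-x b) * dFun ξ (x b) := by
    intro e'
    rcases Int.units_eq_one_or e' with rfl | rfl
    · simp
    · simp [mul_comm]
  simp only [Matrix.mulVec_mulVec, hBB, hψ, hH, sgn_update_self, hE, ← Finset.sum_smul]
  convert zero_smul ℂ _
  have hid := boundary_identity (u := u) (v := x b) (c := ξp - η / 2) (by simpa using hub 1)
    (by simpa [sub_eq_add_neg] using hub (-1))
  rw [← mul_zero (-((-1) ^ M * (sinh (2 * u + η) / sinh (2 * u)) * (-1) ^ M *
    (sinh (2 * x b + η) / sinh (2 * x b)) * sinh η * (dFun ξ (-x b) * dFun ξ (x b)) *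
    (∏ r ∈ T, pairFactor η (x b) (sgn σ x r) * exch η (x b) (sgn σ x r)) *
    HBplus η ξp ξ T σ x)), ← hid, Finset.mul_sum]
  refine Finset.sum_congr rfl fun e' _ => ?_
  rw [Finset.mul_sum]
  refine Finset.sum_congr rfl fun e _ => ?_
  rw [← hd e', ← hpe e', bdryFactor, ← neg_add', sinh_neg, add_sub_assoc, add_sub_assoc]
  ring

/-- The boundary-bulk decomposition: a boundary state is a sum, over the signs of its variables,
of bulk Bethe vectors. -/
theorem boundary_bulk [LinearOrder ι] [Fintype ι] (ξp : ℂ) (x : ι → ℂ) {L : List ι}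
    (hL : L.Nodup) (h2 : ∀ k ∈ L, sinh (2 * x k) ≠ 0)
    (hx : ∀ k ∈ L, ∀ r ∈ L, k ≠ r → ∀ e : ℤˣ, sinh (x k + ((e : ℤ) : ℂ) * x r) ≠ 0) :
    (L.map fun k => Bplus η ξp ξ (x k)).prod *ᵥ vacuum M =
      ∑ σ ∈ signsOn L.toFinset, HBplus η ξp ξ L.toFinset σ x •
        bethe η ξ (List.nodup_finRange M) (sgn σ x) L.toFinset := by
  induction L with
  | nil =>
    have h : signsOn (∅ : Finset ι) = {1} := by
      ext σ
      simp [signsOn, funext_iff]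
    simp [h, HBplus_empty, bethe_empty]
  | cons k L ih =>
    rw [List.nodup_cons] at hL
    have hxL : ∀ k ∈ L, ∀ r ∈ L, k ≠ r → ∀ e : ℤˣ, sinh (x k + ((e : ℤ) : ℂ) * x r) ≠ 0 :=
      fun k hk r hr => hx k (List.mem_cons_of_mem _ hk) r (List.mem_cons_of_mem _ hr)
    have hkr : ∀ r ∈ L, ∀ e : ℤˣ, sinh (x k + ((e : ℤ) : ℂ) * x r) ≠ 0 := fun r hr =>
      hx k List.mem_cons_self r (List.mem_cons_of_mem _ hr) fun h => hL.1 (h ▸ hr)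
    have hkS : k ∉ L.toFinset := by simpa using hL.1
    have hne : ∀ r ∈ L.toFinset, r ≠ k := fun r hr h => hkS (h ▸ hr)
    have hD : ∀ (σ : ι → ℤˣ) (e : ℤˣ), bulkD η ξ (List.finRange M) (-(((e : ℤ) : ℂ) * x k)) *ᵥ
        bethe η ξ (List.nodup_finRange M) (sgn σ x) L.toFinset = _ := fun σ e =>
      exchange_action (List.nodup_finRange M)
        (fun u v h => bulkD_mul_bulkB (List.nodup_finRange M) h) bulkD_vacuum
        (sgn σ x) L.toFinset (-(((e : ℤ) : ℂ) * x k))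
        (by
          intro r hr
          have := sinh_sign_ne_zero (hkr r (by simpa using hr)) e (σ r)
          rwa [sgn, ← neg_add', sinh_neg, neg_ne_zero])
        (by
          intro r hr r' hr' hrr
          have := sinh_sign_ne_zero (hxL r (by simpa using hr) r' (by simpa using hr') hrr)
            (σ r) (-σ r')
          rw [sgn, sgn]
          convert this using 2
          push_cast
          ring)
    rw [List.map_cons, List.prod_cons, ← Matrix.mulVec_mulVec,
      ih hL.2 (fun k hk => h2 k (List.mem_cons_of_mem _ hk)) hxL,
      Bplus_eq_sum _ _ _ (h2 k List.mem_cons_self), Matrix.mulVec_sum, List.toFinset_cons,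
      sum_signsOn_insert hkS]
    have hunw : ∑ σ ∈ signsOn L.toFinset, ∑ e : ℤˣ, ∑ b ∈ L.toFinset,
      (((e : ℤ) : ℂ) * (-1) ^ M * (sinh (2 * x k + η) / sinh (2 * x k)) *
        sinh (((e : ℤ) : ℂ) * x k + ξp - η / 2) * HBplus η ξp ξ L.toFinset σ x *
        (sinh η / sinh (-(((e : ℤ) : ℂ) * x k) - sgn σ x b) * (dFun ξ (sgn σ x b) *
          ∏ r ∈ L.toFinset.erase b, exch η (sgn σ x b) (sgn σ x r)))) •
      (bulkB η ξ (List.finRange M) (((e : ℤ) : ℂ) * x k) *ᵥ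
        (bulkB η ξ (List.finRange M) (-(((e : ℤ) : ℂ) * x k)) *ᵥ
        bethe η ξ (List.nodup_finRange M) (sgn σ x) (L.toFinset.erase b))) = 0 := by
      simp only [Finset.sum_comm (t := L.toFinset)]
      exact Finset.sum_eq_zero fun b hb =>
        unwanted_sum_eq_zero ξp x hb _ (hkr b (by simpa using hb))
    -- What remains are the terms in which `D` has kept its argument.
    rw [← sub_zero (∑ σ ∈ _, ∑ e, _), ← hunw, ← Finset.sum_sub_distrib]
    refine Finset.sum_congr rfl fun σ _ => ?_
    rw [← Finset.sum_sub_distrib, Matrix.mulVec_smul, Matrix.sum_mulVec, Finset.smul_sum]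
    refine Finset.sum_congr rfl fun e _ => ?_
    rw [Matrix.smul_mulVec, ← Matrix.mulVec_mulVec, hD, Matrix.mulVec_sub, Matrix.mulVec_smul,
      Matrix.mulVec_sum, smul_sub, smul_sub, Finset.smul_sum, Finset.smul_sum, smul_smul, smul_smul]
    congr 1
    · rw [bethe_insert _ _ hkS, HBplus_insert ξp hkS, Function.update_self, sgn_update_self,
        bethe_congr _ fun r hr => sgn_update_of_ne σ x (hne r hr) e,
        HBplus_congr (σ := Function.update σ k e) (τ := σ) ξp x
          fun r hr => Function.update_of_ne (hne r hr) _ _]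
      congr 1
      have hp : ∏ r ∈ L.toFinset,
          pairFactor η (((e : ℤ) : ℂ) * x k) (sgn (Function.update σ k e) x r) =
          ∏ r ∈ L.toFinset, exch η (-(((e : ℤ) : ℂ) * x k)) (sgn σ x r) :=
        Finset.prod_congr rfl fun r hr => by
          rw [sgn_update_of_ne σ x (hne r hr), pairFactor_eq_exch]
      rw [hp, bdryFactor]
      ring
    · refine Finset.sum_congr rfl fun b _ => ?_
      rw [Matrix.mulVec_smul, smul_smul, smul_smul]
      congr 1
      ring

end

/-! ### The action of a product of local operators on a bulk Bethe vector -/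

section

variable {M N m : ℕ}

/-- The sites of the chain from the site `t` on (counted from `0`). -/
def chain (M t : ℕ) : List (Fin M) := (List.finRange M).drop t

theorem chain_nodup (M t : ℕ) : (chain M t).Nodup :=
  (List.nodup_finRange M).sublist (List.drop_sublist _ _)

theorem chain_eq_cons (j : Fin M) : chain M j = j :: chain M (j + 1) := by
  rw [chain, List.drop_eq_getElem_cons (by simp)]
  simp [chain]

theorem cons_chain_nodup (j : Fin M) : (j :: chain M (j + 1)).Nodup := by
  rw [← chain_eq_cons]; exact chain_nodup M j

theorem bethe_list_congr {ι : Type} {η : ℂ} {ξ : Fin M → ℂ} {l l' : List (Fin M)} (h : l = l')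
    (hl : l.Nodup) (hl' : l'.Nodup) (x : ι → ℂ) (S : Finset ι) :
    bethe η ξ hl x S = bethe η ξ hl' x S := by
  subst h; rfl

/-- The Bethe vector of the chain of the sites from `t` on. -/
noncomputable def betheFrom {ι : Type} (η : ℂ) (ξ : Fin M → ℂ) (t : ℕ) (y : ι → ℂ) (S : Finset ι) :
    (Fin M → Fin 2) → ℂ :=
  bethe η ξ (chain_nodup M t) y S

theorem betheFrom_eq {ι : Type} {η : ℂ} {ξ : Fin M → ℂ} (j : Fin M) (y : ι → ℂ) (S : Finset ι) :
    betheFrom η ξ j y S = bethe η ξ (cons_chain_nodup j) y S :=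
  bethe_list_congr (chain_eq_cons j) _ _ _ _

section steps

variable {ι : Type} [DecidableEq ι] {η : ℂ} {ξ : Fin M → ℂ} (hm : m ≤ M)

/-- Projecting the first site of the chain on spin up. -/
theorem flip_up_up (t : Fin m) (y : ι → ℂ) (S : Finset ι) :
    elemOp (Fin.castLE hm t) 0 0 *ᵥ betheFrom η ξ t y S =
      (∏ k ∈ S, sinh (y k - ξ (Fin.castLE hm t))) • betheFrom η ξ (t + 1) y S :=
  (congrArg _ (betheFrom_eq (Fin.castLE hm t) y S)).trans
    (elemOp_zero_zero_bethe (cons_chain_nodup (Fin.castLE hm t)) y S)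

/-- Flipping the first site of the chain up. -/
theorem flip_up_down (t : Fin m) (y : ι → ℂ) (S : Finset ι)
    (hy : ∀ k k', k ≠ k' → sinh (y k - y k') ≠ 0) :
    elemOp (Fin.castLE hm t) 0 1 *ᵥ betheFrom η ξ t y S =
      ∑ b ∈ S, (sinh η * aList η ξ (chain M (t + 1)) (y b) *
        ((∏ k ∈ S.erase b, sinh (y k - ξ (Fin.castLE hm t))) *
          ∏ k ∈ S.erase b, exch (-η) (y b) (y k))) • betheFrom η ξ (t + 1) y (S.erase b) :=
  (congrArg _ (betheFrom_eq (Fin.castLE hm t) y S)).trans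
    (elemOp_zero_one_bethe (cons_chain_nodup (Fin.castLE hm t)) y S fun k _ k' _ => hy k k')

/-- Putting a site back with spin down. -/
theorem put_down (t : Fin m) (y : ι → ℂ) {S : Finset ι} {p : ι} (hp : p ∉ S)
    (hyp : y p = ξ (Fin.castLE hm t)) :
    betheFrom η ξ t y (insert p S) = (aList η ξ (chain M t) (ξ (Fin.castLE hm t)) *
      ∏ k ∈ S, sinh (y k - ξ (Fin.castLE hm t) + η)) •
        (elemOp (Fin.castLE hm t) 1 0 *ᵥ betheFrom η ξ (t + 1) y S) := by
  have hch : chain M t = Fin.castLE hm t :: chain M (t + 1) := chain_eq_cons (Fin.castLE hm t)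
  rw [hch]
  exact (betheFrom_eq (Fin.castLE hm t) y _).trans
    (elemOp_one_zero_bethe (cons_chain_nodup (Fin.castLE hm t)) y hp hyp)

/-- Putting a site back with spin up. -/
theorem put_up (t : Fin m) (y : ι → ℂ) {S : Finset ι} {p : ι} (hp : p ∉ S)
    (hyp : y p = ξ (Fin.castLE hm t)) (hy : ∀ k k', k ≠ k' → sinh (y k - y k') ≠ 0)
    (hη : ∀ k ∈ S, sinh (y k - ξ (Fin.castLE hm t) + η) ≠ 0)
    (ha : aList η ξ (chain M t) (ξ (Fin.castLE hm t)) ≠ 0) :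
    elemOp (Fin.castLE hm t) 0 0 *ᵥ betheFrom η ξ (t + 1) y S = ∑ b ∈ insert p S,
      ((aList η ξ (chain M t) (ξ (Fin.castLE hm t)))⁻¹ *
        (∏ k ∈ S.erase b, (sinh (y k - ξ (Fin.castLE hm t) + η))⁻¹) *
        (sinh η * aList η ξ (chain M (t + 1)) (y b) *
          (if b = p then 1 else (sinh (ξ (Fin.castLE hm t) - y b))⁻¹) *
          ∏ k ∈ S.erase b, exch (-η) (y b) (y k))) •
        betheFrom η ξ t y ((insert p S).erase b) := by
  have hch : chain M t = Fin.castLE hm t :: chain M (t + 1) := chain_eq_cons (Fin.castLE hm t)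
  rw [hch] at ha ⊢
  have hb : ∀ T, betheFrom η ξ t y T = _ := fun T => betheFrom_eq (Fin.castLE hm t) y T
  simp only [hb]
  exact (elemOp_zero_zero_bethe_of_notMem _
    (List.nodup_cons.1 (cons_chain_nodup (Fin.castLE hm t))).1 y S).trans
    (bethe_eq_sum_cons (cons_chain_nodup (Fin.castLE hm t)) y hp hyp
      (fun k _ k' _ => hy k k') hη ha)

end steps

/-- The positions in the extended family of variables that are present once the sites from `t` on
have been added: `λ_1, …, λ_N` and the `ξ_j` with `j ≥ t`. -/
def posSet (N m t : ℕ) : Finset (Fin (N + m)) := {k | (k : ℕ) + t < N + m}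

theorem xiPos_val (j : Fin m) : (xiPos N j : ℕ) = N + (m - (j + 1)) := by
  simp [xiPos, Fin.val_rev]

theorem posSet_eq_insert (j : Fin m) :
    posSet N m j = insert (xiPos N j) (posSet N m (j + 1)) := by
  ext k
  have := j.isLt
  have := k.isLt
  simp only [posSet, Finset.mem_filter, Finset.mem_univ, true_and, Finset.mem_insert, Fin.ext_iff,
    xiPos_val]
  omega

theorem xiPos_notMem_posSet (j : Fin m) {t : ℕ} (ht : (j : ℕ) + 1 ≤ t) :
    xiPos N j ∉ posSet N m t := by
  have := j.isLt
  simp only [posSet, Finset.mem_filter, Finset.mem_univ, true_and, xiPos_val]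
  omega

section families

variable {κ ι : Type} [DecidableEq κ] [DecidableEq ι]

theorem image_update {P : Finset κ} {p : κ} (hp : p ∉ P) (b : κ → ι) (β : ι) :
    P.image (Function.update b p β) = P.image b :=
  Finset.image_congr fun q hq => Function.update_of_ne (fun h : q = p => hp (h ▸ hq)) _ _

variable [Fintype κ] [Fintype ι]

/-- The families of distinct indices `b_p ∈ Q_p` for `p ∈ P`, with the value `b⁰_p` at the other
`p`. -/
def famOn (Q : κ → Finset ι) (b₀ : κ → ι) (P : Finset κ) : Finset (κ → ι) :=
  {b | (∀ p ∈ P, ∀ q ∈ P, b p = b q → p = q) ∧ (∀ p ∈ P, b p ∈ Q p) ∧ ∀ p, p ∉ P → b p = b₀ p}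

/-- Choosing `b_p` after the others: it avoids the values already taken. -/
theorem sum_famOn_insert {E : Type*} [AddCommMonoid E] (Q : κ → Finset ι) (b₀ : κ → ι)
    {P : Finset κ} {p : κ} (hp : p ∉ P) (F : (κ → ι) → E) :
    ∑ b ∈ famOn Q b₀ (insert p P), F b =
      ∑ b ∈ famOn Q b₀ P, ∑ β ∈ Q p \ P.image b, F (Function.update b p β) := by
  rw [Finset.sum_sigma']
  symm
  refine Finset.sum_bij' (fun c _ => Function.update c.1 p c.2)
    (fun b _ => ⟨Function.update b p (b₀ p), b p⟩) ?_ ?_ ?_ ?_ ?_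
  · rintro ⟨b, β⟩ h
    simp only [famOn, Finset.mem_sigma, Finset.mem_filter, Finset.mem_univ, true_and,
      Finset.mem_sdiff, Finset.mem_image, not_exists, not_and] at h ⊢
    obtain ⟨⟨h1, h2, h3⟩, h4, h5⟩ := h
    refine ⟨?_, ?_, ?_⟩
    · intro q hq r hr hqr
      by_cases hqp : q = p <;> by_cases hrp : r = p
      · rw [hqp, hrp]
      · subst hqp
        rw [Function.update_self, Function.update_of_ne hrp] at hqr
        exact absurd hqr.symm (h5 r (Finset.mem_of_mem_insert_of_ne hr hrp))
      · subst hrp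
        rw [Function.update_self, Function.update_of_ne hqp] at hqr
        exact absurd hqr (h5 q (Finset.mem_of_mem_insert_of_ne hq hqp))
      · rw [Function.update_of_ne hqp, Function.update_of_ne hrp] at hqr
        exact h1 q (Finset.mem_of_mem_insert_of_ne hq hqp) r
          (Finset.mem_of_mem_insert_of_ne hr hrp) hqr
    · intro q hq
      by_cases hqp : q = p
      · subst hqp; rwa [Function.update_self]
      · rw [Function.update_of_ne hqp]
        exact h2 q (Finset.mem_of_mem_insert_of_ne hq hqp)
    · intro q hq
      rw [Finset.mem_insert, not_or] at hq
      rw [Function.update_of_ne hq.1, h3 q hq.2]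
  · intro b h
    simp only [famOn, Finset.mem_sigma, Finset.mem_filter, Finset.mem_univ, true_and,
      Finset.mem_sdiff, Finset.mem_image, not_exists, not_and] at h ⊢
    obtain ⟨h1, h2, h3⟩ := h
    have hne : ∀ q ∈ P, q ≠ p := fun q hq h => hp (h ▸ hq)
    refine ⟨⟨?_, ?_, ?_⟩, ?_, ?_⟩
    · intro q hq r hr hqr
      rw [Function.update_of_ne (hne q hq), Function.update_of_ne (hne r hr)] at hqr
      exact h1 q (Finset.mem_insert_of_mem hq) r (Finset.mem_insert_of_mem hr) hqr
    · intro q hq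
      rw [Function.update_of_ne (hne q hq)]
      exact h2 q (Finset.mem_insert_of_mem hq)
    · intro q hq
      by_cases hqp : q = p
      · subst hqp; rw [Function.update_self]
      · rw [Function.update_of_ne hqp]
        exact h3 q fun h => (Finset.mem_insert.1 h).elim hqp hq
    · exact h2 p (Finset.mem_insert_self _ _)
    · intro q hq hqp
      rw [Function.update_of_ne (hne q hq)] at hqp
      exact hne q hq (h1 q (Finset.mem_insert_of_mem hq) p (Finset.mem_insert_self _ _) hqp)
  · rintro ⟨b, β⟩ h
    simp only [famOn, Finset.mem_sigma, Finset.mem_filter, Finset.mem_univ, true_and] at h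
    simp only [Function.update_idem, Function.update_self, ← h.1.2.2 p hp,
      Function.update_eq_self]
  · intro b _
    simp
  · rintro ⟨b, β⟩ _
    rfl

end families

/-- The order in which the sites are treated: the sites `j` with `ε'_j = 2` increasingly, as the
values of `i` at the `p < s`, and then the sites `j` with `ε_j = 1` decreasingly. -/
structure SiteOrder (ε ε' : Fin m → Fin 2) (i : Fin m → Fin m) (s : ℕ) : Prop where
  lt_of_lt : ∀ p q : Fin m, p < q → (q : ℕ) < s → i p < i q
  gt_of_lt : ∀ p q : Fin m, p < q → s ≤ (p : ℕ) → i q < i p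
  mem_minus : ∀ j, ε' j = 1 ↔ ∃ p : Fin m, (p : ℕ) < s ∧ i p = j
  mem_plus : ∀ j, ε j = 0 ↔ ∃ p : Fin m, s ≤ (p : ℕ) ∧ i p = j

namespace SiteOrder

variable {ε ε' : Fin m → Fin 2} {i : Fin m → Fin m} {s : ℕ} (h : SiteOrder ε ε' i s)
include h

theorem inj_minus {p q : Fin m} (hp : (p : ℕ) < s) (hq : (q : ℕ) < s) (hi : i p = i q) :
    p = q := by
  rcases lt_trichotomy p q with h' | h' | h'
  · exact absurd hi (h.lt_of_lt p q h' hq).ne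
  · exact h'
  · exact absurd hi (h.lt_of_lt q p h' hp).ne'

theorem inj_plus {p q : Fin m} (hp : s ≤ (p : ℕ)) (hq : s ≤ (q : ℕ)) (hi : i p = i q) :
    p = q := by
  rcases lt_trichotomy p q with h' | h' | h'
  · exact absurd hi (h.gt_of_lt p q h' hp).ne'
  · exact h'
  · exact absurd hi (h.gt_of_lt q p h' hq).ne

end SiteOrder

/-- The positions `p` whose index has been chosen once the sites before `t` have been flipped
up. -/
def chosenFlipping (i : Fin m → Fin m) (s t : ℕ) : Finset (Fin m) :=
  {p | (p : ℕ) < s ∧ (i p : ℕ) < t}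

/-- The positions `p` whose index has been chosen once the sites from `t` on have been put
back. -/
def chosenRestoring (i : Fin m → Fin m) (s t : ℕ) : Finset (Fin m) :=
  {p | (p : ℕ) < s ∨ t ≤ (i p : ℕ)}

/-- The variables among which `b_p` is chosen. -/
def choiceSet (N : ℕ) (i : Fin m → Fin m) (s : ℕ) (p : Fin m) : Finset (Fin (N + m)) :=
  if (p : ℕ) < s then posSet N m m else posSet N m (i p)

/-- The factor that arises when the site `j` is flipped up and taken off the chain. -/
noncomputable def flipFactor (hm : m ≤ M) (η : ℂ) (ξ : Fin M → ℂ) (y : Fin (N + m) → ℂ)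
    (i : Fin m → Fin m) (s : ℕ) (j : Fin m) (b : Fin m → Fin (N + m)) : ℂ :=
  (∏ k ∈ posSet N m m \ (chosenFlipping i s (j + 1)).image b, sinh (y k - ξ (Fin.castLE hm j))) *
    ∏ p ∈ Finset.univ.filter (fun p : Fin m => (p : ℕ) < s ∧ i p = j),
      (sinh η * aList η ξ (chain M (j + 1)) (y (b p)) *
      ∏ k ∈ posSet N m m \ (chosenFlipping i s (j + 1)).image b, exch (-η) (y (b p)) (y k))

/-- The factor that arises when the site `j` is put back into the chain. -/
noncomputable def restoreFactor (hm : m ≤ M) (η : ℂ) (ξ : Fin M → ℂ) (y : Fin (N + m) → ℂ)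
    (i : Fin m → Fin m) (s : ℕ) (j : Fin m) (b : Fin m → Fin (N + m)) : ℂ :=
  (aList η ξ (chain M j) (ξ (Fin.castLE hm j)))⁻¹ *
    (∏ k ∈ posSet N m (j + 1) \ (chosenRestoring i s j).image b,
      (sinh (y k - ξ (Fin.castLE hm j) + η))⁻¹) *
    ∏ p ∈ Finset.univ.filter (fun p : Fin m => s ≤ (p : ℕ) ∧ i p = j),
      (sinh η * aList η ξ (chain M (j + 1)) (y (b p)) *
      (if b p = xiPos N j then 1 else (sinh (ξ (Fin.castLE hm j) - y (b p)))⁻¹) *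
      ∏ k ∈ posSet N m (j + 1) \ (chosenRestoring i s j).image b, exch (-η) (y (b p)) (y k))

variable {hm : m ≤ M} {η : ℂ} {ξ : Fin M → ℂ} {y : Fin (N + m) → ℂ} {ε ε' : Fin m → Fin 2}
  {i : Fin m → Fin m} {s : ℕ}

theorem flipFactor_update {j : Fin m} {p : Fin m} (hp : p ∉ chosenFlipping i s (j + 1))
    (b : Fin m → Fin (N + m)) (β : Fin (N + m)) :
    flipFactor hm η ξ y i s j (Function.update b p β) = flipFactor hm η ξ y i s j b := by
  rw [flipFactor, flipFactor, image_update hp]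
  congr 1
  refine Finset.prod_congr rfl fun q hq => ?_
  rw [Function.update_of_ne]
  rintro rfl
  simp only [chosenFlipping, Finset.mem_filter, Finset.mem_univ, true_and] at hq hp
  exact hp ⟨hq.1, by rw [hq.2]; exact Nat.lt_succ_self _⟩

theorem restoreFactor_update {j : Fin m} {p : Fin m} (hp : p ∉ chosenRestoring i s j)
    (b : Fin m → Fin (N + m)) (β : Fin (N + m)) :
    restoreFactor hm η ξ y i s j (Function.update b p β) = restoreFactor hm η ξ y i s j b := by
  rw [restoreFactor, restoreFactor, image_update hp]
  congr 1
  refine Finset.prod_congr rfl fun q hq => ?_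
  rw [Function.update_of_ne]
  rintro rfl
  simp only [chosenRestoring, Finset.mem_filter, Finset.mem_univ, true_and] at hq hp
  exact hp (Or.inr (by rw [hq.2]))

theorem prod_lt_succ (F : Fin m → ℂ) (t : Fin m) :
    ∏ j ∈ Finset.univ.filter (fun j : Fin m => (j : ℕ) < (t : ℕ) + 1), F j =
      F t * ∏ j ∈ Finset.univ.filter (fun j : Fin m => (j : ℕ) < (t : ℕ)), F j := by
  rw [← Finset.prod_insert (by simp)]
  congr 1
  ext j
  simp only [Finset.mem_filter, Finset.mem_univ, true_and, Finset.mem_insert, Fin.ext_iff]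
  omega

theorem prod_ge_eq (F : Fin m → ℂ) (t : Fin m) :
    ∏ j ∈ Finset.univ.filter (fun j : Fin m => (t : ℕ) ≤ (j : ℕ)), F j =
      F t * ∏ j ∈ Finset.univ.filter (fun j : Fin m => (t : ℕ) + 1 ≤ (j : ℕ)), F j := by
  rw [← Finset.prod_insert (by simp)]
  congr 1
  ext j
  simp only [Finset.mem_filter, Finset.mem_univ, true_and, Finset.mem_insert, Fin.ext_iff]
  omega

theorem sdiff_insert_eq {α : Type*} [DecidableEq α] (S T : Finset α) (β : α) :
    S \ insert β T = (S \ T).erase β := by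
  ext k; simp only [Finset.mem_sdiff, Finset.mem_insert, Finset.mem_erase]; tauto

/-- The operator that flips the sites before `t` up, from the configuration `ε'`. -/
noncomputable def flipUp (hm : m ≤ M) (ε' : Fin m → Fin 2) (t : ℕ) : Op M :=
  (((List.finRange m).take t).map fun j => elemOp (Fin.castLE hm j) 0 (ε' j)).reverse.prod

theorem flipUp_succ (t : Fin m) :
    flipUp hm ε' (t + 1) = elemOp (Fin.castLE hm t) 0 (ε' t) * flipUp hm ε' t := by
  rw [flipUp, flipUp, List.take_succ_eq_append_getElem (by simp)]
  simp

/-- The operator that puts the sites from `t` on, which are up, into the configuration `ε`. -/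
noncomputable def setSpins (hm : m ≤ M) (ε : Fin m → Fin 2) (t : ℕ) : Op M :=
  (((List.finRange m).drop t).map fun j => elemOp (Fin.castLE hm j) (ε j) 0).prod

theorem setSpins_eq (t : Fin m) :
    setSpins hm ε t = elemOp (Fin.castLE hm t) (ε t) 0 * setSpins hm ε (t + 1) := by
  rw [setSpins, setSpins, List.drop_eq_getElem_cons (by simp)]
  simp

theorem zero_or_one (a : Fin 2) : a = 0 ∨ a = 1 := by revert a; decide

/-- Flipping the first `t` sites up, starting from a bulk Bethe vector. -/
theorem flipUp_betheFrom (h : SiteOrder ε ε' i s) (b₀ : Fin m → Fin (N + m))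
    (hy : ∀ k k', k ≠ k' → sinh (y k - y k') ≠ 0) (t : ℕ) (ht : t ≤ m) :
    flipUp hm ε' t *ᵥ betheFrom η ξ 0 y (posSet N m m) =
      ∑ b ∈ famOn (choiceSet N i s) b₀ (chosenFlipping i s t),
        (∏ j ∈ Finset.univ.filter (fun j : Fin m => (j : ℕ) < t), flipFactor hm η ξ y i s j b) •
          betheFrom η ξ t y (posSet N m m \ (chosenFlipping i s t).image b) := by
  induction t with
  | zero =>
    have h0 : chosenFlipping i s 0 = ∅ := by simp [chosenFlipping]
    have h1 : famOn (choiceSet N i s) b₀ (∅ : Finset (Fin m)) = {b₀} := by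
      ext b; simp [famOn, funext_iff]
    simp [h0, h1, flipUp]
  | succ t ih =>
    obtain ⟨t, rfl⟩ : ∃ t' : Fin m, t = t' := ⟨⟨t, ht⟩, rfl⟩
    rw [flipUp_succ, ← Matrix.mulVec_mulVec, ih t.isLt.le, Matrix.mulVec_sum]
    -- If `ε'_t` is down, then `t = i_p` for one `p < s`, and `b_p` is chosen now.
    rcases zero_or_one (ε' t) with he | he
    · have hno : ∀ p : Fin m, ¬ ((p : ℕ) < s ∧ i p = t) := by
        intro p hp
        have := (h.mem_minus t).2 ⟨p, hp⟩
        rw [he] at this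
        exact absurd this (by decide)
      have hdec : chosenFlipping i s (t + 1) = chosenFlipping i s t := by
        ext p
        have := hno p
        simp only [chosenFlipping, Finset.mem_filter, Finset.mem_univ, true_and, Fin.ext_iff] at this ⊢
        omega
      rw [hdec]
      refine Finset.sum_congr rfl fun b _ => ?_
      rw [Matrix.mulVec_smul, he, flip_up_up, smul_smul,
        prod_lt_succ, flipFactor, Finset.filter_false_of_mem fun p _ => hno p, Finset.prod_empty,
        mul_one, hdec, mul_comm]
    · obtain ⟨p, hp⟩ := (h.mem_minus t).1 he
      have hpn : p ∉ chosenFlipping i s t := by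
        simp only [chosenFlipping, Finset.mem_filter, Finset.mem_univ, true_and, hp.2]; omega
      have huniq : ∀ q : Fin m, ((q : ℕ) < s ∧ i q = t) ↔ q = p := fun q =>
        ⟨fun hq => h.inj_minus hq.1 hp.1 (hq.2.trans hp.2.symm), fun hq => hq ▸ hp⟩
      have hdec : chosenFlipping i s (t + 1) = insert p (chosenFlipping i s t) := by
        ext q
        have := huniq q
        simp only [chosenFlipping, Finset.mem_filter, Finset.mem_univ, true_and, Fin.ext_iff,
          Finset.mem_insert] at this ⊢
        omega
      have hQ : choiceSet N i s p = posSet N m m := if_pos hp.1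
      have hfil : (Finset.univ.filter fun q : Fin m => (q : ℕ) < s ∧ i q = t) = {p} := by
        ext q; simp [huniq q]
      rw [hdec, sum_famOn_insert _ _ hpn, hQ]
      refine Finset.sum_congr rfl fun b _ => ?_
      rw [Matrix.mulVec_smul, he, flip_up_down hm t y _ hy, Finset.smul_sum]
      refine Finset.sum_congr rfl fun β _ => ?_
      have hlt : ∏ j ∈ Finset.univ.filter (fun j : Fin m => (j : ℕ) < (t : ℕ)),
          flipFactor hm η ξ y i s j (Function.update b p β) =
          ∏ j ∈ Finset.univ.filter (fun j : Fin m => (j : ℕ) < (t : ℕ)),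
            flipFactor hm η ξ y i s j b := by
        refine Finset.prod_congr rfl fun j hj => flipFactor_update ?_ b β
        simp only [chosenFlipping, Finset.mem_filter, Finset.mem_univ, true_and, hp.2] at hj ⊢
        omega
      rw [smul_smul, prod_lt_succ, hlt, flipFactor, hfil, Finset.prod_singleton, hdec,
        Finset.image_insert, Function.update_self, image_update hpn, sdiff_insert_eq]
      congr 1
      ring

/-- The action on a bulk Bethe vector of the flips of all spins, with the sites from `t` on put
back into the chain. -/
theorem setSpins_betheFrom (h : SiteOrder ε ε' i s) (b₀ : Fin m → Fin (N + m))
    (hy : ∀ k k', k ≠ k' → sinh (y k - y k') ≠ 0)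
    (hξ : ∀ j, y (xiPos N j) = ξ (Fin.castLE hm j))
    (hη : ∀ k j, sinh (y k - ξ (Fin.castLE hm j) + η) ≠ 0)
    (ha : ∀ j : Fin m, aList η ξ (chain M j) (ξ (Fin.castLE hm j)) ≠ 0)
    (t : ℕ) (ht : t ≤ m) :
    setSpins hm ε t *ᵥ (flipUp hm ε' m *ᵥ betheFrom η ξ 0 y (posSet N m m)) =
      ∑ b ∈ famOn (choiceSet N i s) b₀ (chosenRestoring i s t),
        ((∏ j, flipFactor hm η ξ y i s j b) *
          ∏ j ∈ Finset.univ.filter (fun j : Fin m => t ≤ (j : ℕ)), restoreFactor hm η ξ y i s j b) •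
          betheFrom η ξ t y (posSet N m t \ (chosenRestoring i s t).image b) := by
  induction ht using Nat.decreasingInduction with
  | self =>
    have h0 : chosenRestoring i s m = chosenFlipping i s m := by
      ext p; have := (i p).isLt
      simp only [chosenFlipping, chosenRestoring, Finset.mem_filter, Finset.mem_univ, true_and]; omega
    have h1 : (Finset.univ.filter fun j : Fin m => m ≤ (j : ℕ)) = ∅ :=
      Finset.filter_false_of_mem fun j _ => by have := j.isLt; omega
    have h2 : (Finset.univ.filter fun j : Fin m => (j : ℕ) < m) = Finset.univ :=
      Finset.filter_true_of_mem fun j _ => j.isLt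
    have h3 : setSpins hm ε m = 1 := by
      rw [setSpins, List.drop_eq_nil_of_le (by simp), List.map_nil, List.prod_nil]
    rw [h3, Matrix.one_mulVec, flipUp_betheFrom h b₀ hy m le_rfl, h0, h1, h2]
    simp
  | of_succ t ht ih =>
    obtain ⟨t, rfl⟩ : ∃ t' : Fin m, t = t' := ⟨⟨t, ht⟩, rfl⟩
    have hpos : ∀ b ∈ famOn (choiceSet N i s) b₀ (chosenRestoring i s (t + 1)),
        xiPos N t ∉ (chosenRestoring i s (t + 1)).image b := by
      intro b hb hmem
      obtain ⟨q, hq, hqt⟩ := Finset.mem_image.1 hmem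
      simp only [famOn, Finset.mem_filter, Finset.mem_univ, true_and] at hb
      have hbq := hb.2.1 q hq
      simp only [chosenRestoring, Finset.mem_filter, Finset.mem_univ, true_and] at hq
      rw [hqt, choiceSet] at hbq
      split_ifs at hbq with hqs
      · exact xiPos_notMem_posSet t (by omega) hbq
      · exact xiPos_notMem_posSet t (by omega) hbq
    have hins : ∀ b ∈ famOn (choiceSet N i s) b₀ (chosenRestoring i s (t + 1)),
        posSet N m t \ (chosenRestoring i s (t + 1)).image b =
          insert (xiPos N t) (posSet N m (t + 1) \ (chosenRestoring i s (t + 1)).image b) := by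
      intro b hb
      rw [posSet_eq_insert, Finset.insert_sdiff_of_notMem _ (hpos b hb)]
    have hnot : ∀ b : Fin m → Fin (N + m),
        xiPos N t ∉ posSet N m (t + 1) \ (chosenRestoring i s (t + 1)).image b := fun b hb =>
      xiPos_notMem_posSet t le_rfl (Finset.mem_sdiff.1 hb).1
    rw [setSpins_eq, ← Matrix.mulVec_mulVec, ih, Matrix.mulVec_sum]
    -- If `ε_t` is up, then `t = i_p` for one `p ≥ s`, and `b_p` is chosen now, possibly as the
    -- position of `ξ_t` itself.
    rcases zero_or_one (ε t) with he | he
    · obtain ⟨p, hp⟩ := (h.mem_plus t).1 he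
      have hpn : p ∉ chosenRestoring i s (t + 1) := by
        simp only [chosenRestoring, Finset.mem_filter, Finset.mem_univ, true_and, hp.2]; omega
      have huniq : ∀ q : Fin m, (s ≤ (q : ℕ) ∧ i q = t) ↔ q = p := fun q =>
        ⟨fun hq => h.inj_plus hq.1 hp.1 (hq.2.trans hp.2.symm), fun hq => hq ▸ hp⟩
      have hdec : chosenRestoring i s t = insert p (chosenRestoring i s (t + 1)) := by
        ext q
        have := huniq q
        simp only [chosenRestoring, Finset.mem_filter, Finset.mem_univ, true_and, Fin.ext_iff,
          Finset.mem_insert] at this ⊢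
        omega
      have hQ : choiceSet N i s p = posSet N m t := by
        rw [choiceSet, if_neg (not_lt.2 hp.1), hp.2]
      have hfil : (Finset.univ.filter fun q : Fin m => s ≤ (q : ℕ) ∧ i q = t) = {p} := by
        ext q; simp [huniq q]
      rw [hdec, sum_famOn_insert _ _ hpn, hQ]
      refine Finset.sum_congr rfl fun b hb => ?_
      rw [Matrix.mulVec_smul, he, put_up hm t y (hnot b) (hξ t) hy (fun k _ => hη k t) (ha t),
        Finset.smul_sum, hins b hb]
      refine Finset.sum_congr rfl fun β _ => ?_
      have hge : ∏ j ∈ Finset.univ.filter (fun j : Fin m => (t : ℕ) + 1 ≤ (j : ℕ)),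
          restoreFactor hm η ξ y i s j (Function.update b p β) =
          ∏ j ∈ Finset.univ.filter (fun j : Fin m => (t : ℕ) + 1 ≤ (j : ℕ)),
            restoreFactor hm η ξ y i s j b := by
        refine Finset.prod_congr rfl fun j hj => restoreFactor_update ?_ b β
        simp only [chosenRestoring, Finset.mem_filter, Finset.mem_univ, true_and, hp.2] at hj ⊢
        omega
      have hall : ∏ j, flipFactor hm η ξ y i s j (Function.update b p β) =
          ∏ j, flipFactor hm η ξ y i s j b := by
        refine Finset.prod_congr rfl fun j hj => flipFactor_update ?_ b β
        simp only [chosenFlipping, Finset.mem_filter, Finset.mem_univ, true_and] at hj ⊢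
        omega
      rw [smul_smul, prod_ge_eq, hge, hall, restoreFactor, hfil, Finset.prod_singleton, hdec,
        Finset.image_insert, Function.update_self, image_update hpn, sdiff_insert_eq,
        sdiff_insert_eq, hins b hb]
      congr 1
      ring
    · have hno : ∀ p : Fin m, ¬ (s ≤ (p : ℕ) ∧ i p = t) := by
        intro p hp
        have := (h.mem_plus t).2 ⟨p, hp⟩
        rw [he] at this
        exact absurd this (by decide)
      have hdec : chosenRestoring i s t = chosenRestoring i s (t + 1) := by
        ext p
        have := hno p
        simp only [chosenRestoring, Finset.mem_filter, Finset.mem_univ, true_and, Fin.ext_iff] at this ⊢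
        omega
      rw [hdec]
      refine Finset.sum_congr rfl fun b hb => ?_
      rw [hins b hb, put_down hm t y (hnot b) (hξ t),
        Matrix.mulVec_smul, he, smul_smul, prod_ge_eq, restoreFactor,
        Finset.filter_false_of_mem fun p _ => hno p, Finset.prod_empty, mul_one, hdec]
      have hP : ∏ k ∈ posSet N m (t + 1) \ (chosenRestoring i s (t + 1)).image b,
          sinh (y k - ξ (Fin.castLE hm t) + η) ≠ 0 :=
        Finset.prod_ne_zero_iff.2 fun k _ => hη k t
      rw [Finset.prod_inv_distrib]
      have := ha t
      congr 1
      field_simp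

end

/-! ### Sorting the factors by variable -/

section

variable {M N m : ℕ}

/-- The constraints on the tuples `b` that are summed over, for arbitrary sites `i_p`. -/
structure Admissible (i : Fin m → Fin m) (s : ℕ) (b : Fin m → Fin (N + m)) : Prop where
  inj : Function.Injective b
  lt_N : ∀ p : Fin m, (p : ℕ) < s → (b p : ℕ) < N
  add_lt : ∀ p : Fin m, s ≤ (p : ℕ) → (b p : ℕ) + (i p : ℕ) < N + m

theorem xiPos_injective : Function.Injective (xiPos N : Fin m → Fin (N + m)) := by
  intro j j' h
  have := congrArg Fin.val h
  rw [xiPos_val, xiPos_val] at this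
  ext
  omega

theorem exists_xiPos (k : Fin (N + m)) (hk : N ≤ (k : ℕ)) : ∃ j, xiPos N j = k := by
  refine ⟨⟨N + m - 1 - k, by have := k.isLt; omega⟩, ?_⟩
  ext
  rw [xiPos_val]
  have := k.isLt
  simp only
  omega

theorem le_xiPos (j : Fin m) : N ≤ (xiPos N j : ℕ) := by rw [xiPos_val]; omega

section split

variable {b : Fin m → Fin (N + m)}

theorem mem_bSet (k : Fin (N + m)) : k ∈ bSet b ↔ ∃ p, b p = k := by simp [bSet]

/-- The extended positions are those in `α_-`, those of the `ξ_j` with `j ∈ γ_+`, and the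
`b_p`. -/
theorem prod_split (hb : Function.Injective b) (F : Fin (N + m) → ℂ) :
    ∏ k, F k = (∏ k ∈ alphaMinus b, F k) * (∏ j ∈ gammaPlus b, F (xiPos N j)) * ∏ p, F (b p) := by
  have h1 : ∏ p, F (b p) = ∏ k ∈ bSet b, F k := by
    rw [bSet, Finset.prod_image fun _ _ _ _ h => hb h]
  have h2 : ∏ j ∈ gammaPlus b, F (xiPos N j) =
      ∏ k ∈ Finset.univ.filter (fun k : Fin (N + m) => N ≤ (k : ℕ) ∧ k ∉ bSet b), F k := by
    rw [← Finset.prod_image fun _ _ _ _ h => xiPos_injective h]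
    congr 1
    ext k
    simp only [Finset.mem_image, gammaPlus, Finset.mem_filter, Finset.mem_univ, true_and]
    constructor
    · rintro ⟨j, hj, rfl⟩
      exact ⟨le_xiPos j, hj⟩
    · rintro ⟨hk, hkb⟩
      obtain ⟨j, rfl⟩ := exists_xiPos k hk
      exact ⟨j, hkb, rfl⟩
  rw [h1, h2, alphaMinus, ← Finset.prod_filter_mul_prod_filter_not Finset.univ (· ∈ bSet b),
    mul_comm, Finset.filter_univ_mem]
  congr 1
  rw [← Finset.prod_filter_mul_prod_filter_not _ (fun k : Fin (N + m) => (k : ℕ) < N),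
    Finset.filter_filter, Finset.filter_filter]
  simp only [not_lt, and_comm]

/-- The set `α_+` consists of the `b_p` that are smaller than `N`. -/
theorem prod_alphaPlus (hb : Function.Injective b) (F : Fin (N + m) → ℂ) :
    ∏ k ∈ alphaPlus b, F k = ∏ p, if (b p : ℕ) < N then F (b p) else 1 := by
  rw [← Finset.prod_filter, ← Finset.prod_image (g := b) fun _ _ _ _ h => hb h]
  congr 1
  ext k
  simp only [alphaPlus, mem_bSet, Finset.mem_filter, Finset.mem_univ, true_and, Finset.mem_image]
  constructor
  · rintro ⟨hk, p, rfl⟩; exact ⟨p, hk, rfl⟩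
  · rintro ⟨p, hk, rfl⟩; exact ⟨hk, p, rfl⟩

theorem alphaMinus_lt {k : Fin (N + m)} (hk : k ∈ alphaMinus b) : (k : ℕ) < N := by
  simp only [alphaMinus, Finset.mem_filter] at hk; exact hk.2.1

theorem alphaMinus_ne {k : Fin (N + m)} (hk : k ∈ alphaMinus b) (p : Fin m) : b p ≠ k := by
  simp only [alphaMinus, Finset.mem_filter, mem_bSet, not_exists] at hk; exact hk.2.2 p

theorem gammaPlus_ne {j : Fin m} (hj : j ∈ gammaPlus b) (p : Fin m) : b p ≠ xiPos N j := by
  simp only [gammaPlus, Finset.mem_filter, mem_bSet, not_exists] at hj; exact hj.2 p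

/-- The sites `1, …, m` are those in `γ_+` and those whose `ξ_j` is taken by some `b_p`. -/
theorem prod_sites_split (hb : Function.Injective b) (F : Fin (N + m) → ℂ) :
    ∏ j : Fin m, F (xiPos N j) =
      (∏ j ∈ gammaPlus b, F (xiPos N j)) * ∏ p, if N ≤ (b p : ℕ) then F (b p) else 1 := by
  have h := prod_split hb fun k => if N ≤ (k : ℕ) then F k else 1
  have h1 : ∏ k ∈ alphaMinus b, (if N ≤ (k : ℕ) then F k else 1) = 1 :=
    Finset.prod_eq_one fun k hk => if_neg (not_le.2 (alphaMinus_lt hk))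
  have h2 : ∏ k : Fin (N + m), (if N ≤ (k : ℕ) then F k else 1) = ∏ j : Fin m, F (xiPos N j) := by
    rw [← Finset.prod_filter, ← Finset.prod_image (g := xiPos N) fun _ _ _ _ h => xiPos_injective h]
    congr 1
    ext k
    simp only [Finset.mem_filter, Finset.mem_univ, true_and, Finset.mem_image]
    exact ⟨exists_xiPos k, fun ⟨j, hj⟩ => hj ▸ le_xiPos j⟩
  rw [h1, h2, one_mul] at h
  rw [h]
  congr 1
  exact Finset.prod_congr rfl fun j _ => if_pos (le_xiPos j)

end split

section coefficient

variable {hm : m ≤ M} {η : ℂ} {ξ : Fin M → ℂ} {y : Fin (N + m) → ℂ}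
  {ε ε' : Fin m → Fin 2} {i : Fin m → Fin m} {s : ℕ} {b : Fin m → Fin (N + m)}

/-- A product over the sites of the factors of the `p` that are treated there. -/
theorem prod_fiber (C : Fin m → Prop) [DecidablePred C] (G : Fin m → Fin m → ℂ) :
    ∏ j, ∏ p ∈ Finset.univ.filter (fun p : Fin m => C p ∧ i p = j), G p j =
      ∏ p, if C p then G p (i p) else 1 := by
  simp only [Finset.prod_filter, ite_and]
  rw [Finset.prod_comm]
  refine Finset.prod_congr rfl fun p _ => ?_
  split_ifs with h
  · simp
  · simp

/-- The variables present at a stage are those in `α_-`, the `ξ_j` with `j ∈ γ_+` already added, and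
the `b_p` that are available but not yet removed. -/
theorem prod_sdiff_image (hb : Function.Injective b) (S : Finset (Fin (N + m))) (P : Finset (Fin m))
    (F : Fin (N + m) → ℂ) (hS : ∀ k ∈ alphaMinus b, k ∈ S) :
    ∏ k ∈ S \ P.image b, F k = (∏ k ∈ alphaMinus b, F k) *
      (∏ j ∈ gammaPlus b, if xiPos N j ∈ S then F (xiPos N j) else 1) *
      ∏ p, if b p ∈ S ∧ p ∉ P then F (b p) else 1 := by
  have h := prod_split hb fun k => if k ∈ S \ P.image b then F k else 1
  rw [Finset.prod_ite_mem, Finset.univ_inter] at h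
  rw [h]
  congr 1
  · congr 1
    · refine Finset.prod_congr rfl fun k hk => if_pos ?_
      rw [Finset.mem_sdiff, Finset.mem_image]
      exact ⟨hS k hk, fun ⟨p, _, hp⟩ => alphaMinus_ne hk p hp⟩
    · refine Finset.prod_congr rfl fun j hj => ?_
      congr 1
      rw [Finset.mem_sdiff, Finset.mem_image, eq_iff_iff, and_iff_left]
      exact fun ⟨p, _, hp⟩ => gammaPlus_ne hj p hp
  · refine Finset.prod_congr rfl fun p _ => ?_
    congr 1
    rw [Finset.mem_sdiff, Finset.mem_image, eq_iff_iff]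
    refine and_congr_right fun _ => not_congr ⟨fun ⟨q, hq, hqp⟩ => hb hqp ▸ hq, fun h => ⟨p, h, rfl⟩⟩

theorem mem_posSet (t : ℕ) (k : Fin (N + m)) : k ∈ posSet N m t ↔ (k : ℕ) + t < N + m := by
  simp [posSet]

theorem alphaMinus_mem_posSet {t : ℕ} (ht : t ≤ m) {k : Fin (N + m)} (hk : k ∈ alphaMinus b) :
    k ∈ posSet N m t := by
  have := alphaMinus_lt hk
  rw [mem_posSet]; omega

/-- The factors of the first stage, sorted by the variable they contain. -/
theorem prod_flipFactor (h : SiteOrder ε ε' i s) (hb : Admissible i s b) :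
    ∏ j : Fin m, flipFactor hm η ξ y i s j b =
      (∏ k ∈ alphaMinus b, ∏ j : Fin m, sinh (y k - ξ (Fin.castLE hm j))) *
      (∏ p : Fin m, ∏ j : Fin m, if (b p : ℕ) < N ∧ ¬ ((p : ℕ) < s ∧ i p ≤ j) then
        sinh (y (b p) - ξ (Fin.castLE hm j)) else 1) *
      ∏ p : Fin m, if (p : ℕ) < s then sinh η * aList η ξ (chain M (i p + 1)) (y (b p)) *
        ((∏ k ∈ alphaMinus b, exch (-η) (y (b p)) (y k)) *
          ∏ q : Fin m, if p < q ∧ (b q : ℕ) < N then exch (-η) (y (b p)) (y (b q)) else 1) else 1 := by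
  unfold flipFactor
  rw [Finset.prod_mul_distrib, prod_fiber fun p : Fin m => (p : ℕ) < s]
  congr 1
  · rw [Finset.prod_comm, Finset.prod_comm (s := (Finset.univ : Finset (Fin m))) (t := Finset.univ),
      ← Finset.prod_mul_distrib]
    refine Finset.prod_congr rfl fun j _ => ?_
    rw [prod_sdiff_image hb.inj _ _ _ fun k hk => alphaMinus_mem_posSet le_rfl hk]
    have : ∀ l ∈ gammaPlus b, (if xiPos N l ∈ posSet N m m then
        sinh (y (xiPos N l) - ξ (Fin.castLE hm j)) else 1) = 1 := fun l _ =>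
      if_neg (xiPos_notMem_posSet l l.isLt)
    rw [Finset.prod_congr rfl this, Finset.prod_const_one, mul_one]
    congr 1
    refine Finset.prod_congr rfl fun p _ => ?_
    congr 1
    simp only [mem_posSet, chosenFlipping, Finset.mem_filter, Finset.mem_univ, true_and, eq_iff_iff,
      Fin.le_def]
    omega
  · refine Finset.prod_congr rfl fun p _ => ?_
    split_ifs with hp
    · rw [prod_sdiff_image hb.inj _ _ _ fun k hk => alphaMinus_mem_posSet le_rfl hk]
      have : ∀ l ∈ gammaPlus b, (if xiPos N l ∈ posSet N m m then
          exch (-η) (y (b p)) (y (xiPos N l)) else 1) = 1 := fun l _ =>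
        if_neg (xiPos_notMem_posSet l l.isLt)
      rw [Finset.prod_congr rfl this, Finset.prod_const_one, mul_one]
      congr 2
      refine Finset.prod_congr rfl fun q _ => ?_
      congr 1
      have h1 : p < q → (q : ℕ) < s → (i p : ℕ) < i q := h.lt_of_lt p q
      have h2 : q < p → (i q : ℕ) < i p := fun hqp => h.lt_of_lt q p hqp hp
      have h3 : q = p → (i q : ℕ) = i p := fun hqp => by rw [hqp]
      simp only [mem_posSet, chosenFlipping, Finset.mem_filter, Finset.mem_univ, true_and, eq_iff_iff,
        Fin.lt_def, Fin.ext_iff] at h1 h2 h3 ⊢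
      constructor
      · rintro ⟨h4, h5⟩
        refine ⟨?_, by omega⟩
        by_contra h6
        rcases Nat.lt_or_ge (q : ℕ) p with h7 | h7
        · exact h5 ⟨by omega, by have := h2 h7; omega⟩
        · exact h5 ⟨by omega, by have := h3 (by omega); omega⟩
      · rintro ⟨h4, h5⟩
        exact ⟨by omega, fun h6 => by have := h1 h4 h6.1; omega⟩
    · rfl

/-- The factors of the second stage, sorted by the variable they contain. -/
theorem prod_restoreFactor (h : SiteOrder ε ε' i s) (hb : Admissible i s b)
    (hξ : ∀ j, y (xiPos N j) = ξ (Fin.castLE hm j)) :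
    ∏ j : Fin m, restoreFactor hm η ξ y i s j b =
      (∏ k ∈ alphaMinus b, ∏ j : Fin m, (sinh (y k - ξ (Fin.castLE hm j) + η))⁻¹) *
      (∏ l ∈ gammaPlus b, ((aList η ξ (chain M l) (ξ (Fin.castLE hm l)))⁻¹ *
        ∏ j : Fin m, if j < l then (sinh (ξ (Fin.castLE hm l) - ξ (Fin.castLE hm j) + η))⁻¹ else 1)) *
      (∏ p : Fin m, ((if N ≤ (b p : ℕ) then (aList η ξ (chain M (N + m - 1 - b p)) (y (b p)))⁻¹ else 1) *
        ∏ j : Fin m, if s ≤ (p : ℕ) ∧ i p < j ∧ (b p : ℕ) + j + 1 < N + m then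
          (sinh (y (b p) - ξ (Fin.castLE hm j) + η))⁻¹ else 1)) *
      ∏ p : Fin m, if s ≤ (p : ℕ) then sinh η * aList η ξ (chain M (i p + 1)) (y (b p)) *
        (if b p = xiPos N (i p) then 1 else (sinh (ξ (Fin.castLE hm (i p)) - y (b p)))⁻¹) *
        ((∏ k ∈ alphaMinus b, exch (-η) (y (b p)) (y k)) *
          (∏ l ∈ gammaPlus b, if i p < l then
            exch (-η) (y (b p)) (ξ (Fin.castLE hm l)) else 1) *
          ∏ q : Fin m, if p < q ∧ (b q : ℕ) + i p + 1 < N + m then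
            exch (-η) (y (b p)) (y (b q)) else 1) else 1 := by
  unfold restoreFactor
  have hmem : ∀ l j : Fin m, xiPos N l ∈ posSet N m (j + 1) ↔ j < l := by
    intro l j
    have := l.isLt
    have := j.isLt
    rw [mem_posSet, xiPos_val, Fin.lt_def]; omega
  rw [Finset.prod_mul_distrib, prod_fiber fun p : Fin m => s ≤ (p : ℕ)]
  congr 1
  · rw [Finset.prod_mul_distrib]
    have ha := prod_sites_split hb.inj fun k => (aList η ξ (chain M (N + m - 1 - k)) (y k))⁻¹
    have hsub : ∀ j : Fin m, N + m - 1 - (xiPos N j : ℕ) = j := by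
      intro j; have := j.isLt; rw [xiPos_val]; omega
    simp only [hsub, hξ] at ha
    rw [ha, Finset.prod_mul_distrib, Finset.prod_mul_distrib]
    have hW : ∀ j : Fin m, ∏ k ∈ posSet N m (j + 1) \ (chosenRestoring i s j).image b,
        (sinh (y k - ξ (Fin.castLE hm j) + η))⁻¹ =
        (∏ k ∈ alphaMinus b, (sinh (y k - ξ (Fin.castLE hm j) + η))⁻¹) *
        (∏ l ∈ gammaPlus b, if j < l then
          (sinh (ξ (Fin.castLE hm l) - ξ (Fin.castLE hm j) + η))⁻¹ else 1) *
        ∏ p : Fin m, if s ≤ (p : ℕ) ∧ i p < j ∧ (b p : ℕ) + j + 1 < N + m then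
          (sinh (y (b p) - ξ (Fin.castLE hm j) + η))⁻¹ else 1 := by
      intro j
      rw [prod_sdiff_image hb.inj _ _ _ fun k hk => alphaMinus_mem_posSet j.isLt hk]
      simp only [hmem, hξ]
      congr 1
      refine Finset.prod_congr rfl fun p _ => ?_
      congr 1
      simp only [mem_posSet, chosenRestoring, Finset.mem_filter, Finset.mem_univ, true_and, eq_iff_iff,
        Fin.lt_def]
      omega
    simp only [hW, Finset.prod_mul_distrib]
    rw [Finset.prod_comm (s := Finset.univ) (t := alphaMinus b),
      Finset.prod_comm (s := Finset.univ) (t := gammaPlus b),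
      Finset.prod_comm (s := (Finset.univ : Finset (Fin m))) (t := (Finset.univ : Finset (Fin m)))]
    ring
  · refine Finset.prod_congr rfl fun p _ => ?_
    split_ifs with hp
    on_goal 3 => rfl
    all_goals
      rw [prod_sdiff_image hb.inj _ _ _ fun k hk => alphaMinus_mem_posSet (i p).isLt hk]
      simp only [hmem, hξ]
      congr 2
      refine Finset.prod_congr rfl fun q _ => ?_
      congr 1
      have h1 : p < q → (i q : ℕ) < i p := fun hpq => h.gt_of_lt p q hpq hp
      have h2 : s ≤ (q : ℕ) → q < p → (i p : ℕ) < i q := fun hq hqp => h.gt_of_lt q p hqp hq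
      have h3 : q = p → (i q : ℕ) = i p := fun hqp => by rw [hqp]
      simp only [mem_posSet, chosenRestoring, Finset.mem_filter, Finset.mem_univ, true_and, eq_iff_iff,
        Fin.lt_def, Fin.ext_iff] at h1 h2 h3 ⊢
      constructor
      · rintro ⟨h4, h5⟩
        refine ⟨?_, by omega⟩
        by_contra h6
        rcases Nat.lt_or_ge (q : ℕ) p with h7 | h7
        · rcases Nat.lt_or_ge (q : ℕ) s with h8 | h8
          · exact h5 (Or.inl h8)
          · have := h2 h8 h7
            exact h5 (Or.inr (by omega))
        · have := h3 (by omega)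
          exact h5 (Or.inr (by omega))
      · rintro ⟨h4, h5⟩
        have := h1 h4
        exact ⟨by omega, fun h6 => by omega⟩

end coefficient

end

/-! ### The closed form of the bulk coefficient: factors of a selected variable -/

section

variable {M N m : ℕ}

/-- The sites `j` with `t ≤ j < m` split off from the product over the chain from `t` on. -/
theorem aList_chain (hm : m ≤ M) (η : ℂ) (ξ : Fin M → ℂ) (u : ℂ) {t : ℕ} (ht : t ≤ m) :
    aList η ξ (chain M t) u =
      (∏ j : Fin m, if t ≤ (j : ℕ) then sinh (u - ξ (Fin.castLE hm j) + η) else 1) *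
        aList η ξ (chain M m) u := by
  induction ht using Nat.decreasingInduction with
  | self =>
    rw [Finset.prod_eq_one, one_mul]
    intro j _
    exact if_neg (by have := j.isLt; omega)
  | of_succ t ht ih =>
    have hch : chain M t = Fin.castLE hm ⟨t, ht⟩ :: chain M (t + 1) :=
      chain_eq_cons (Fin.castLE hm ⟨t, ht⟩)
    have h := prod_ge_eq (fun j : Fin m => sinh (u - ξ (Fin.castLE hm j) + η)) ⟨t, ht⟩
    rw [Finset.prod_filter, Finset.prod_filter] at h
    rw [h, hch, mul_assoc, ← ih]
    simp [aList]

theorem aFun_eq_aList (η : ℂ) (ξ : Fin M → ℂ) (u : ℂ) : aFun η ξ u = aList η ξ (chain M 0) u := by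
  rw [aFun, aList, chain, List.drop_zero, ← List.ofFn_eq_map, List.prod_ofFn]

theorem sinh_sub_comm (u v : ℂ) : sinh (u - v) = -sinh (v - u) := by
  rw [← sinh_neg]; congr 1; ring

theorem exch_neg_eq (η u v : ℂ) : exch (-η) u v = sinh (v - u + η) / sinh (v - u) := by
  rw [exch, sinh_sub_comm u v, show u - v + -η = -(v - u + η) by ring, sinh_neg, neg_div_neg_eq]

section rows

variable (hm : m ≤ M) (η : ℂ) (ξ : Fin M → ℂ) (y : Fin (N + m) → ℂ)
  (i : Fin m → Fin m) (s : ℕ) (b : Fin m → Fin (N + m))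

/-- The last factor of the coefficient for an index `b_p` with `p ≤ s`. -/
noncomputable def minusFactor (p : Fin m) : ℂ :=
  (∏ k ∈ Finset.Ioi (i p), sinh (y (b p) - ξ (Fin.castLE hm k) + η)) /
    ∏ k ∈ Finset.Ici (i p), sinh (y (b p) - ξ (Fin.castLE hm k))

/-- The last factor of the coefficient for an index `b_p` with `p > s`. -/
noncomputable def plusFactor (p : Fin m) : ℂ :=
  (∏ k ∈ Finset.Ioi (i p), sinh (ξ (Fin.castLE hm k) - y (b p) + η)) /
    ∏ k ∈ Finset.Ici (i p) with b p ≠ xiPos N k, sinh (ξ (Fin.castLE hm k) - y (b p))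

/-- The coefficients of the action of the local operators on a bulk Bethe vector. It is the
coefficient of the boundary case without the factors `H_σ` and without the factors of the sign
`e = +`. -/
noncomputable def bulkCoeff : ℂ :=
  (∏ j : Fin m, aFun η ξ (y (b j)) / aFun η ξ (ξ (Fin.castLE hm j))) *
  (∏ p : Fin m, ∏ q : Fin m with p < q,
    sinh (y (b p) - y (b q)) / sinh (y (b p) - y (b q) + η)) *
  (∏ k ∈ alphaMinus b, ((∏ j ∈ alphaPlus b, sinh (y j - y k - η) / sinh (y j - y k)) *
    ∏ j ∈ gammaPlus b,
      sinh (ξ (Fin.castLE hm j) - y k) / sinh (ξ (Fin.castLE hm j) - y k - η))) *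
  (∏ k ∈ alphaPlus b, ((∏ j ∈ gammaPlus b,
      sinh (ξ (Fin.castLE hm j) - y k) / sinh (ξ (Fin.castLE hm j) - y k - η)) *
    ((∏ j ∈ alphaPlus b, sinh (y j - y k + η)) /
      ∏ j ∈ (alphaPlus b).erase k, sinh (y j - y k)))) *
  (∏ p ∈ Finset.univ.filter (fun p : Fin m => (p : ℕ) < s), minusFactor hm η ξ y i b p) *
  ∏ p ∈ Finset.univ.filter (fun p : Fin m => s ≤ (p : ℕ)), plusFactor hm η ξ y i b p

/-- Genericity of the variables in the bulk formula, the last `m` of which are the `ξ_j`. -/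
structure Generic : Prop where
  xi : ∀ j, y (xiPos N j) = ξ (Fin.castLE hm j)
  sub : ∀ k k', k ≠ k' → sinh (y k - y k') ≠ 0
  sub_eta : ∀ k j, sinh (y k - ξ (Fin.castLE hm j) + η) ≠ 0
  pair : 2 ≤ m → ∀ k k', k ≠ k' → sinh (y k - y k' + η) ≠ 0
  a_ne : ∀ (j : Fin m) (k : Fin M), sinh (ξ (Fin.castLE hm j) - ξ k + η) ≠ 0

variable {hm η ξ y i s b} {ε ε' : Fin m → Fin 2}

theorem Generic.pair' (g : Generic hm η ξ y) (hb : Function.Injective b) {p q : Fin m}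
    (hpq : p ≠ q) : sinh (y (b p) - y (b q) + η) ≠ 0 := by
  refine g.pair ?_ _ _ (hb.ne hpq)
  have := p.isLt
  have := q.isLt
  have : (p : ℕ) ≠ q := fun h => hpq (Fin.ext h)
  omega

theorem Generic.exch_ne (g : Generic hm η ξ y) (hb : Function.Injective b) {p q : Fin m}
    (hpq : p ≠ q) : exch (-η) (y (b p)) (y (b q)) ≠ 0 := by
  rw [exch_neg_eq]
  exact div_ne_zero (g.pair' hb hpq.symm) (g.sub _ _ (hb.ne hpq.symm))

theorem Generic.aList_ne (g : Generic hm η ξ y) (j : Fin m) (l : List (Fin M)) :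
    aList η ξ l (ξ (Fin.castLE hm j)) ≠ 0 := by
  rw [aList]
  refine List.prod_ne_zero ?_
  rw [List.mem_map]
  rintro ⟨k, _, hk⟩
  exact g.a_ne j k hk

theorem Generic.aList_ne' (g : Generic hm η ξ y) {k : Fin (N + m)} (hk : N ≤ (k : ℕ))
    (l : List (Fin M)) : aList η ξ l (y k) ≠ 0 := by
  obtain ⟨j, rfl⟩ := exists_xiPos k hk
  rw [g.xi]; exact g.aList_ne j l

theorem Generic.sub_xi (g : Generic hm η ξ y) {k : Fin (N + m)} {j : Fin m}
    (h : k ≠ xiPos N j) : sinh (y k - ξ (Fin.castLE hm j)) ≠ 0 := by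
  rw [← g.xi]; exact g.sub _ _ h

theorem Generic.xi_sub (g : Generic hm η ξ y) {k : Fin (N + m)} {j : Fin m}
    (h : k ≠ xiPos N j) : sinh (ξ (Fin.castLE hm j) - y k) ≠ 0 := by
  rw [← g.xi]; exact g.sub _ _ h.symm

theorem ne_xiPos_of_lt {k : Fin (N + m)} (h : (k : ℕ) < N) (j : Fin m) : k ≠ xiPos N j := by
  rintro rfl
  exact absurd h (not_lt.2 (le_xiPos j))

theorem prod_Ioi_eq (a : Fin m) (F : Fin m → ℂ) :
    ∏ k ∈ Finset.Ioi a, F k = ∏ k, if a < k then F k else 1 := by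
  rw [← Finset.prod_filter]; congr 1; ext; simp

theorem prod_Ici_eq (a : Fin m) (F : Fin m → ℂ) :
    ∏ k ∈ Finset.Ici a, F k = ∏ k, if a ≤ k then F k else 1 := by
  rw [← Finset.prod_filter]; congr 1; ext; simp

/-- For the sites above `i_p`, the factors of pairs with `γ_+` and with the later `b_q` in terms of
those with all sites. -/
theorem gamma_pairs (g : Generic hm η ξ y) (h : SiteOrder ε ε' i s) (hb : Admissible i s b)
    {p : Fin m} (hp : s ≤ (p : ℕ)) :
    (∏ l ∈ gammaPlus b, if i p < l then exch (-η) (y (b p)) (ξ (Fin.castLE hm l)) else 1) *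
      (∏ q : Fin m, if p < q ∧ (b q : ℕ) + i p + 1 < N + m then
        exch (-η) (y (b p)) (y (b q)) else 1) =
    (∏ l : Fin m, if i p < l ∧ b p ≠ xiPos N l then
        exch (-η) (y (b p)) (ξ (Fin.castLE hm l)) else 1) *
      (∏ q : Fin m, if q < p ∧ N ≤ (b q : ℕ) then (exch (-η) (y (b p)) (y (b q)))⁻¹ else 1) *
      ∏ q : Fin m, if p < q ∧ (b q : ℕ) < N then exch (-η) (y (b p)) (y (b q)) else 1 := by
  have hsp := prod_sites_split hb.inj fun k => if (k : ℕ) + i p + 1 < N + m ∧ b p ≠ k then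
    exch (-η) (y (b p)) (y k) else 1
  have hcond : ∀ l : Fin m, (xiPos N l : ℕ) + i p + 1 < N + m ↔ i p < l := by
    intro l
    have := l.isLt
    have := (i p).isLt
    rw [xiPos_val, Fin.lt_def]; omega
  simp only [hcond, g.xi] at hsp
  have hγ : ∏ l ∈ gammaPlus b, (if i p < l ∧ b p ≠ xiPos N l then
      exch (-η) (y (b p)) (ξ (Fin.castLE hm l)) else 1) =
      ∏ l ∈ gammaPlus b, if i p < l then exch (-η) (y (b p)) (ξ (Fin.castLE hm l)) else 1 :=
    Finset.prod_congr rfl fun l hl => by simp [gammaPlus_ne hl p]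
  rw [hsp, hγ, mul_assoc, mul_assoc, ← Finset.prod_mul_distrib, ← Finset.prod_mul_distrib]
  congr 1
  refine Finset.prod_congr rfl fun q _ => ?_
  have hip := (i p).isLt
  rcases lt_trichotomy p q with hpq | rfl | hpq
  · have hne : b p ≠ b q := hb.inj.ne hpq.ne
    by_cases hq : N ≤ (b q : ℕ)
    · simp [hpq, hpq.asymm, hq, hne, not_lt.2 hq]
    · have h1 : (b q : ℕ) + i p + 1 < N + m := by omega
      simp [hpq, hpq.asymm, hq, h1, not_le.1 hq]
  · simp
  · have hne : b p ≠ b q := hb.inj.ne hpq.ne'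
    by_cases hq : N ≤ (b q : ℕ)
    · have hqs : s ≤ (q : ℕ) := by
        by_contra hqs
        exact absurd (hb.lt_N q (not_le.1 hqs)) (not_lt.2 hq)
      have h1 : (b q : ℕ) + i p + 1 < N + m := by
        have := hb.add_lt q hqs
        have : (i p : ℕ) < i q := h.gt_of_lt q p hpq hqs
        omega
      simp [hpq, hpq.asymm, hq, hne, h1, not_lt.2 hq, mul_inv_cancel₀ (g.exch_ne hb.inj hpq.ne')]
    · simp [hpq.asymm, hq]

/-- The last factor of the coefficient, with the factors of sites above `i_p` as exchange factors.
If `b_p` is the position of some `ξ_L` with `L` above `i_p`, then the numerator has the additional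
factor `sinh η` from `L`. -/
theorem plusFactor_eq (g : Generic hm η ξ y) (hb : Admissible i s b) {p : Fin m}
    (hp : s ≤ (p : ℕ)) :
    plusFactor hm η ξ y i b p =
      (if b p = xiPos N (i p) then 1 else (sinh (ξ (Fin.castLE hm (i p)) - y (b p)))⁻¹) *
      (∏ l : Fin m, if i p < l ∧ b p ≠ xiPos N l then
        exch (-η) (y (b p)) (ξ (Fin.castLE hm l)) else 1) *
      if N ≤ (b p : ℕ) ∧ b p ≠ xiPos N (i p) then sinh η else 1 := by
  have h1 : (if N ≤ (b p : ℕ) ∧ b p ≠ xiPos N (i p) then sinh η else 1) =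
      ∏ l : Fin m, if i p < l ∧ b p = xiPos N l then sinh η else 1 := by
    split_ifs with h
    · obtain ⟨L, hL⟩ := exists_xiPos (b p) h.1
      have hLi : i p < L := by
        have h2 := hb.add_lt p hp
        have h3 : L ≠ i p := fun h' => h.2 (by rw [← hL, h'])
        rw [← hL, xiPos_val] at h2
        have := L.isLt
        have : (L : ℕ) ≠ i p := fun h' => h3 (Fin.ext h')
        rw [Fin.lt_def]; omega
      rw [Finset.prod_eq_single L]
      · rw [if_pos ⟨hLi, hL.symm⟩]
      · intro l _ hl
        exact if_neg fun h' => hl (xiPos_injective (h'.2.symm.trans hL.symm))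
      · simp
    · rw [Finset.prod_eq_one]
      intro l _
      rw [if_neg]
      rintro ⟨h3, h4⟩
      exact h ⟨by rw [h4]; exact le_xiPos l, fun h2 => h3.ne (xiPos_injective (h2.symm.trans h4))⟩
  have h2 : ∏ k ∈ Finset.Ici (i p) with b p ≠ xiPos N k, sinh (ξ (Fin.castLE hm k) - y (b p)) =
      (if b p = xiPos N (i p) then 1 else sinh (ξ (Fin.castLE hm (i p)) - y (b p))) *
      ∏ l : Fin m, if i p < l ∧ b p ≠ xiPos N l then
        sinh (ξ (Fin.castLE hm l) - y (b p)) else 1 := by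
    rw [Finset.prod_filter, show Finset.Ici (i p) = insert (i p) (Finset.Ioi (i p)) by
      ext; simp [le_iff_eq_or_lt, eq_comm], Finset.prod_insert (by simp), prod_Ioi_eq]
    simp only [ite_and, ne_eq, ite_not]
  have h3 : ∏ k ∈ Finset.Ioi (i p), sinh (ξ (Fin.castLE hm k) - y (b p) + η) =
      ((∏ l : Fin m, if i p < l ∧ b p ≠ xiPos N l then
        exch (-η) (y (b p)) (ξ (Fin.castLE hm l)) else 1) *
        ∏ l : Fin m, if i p < l ∧ b p = xiPos N l then sinh η else 1) *
      ∏ l : Fin m, if i p < l ∧ b p ≠ xiPos N l then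
        sinh (ξ (Fin.castLE hm l) - y (b p)) else 1 := by
    rw [prod_Ioi_eq, ← Finset.prod_mul_distrib, ← Finset.prod_mul_distrib]
    refine Finset.prod_congr rfl fun l _ => ?_
    by_cases hl : i p < l
    · by_cases hbl : b p = xiPos N l
      · simp [hl, hbl, g.xi]
      · simp [hl, hbl, exch_neg_eq, div_mul_cancel₀ _ (g.xi_sub hbl)]
    · simp [hl]
  have h4 : (∏ l : Fin m, if i p < l ∧ b p ≠ xiPos N l then
        sinh (ξ (Fin.castLE hm l) - y (b p)) else 1) ≠ 0 := by
    refine Finset.prod_ne_zero_iff.2 fun l _ => ?_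
    split_ifs with hl
    · exact g.xi_sub hl.2
    · exact one_ne_zero
  rw [h1, plusFactor, h2, h3, mul_div_mul_right _ _ h4]
  split_ifs with h
  · simp
  · rw [div_eq_mul_inv]; ring

end rows

end

section

variable {M N m : ℕ}

section rows

variable {hm : m ≤ M} {η : ℂ} {ξ : Fin M → ℂ} {y : Fin (N + m) → ℂ}
  {ε ε' : Fin m → Fin 2} {i : Fin m → Fin m} {s : ℕ} {b : Fin m → Fin (N + m)}

/-- For `b_p` at the position of `ξ_L`, the factors `a` of the partial chains cancel. -/
theorem aList_ratio (g : Generic hm η ξ y) (hb : Admissible i s b) {p : Fin m} (hp : s ≤ (p : ℕ))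
    (hN : N ≤ (b p : ℕ)) :
    (aList η ξ (chain M (N + m - 1 - b p)) (y (b p)))⁻¹ *
      (∏ j : Fin m, if s ≤ (p : ℕ) ∧ i p < j ∧ (b p : ℕ) + j + 1 < N + m then
          (sinh (y (b p) - ξ (Fin.castLE hm j) + η))⁻¹ else 1) *
      (sinh η * aList η ξ (chain M (i p + 1)) (y (b p))) =
    if N ≤ (b p : ℕ) ∧ b p ≠ xiPos N (i p) then sinh η else 1 := by
  have hadd := hb.add_lt p hp
  obtain ⟨L, hL⟩ := exists_xiPos (b p) hN
  have hLv : N + m - 1 - (b p : ℕ) = L := by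
    have := L.isLt
    rw [← hL, xiPos_val]; omega
  have hLm := L.isLt
  have hbv : (b p : ℕ) = N + m - 1 - L := by rw [← hL, xiPos_val]; omega
  have hy : y (b p) = ξ (Fin.castLE hm L) := by rw [← hL, g.xi]
  have hne := g.aList_ne' hN (chain M L)
  have hcan : ∀ l : List (Fin M), aList η ξ l (y (b p)) ≠ 0 := g.aList_ne' hN
  rw [hLv, inv_mul_eq_div, div_mul_eq_mul_div, div_eq_iff hne]
  by_cases hiL : b p = xiPos N (i p)
  · have hi : i p = L := xiPos_injective (hiL.symm.trans hL.symm)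
    rw [if_neg (by tauto), Finset.prod_eq_one, one_mul, one_mul, aList_chain hm η ξ _ hLm.le,
      aList_chain hm η ξ _ (show (i p : ℕ) + 1 ≤ m by omega), hi]
    · have h := prod_ge_eq (fun j : Fin m => sinh (y (b p) - ξ (Fin.castLE hm j) + η)) L
      rw [Finset.prod_filter, Finset.prod_filter] at h
      rw [h, hy, sub_self, zero_add]
      ring
    · intro j _
      rw [if_neg]
      rintro ⟨_, h1, h2⟩
      rw [hi, Fin.lt_def] at h1
      omega
  · have hlt : (i p : ℕ) < L := by
      have : (i p : ℕ) ≠ L := fun h => hiL (by rw [← hL, Fin.ext h])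
      omega
    rw [if_pos ⟨hN, hiL⟩, aList_chain hm η ξ _ hLm.le,
      aList_chain hm η ξ _ (show (i p : ℕ) + 1 ≤ m by omega), mul_left_comm, ← mul_assoc (∏ _, _)]
    congr 2
    rw [← Finset.prod_mul_distrib]
    refine Finset.prod_congr rfl fun j _ => ?_
    have hj := j.isLt
    by_cases h1 : (i p : ℕ) < j
    · have h1' : (i p : ℕ) + 1 ≤ j := h1
      by_cases h2 : (j : ℕ) < L
      · have h3 : (b p : ℕ) + j + 1 < N + m := by omega
        have h4 := g.sub_eta (b p) j
        simp [hp, Fin.lt_def, h1, h1', h3, not_le.2 h2, h4]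
      · have h3 : ¬ ((b p : ℕ) + j + 1 < N + m) := by omega
        simp [h1', h3, not_lt.1 h2]
    · have h2 : ¬ ((L : ℕ) ≤ j) := by omega
      have h1' : ¬ ((i p : ℕ) + 1 ≤ j) := by omega
      simp [Fin.lt_def, h1, h1', h2]

/-- The factors of the two stages which contain the variable at `b_p`, apart from those shared with
the variables from `α_-`: they are the last factor of the coefficient, the exchange factors with
the other `b_q`, and, for `b_p ≤ N`, a product over all sites. -/
theorem selected_row_eq (g : Generic hm η ξ y) (h : SiteOrder ε ε' i s) (hb : Admissible i s b)
    (p : Fin m) :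
    (∏ j : Fin m, if (b p : ℕ) < N ∧ ¬ ((p : ℕ) < s ∧ i p ≤ j) then
        sinh (y (b p) - ξ (Fin.castLE hm j)) else 1) *
      (if (p : ℕ) < s then sinh η * aList η ξ (chain M (i p + 1)) (y (b p)) *
        ∏ q : Fin m, if p < q ∧ (b q : ℕ) < N then exch (-η) (y (b p)) (y (b q)) else 1 else 1) *
      ((if N ≤ (b p : ℕ) then (aList η ξ (chain M (N + m - 1 - b p)) (y (b p)))⁻¹ else 1) *
        ∏ j : Fin m, if s ≤ (p : ℕ) ∧ i p < j ∧ (b p : ℕ) + j + 1 < N + m then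
          (sinh (y (b p) - ξ (Fin.castLE hm j) + η))⁻¹ else 1) *
      (if s ≤ (p : ℕ) then sinh η * aList η ξ (chain M (i p + 1)) (y (b p)) *
        (if b p = xiPos N (i p) then 1 else (sinh (ξ (Fin.castLE hm (i p)) - y (b p)))⁻¹) *
        ((∏ l ∈ gammaPlus b, if i p < l then
            exch (-η) (y (b p)) (ξ (Fin.castLE hm l)) else 1) *
          ∏ q : Fin m, if p < q ∧ (b q : ℕ) + i p + 1 < N + m then
            exch (-η) (y (b p)) (y (b q)) else 1) else 1) =
    (if (b p : ℕ) < N then sinh η * aList η ξ (chain M m) (y (b p)) *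
        ∏ j : Fin m, sinh (y (b p) - ξ (Fin.castLE hm j)) else 1) *
      (if (p : ℕ) < s then minusFactor hm η ξ y i b p else plusFactor hm η ξ y i b p) *
      ((∏ q : Fin m, if q < p ∧ N ≤ (b q : ℕ) then (exch (-η) (y (b p)) (y (b q)))⁻¹ else 1) *
      ∏ q : Fin m, if p < q ∧ (b q : ℕ) < N then exch (-η) (y (b p)) (y (b q)) else 1) := by
  have hipm : (i p : ℕ) + 1 ≤ m := (i p).isLt
  rcases Nat.lt_or_ge (p : ℕ) s with hp | hp
  · have hbp := hb.lt_N p hp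
    have h1 : ∏ q : Fin m, (if q < p ∧ N ≤ (b q : ℕ) then
        (exch (-η) (y (b p)) (y (b q)))⁻¹ else 1) = 1 := by
      refine Finset.prod_eq_one fun q _ => if_neg ?_
      rintro ⟨h1, h2⟩
      rw [Fin.lt_def] at h1
      have := hb.lt_N q (by omega)
      omega
    have h2 : (∏ j : Fin m, if (b p : ℕ) < N ∧ ¬ ((p : ℕ) < s ∧ i p ≤ j) then
        sinh (y (b p) - ξ (Fin.castLE hm j)) else 1) *
        ∏ k ∈ Finset.Ici (i p), sinh (y (b p) - ξ (Fin.castLE hm k)) =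
        ∏ j : Fin m, sinh (y (b p) - ξ (Fin.castLE hm j)) := by
      rw [prod_Ici_eq, ← Finset.prod_mul_distrib]
      refine Finset.prod_congr rfl fun j _ => ?_
      by_cases hj : i p ≤ j <;> simp [hbp, hp, hj]
    have h3 : ∏ k ∈ Finset.Ici (i p), sinh (y (b p) - ξ (Fin.castLE hm k)) ≠ 0 :=
      Finset.prod_ne_zero_iff.2 fun k _ => g.sub_xi (ne_xiPos_of_lt hbp k)
    have h4 : ∏ k ∈ Finset.Ioi (i p), sinh (y (b p) - ξ (Fin.castLE hm k) + η) =
        ∏ j : Fin m, if (i p : ℕ) + 1 ≤ j then sinh (y (b p) - ξ (Fin.castLE hm j) + η) else 1 :=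
      prod_Ioi_eq _ _
    have h5 : ∏ j : Fin m, (if s ≤ (p : ℕ) ∧ i p < j ∧ (b p : ℕ) + j + 1 < N + m then
          (sinh (y (b p) - ξ (Fin.castLE hm j) + η))⁻¹ else 1) = 1 :=
      Finset.prod_eq_one fun j _ => if_neg fun hh => absurd hh.1 (not_le.2 hp)
    rw [h1, h5, ← h2, minusFactor, h4, aList_chain hm η ξ _ hipm]
    simp only [hp, hbp, not_le.2 hp, not_le.2 hbp, if_true, if_false, one_mul, mul_one]
    rw [mul_div_assoc', eq_comm, div_mul_eq_mul_div, div_eq_iff h3]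
    ring
  · have h6 : ¬ ((p : ℕ) < s) := not_lt.2 hp
    rcases Nat.lt_or_ge (b p : ℕ) N with hbp | hbp
    · have h1 : (∏ j : Fin m, if s ≤ (p : ℕ) ∧ i p < j ∧ (b p : ℕ) + j + 1 < N + m then
          (sinh (y (b p) - ξ (Fin.castLE hm j) + η))⁻¹ else 1) *
          (∏ j : Fin m, if (i p : ℕ) + 1 ≤ j then
            sinh (y (b p) - ξ (Fin.castLE hm j) + η) else 1) = 1 := by
        rw [← Finset.prod_mul_distrib]
        refine Finset.prod_eq_one fun j _ => ?_
        have hj := j.isLt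
        have h2 : (b p : ℕ) + j + 1 < N + m := by omega
        by_cases hij : (i p : ℕ) < j
        · have hij' : (i p : ℕ) + 1 ≤ j := hij
          simp [hp, Fin.lt_def, hij, hij', h2, g.sub_eta (b p) j]
        · have hij' : ¬ ((i p : ℕ) + 1 ≤ j) := hij
          simp [Fin.lt_def, hij, hij']
      rw [gamma_pairs g h hb hp, plusFactor_eq g hb hp, aList_chain hm η ξ _ hipm]
      simp only [hp, hbp, h6, not_le.2 hbp, if_true, if_false, one_mul, mul_one, false_and,
        and_true, not_false_eq_true, true_and]
      simp only [hp, true_and] at h1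
      linear_combination ((∏ j : Fin m, sinh (y (b p) - ξ (Fin.castLE hm j))) * sinh η *
        aList η ξ (chain M m) (y (b p)) *
        (if b p = xiPos N (i p) then 1 else (sinh (ξ (Fin.castLE hm (i p)) - y (b p)))⁻¹) *
        ((∏ l : Fin m, if i p < l ∧ b p ≠ xiPos N l then
          exch (-η) (y (b p)) (ξ (Fin.castLE hm l)) else 1) *
        (∏ q : Fin m, if q < p ∧ N ≤ (b q : ℕ) then
          (exch (-η) (y (b p)) (y (b q)))⁻¹ else 1) *
        ∏ q : Fin m, if p < q ∧ (b q : ℕ) < N then exch (-η) (y (b p)) (y (b q)) else 1)) * h1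
    · have h1 := aList_ratio g hb hp hbp
      have h2 : ∏ j : Fin m, (if (b p : ℕ) < N ∧ ¬ ((p : ℕ) < s ∧ i p ≤ j) then
          sinh (y (b p) - ξ (Fin.castLE hm j)) else 1) = 1 :=
        Finset.prod_eq_one fun j _ => if_neg fun hh => absurd hh.1 (not_lt.2 hbp)
      rw [gamma_pairs g h hb hp, plusFactor_eq g hb hp, h2, if_neg h6, if_neg h6, if_pos hp,
        if_neg (not_lt.2 hbp), if_pos hbp, ← h1]
      ring

end rows

end

/-! ### The closed form of the bulk coefficient: assembly -/

section

variable {M N m : ℕ}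

section rows

variable {hm : m ≤ M} {η : ℂ} {ξ : Fin M → ℂ} {y : Fin (N + m) → ℂ}
  {ε ε' : Fin m → Fin 2} {i : Fin m → Fin m} {s : ℕ} {b : Fin m → Fin (N + m)}

theorem aFun_eq_mul (hm : m ≤ M) (η : ℂ) (ξ : Fin M → ℂ) (u : ℂ) :
    aFun η ξ u = (∏ j : Fin m, sinh (u - ξ (Fin.castLE hm j) + η)) * aList η ξ (chain M m) u := by
  rw [aFun_eq_aList, aList_chain hm η ξ u (Nat.zero_le m)]
  simp

theorem exch_neg_eq' (η u v : ℂ) : exch (-η) u v = sinh (u - v - η) / sinh (u - v) := by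
  rw [exch, sub_eq_add_neg (u - v)]

/-- The factors of the coefficient which contain the variable at a position of `α_-`. -/
theorem alphaMinus_row (g : Generic hm η ξ y) (hb : Function.Injective b) {k : Fin (N + m)}
    (hk : k ∈ alphaMinus b) :
    (∏ j : Fin m, sinh (y k - ξ (Fin.castLE hm j))) *
      (∏ j : Fin m, (sinh (y k - ξ (Fin.castLE hm j) + η))⁻¹) *
      (∏ p, exch (-η) (y (b p)) (y k)) =
    (∏ j ∈ alphaPlus b, sinh (y j - y k - η) / sinh (y j - y k)) *
      ∏ j ∈ gammaPlus b,
        sinh (ξ (Fin.castLE hm j) - y k) / sinh (ξ (Fin.castLE hm j) - y k - η) := by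
  have h1 := prod_sites_split hb fun k' => sinh (y k - y k') * (sinh (y k - y k' + η))⁻¹
  simp only [g.xi] at h1
  rw [← Finset.prod_mul_distrib, h1, prod_alphaPlus hb, mul_assoc, ← Finset.prod_mul_distrib,
    mul_comm]
  congr 1
  · refine Finset.prod_congr rfl fun p _ => ?_
    have h2 := g.sub _ _ (alphaMinus_ne hk p)
    by_cases hp : (b p : ℕ) < N
    · rw [if_pos hp, if_neg (not_le.2 hp), one_mul, exch_neg_eq']
    · rw [if_neg hp, if_pos (not_lt.1 hp), exch_neg_eq]
      have h3 := g.sub _ _ (alphaMinus_ne hk p).symm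
      obtain ⟨j, hj⟩ := exists_xiPos (b p) (not_lt.1 hp)
      have h4 := g.sub_eta k j
      rw [← g.xi, hj] at h4
      rw [← div_eq_mul_inv, div_mul_div_comm, mul_comm, div_self (mul_ne_zero h4 h3)]
  · refine Finset.prod_congr rfl fun j _ => ?_
    rw [← div_eq_mul_inv, sinh_sub_comm (y k), show y k - ξ (Fin.castLE hm j) + η =
      -(ξ (Fin.castLE hm j) - y k - η) by ring, sinh_neg, neg_div_neg_eq]

/-- The factors of the coefficient which contain `ξ_l`, `l ∈ γ_+`, and no other variable. -/
theorem gammaPlus_row (hm : m ≤ M) (η : ℂ) (ξ : Fin M → ℂ) (l : Fin m) :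
    (aList η ξ (chain M l) (ξ (Fin.castLE hm l)))⁻¹ *
        (∏ j : Fin m, if j < l then
          (sinh (ξ (Fin.castLE hm l) - ξ (Fin.castLE hm j) + η))⁻¹ else 1) =
      (aFun η ξ (ξ (Fin.castLE hm l)))⁻¹ := by
  rw [aFun_eq_mul hm, aList_chain hm η ξ _ l.isLt.le, mul_inv, mul_inv, mul_right_comm,
    ← Finset.prod_inv_distrib, ← Finset.prod_inv_distrib, ← Finset.prod_mul_distrib]
  congr 1
  refine Finset.prod_congr rfl fun j _ => ?_
  by_cases h : j < l
  · simp [h, not_le.2 (Fin.lt_def.1 h)]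
  · simp [h, Fin.le_def.1 (not_lt.1 h)]

/-- The quotients `a(λ_{b_p}) / a(ξ_j)`, the factors with equal arguments being cancelled. -/
theorem prod_aFun_div (g : Generic hm η ξ y) (hb : Function.Injective b) :
    ∏ j : Fin m, aFun η ξ (y (b j)) / aFun η ξ (ξ (Fin.castLE hm j)) =
      (∏ p, if (b p : ℕ) < N then aFun η ξ (y (b p)) else 1) *
        ∏ l ∈ gammaPlus b, (aFun η ξ (ξ (Fin.castLE hm l)))⁻¹ := by
  have h1 := prod_sites_split hb fun k => (aFun η ξ (y k))⁻¹
  simp only [g.xi] at h1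
  simp only [div_eq_mul_inv]
  rw [Finset.prod_mul_distrib, h1, mul_comm (∏ l ∈ gammaPlus b, _), ← mul_assoc,
    ← Finset.prod_mul_distrib]
  congr 1
  refine Finset.prod_congr rfl fun p _ => ?_
  by_cases hp : (b p : ℕ) < N
  · rw [if_pos hp, if_neg (not_le.2 hp), mul_one]
  · rw [if_neg hp, if_pos (not_lt.1 hp), mul_inv_cancel₀]
    rw [aFun_eq_aList]
    exact g.aList_ne' (not_lt.1 hp) _

/-- The numerator `a(λ_{b_p})` contains one factor for each of the sites `1, …, m`; those of the
sites not in `γ_+` are turned into factors of pairs. -/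
theorem alphaPlus_aFun (g : Generic hm η ξ y) (hb : Function.Injective b) {p : Fin m}
    (hp : (b p : ℕ) < N) :
    aFun η ξ (y (b p)) * (∏ j ∈ gammaPlus b,
      sinh (ξ (Fin.castLE hm j) - y (b p)) / sinh (ξ (Fin.castLE hm j) - y (b p) - η)) =
    aList η ξ (chain M m) (y (b p)) * (∏ j : Fin m, sinh (y (b p) - ξ (Fin.castLE hm j))) *
      ∏ q, if N ≤ (b q : ℕ) then exch (-η) (y (b q)) (y (b p)) else 1 := by
  have h1 := prod_sites_split hb fun k => sinh (y (b p) - y k)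
  have h2 := prod_sites_split hb fun k => sinh (y (b p) - y k + η)
  simp only [g.xi] at h1 h2
  rw [aFun_eq_mul hm, h1, h2, ← mul_assoc (aList _ _ _ _), mul_assoc _ (∏ _, _) (∏ _, _),
    ← Finset.prod_mul_distrib]
  have h3 : ∀ q, ((if N ≤ (b q : ℕ) then sinh (y (b p) - y (b q)) else 1) *
      if N ≤ (b q : ℕ) then exch (-η) (y (b q)) (y (b p)) else 1) =
      if N ≤ (b q : ℕ) then sinh (y (b p) - y (b q) + η) else 1 := by
    intro q
    split_ifs with hq
    · rw [exch_neg_eq, mul_div_cancel₀]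
      exact g.sub _ _ fun h => by rw [h] at hp; omega
    · rw [one_mul]
  have h4 : ∏ l ∈ gammaPlus b, sinh (y (b p) - ξ (Fin.castLE hm l)) =
      (∏ l ∈ gammaPlus b, sinh (y (b p) - ξ (Fin.castLE hm l) + η)) * ∏ j ∈ gammaPlus b,
      sinh (ξ (Fin.castLE hm j) - y (b p)) / sinh (ξ (Fin.castLE hm j) - y (b p) - η) := by
    rw [← Finset.prod_mul_distrib]
    refine Finset.prod_congr rfl fun l _ => ?_
    have h5 := g.sub_eta (b p) l
    have h6 : sinh (y (b p) - ξ (Fin.castLE hm l) + η) =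
      -sinh (ξ (Fin.castLE hm l) - y (b p) - η) := by rw [← sinh_neg]; congr 1; ring
    rw [h6] at h5 ⊢
    rw [sinh_sub_comm, neg_mul, mul_div_cancel₀ _ (neg_ne_zero.1 h5)]
  rw [Finset.prod_congr rfl fun q _ => h3 q, h4]
  ring

/-- The factors of a fixed `b_p ≤ N` with the other elements of `α_+`. -/
theorem alphaPlus_ratio (η : ℂ) (y : Fin (N + m) → ℂ) (hb : Function.Injective b) {p : Fin m}
    (hp : (b p : ℕ) < N) :
    (∏ j ∈ alphaPlus b, sinh (y j - y (b p) + η)) /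
        (∏ j ∈ (alphaPlus b).erase (b p), sinh (y j - y (b p))) =
      sinh η * ∏ q, if q ≠ p ∧ (b q : ℕ) < N then exch (-η) (y (b p)) (y (b q)) else 1 := by
  have h1 : ∏ j ∈ (alphaPlus b).erase (b p), sinh (y j - y (b p)) =
      ∏ q, if q ≠ p ∧ (b q : ℕ) < N then sinh (y (b q) - y (b p)) else 1 := by
    rw [← Finset.filter_ne', Finset.prod_filter, prod_alphaPlus hb]
    refine Finset.prod_congr rfl fun q _ => ?_
    simp only [hb.ne_iff, ite_and]
    split_ifs <;> rfl
  have h2 : sinh η = ∏ q : Fin m, if q = p then sinh η else 1 := by simp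
  rw [h1, h2, prod_alphaPlus hb, ← Finset.prod_div_distrib, ← Finset.prod_mul_distrib]
  refine Finset.prod_congr rfl fun q _ => ?_
  by_cases hq : q = p
  · subst hq
    simp [hp]
  · by_cases hqN : (b q : ℕ) < N
    · simp [hq, hqN, exch_neg_eq]
    · simp [hqN]
      simp [hq]

/-- The factors `sinh (λ_{b_p} - λ_{b_q} + κ)`: on one side they come from the ordered exchange
of operators, on the other one from the symmetric form of the coefficient. -/
theorem pairs_eq (g : Generic hm η ξ y) (hb : Function.Injective b) :
    (∏ p : Fin m, ∏ q : Fin m with p < q,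
      sinh (y (b p) - y (b q)) / sinh (y (b p) - y (b q) + η)) *
    (∏ p : Fin m, if (b p : ℕ) < N then
      (∏ q : Fin m, if N ≤ (b q : ℕ) then exch (-η) (y (b q)) (y (b p)) else 1) *
      ∏ q : Fin m, if q ≠ p ∧ (b q : ℕ) < N then exch (-η) (y (b p)) (y (b q)) else 1 else 1) =
    ∏ p : Fin m,
      ((∏ q : Fin m, if q < p ∧ N ≤ (b q : ℕ) then (exch (-η) (y (b p)) (y (b q)))⁻¹ else 1) *
      ∏ q : Fin m, if p < q ∧ (b q : ℕ) < N then exch (-η) (y (b p)) (y (b q)) else 1) := by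
  have h1 : (∏ p : Fin m, ∏ q : Fin m with p < q,
      sinh (y (b p) - y (b q)) / sinh (y (b p) - y (b q) + η)) =
      ∏ p : Fin m, ∏ q : Fin m, if q < p then (exch (-η) (y (b p)) (y (b q)))⁻¹ else 1 := by
    simp only [Finset.prod_filter]
    rw [Finset.prod_comm]
    refine Finset.prod_congr rfl fun p _ => Finset.prod_congr rfl fun q _ => ?_
    rw [exch_neg_eq, inv_div]
  have h2 : (∏ p : Fin m, if (b p : ℕ) < N then
      (∏ q : Fin m, if N ≤ (b q : ℕ) then exch (-η) (y (b q)) (y (b p)) else 1) *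
      ∏ q : Fin m, if q ≠ p ∧ (b q : ℕ) < N then exch (-η) (y (b p)) (y (b q)) else 1 else 1) =
      (∏ p : Fin m, ∏ q : Fin m, if N ≤ (b p : ℕ) ∧ (b q : ℕ) < N then
        exch (-η) (y (b p)) (y (b q)) else 1) *
      ∏ p : Fin m, ∏ q : Fin m, if (b p : ℕ) < N ∧ q ≠ p ∧ (b q : ℕ) < N then
        exch (-η) (y (b p)) (y (b q)) else 1 := by
    rw [Finset.prod_comm (f := fun p q : Fin m => if N ≤ (b p : ℕ) ∧ (b q : ℕ) < N then
        exch (-η) (y (b p)) (y (b q)) else 1), ← Finset.prod_mul_distrib]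
    refine Finset.prod_congr rfl fun p _ => ?_
    by_cases hp : (b p : ℕ) < N <;> simp [hp]
  rw [h1, h2, ← Finset.prod_mul_distrib, ← Finset.prod_mul_distrib]
  refine Finset.prod_congr rfl fun p _ => ?_
  rw [← Finset.prod_mul_distrib, ← Finset.prod_mul_distrib, ← Finset.prod_mul_distrib]
  refine Finset.prod_congr rfl fun q _ => ?_
  rcases lt_trichotomy p q with hpq | rfl | hpq
  · by_cases hp : (b p : ℕ) < N <;> by_cases hq : (b q : ℕ) < N <;>
      simp [hpq, hpq.asymm, hpq.ne', ← not_lt, hp, hq]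
  · by_cases hp : (b p : ℕ) < N <;> simp [hp]
  · have h3 := g.exch_ne hb hpq.ne'
    by_cases hp : (b p : ℕ) < N <;> by_cases hq : (b q : ℕ) < N <;>
      simp [hpq, hpq.asymm, hpq.ne, ← not_lt, hp, hq, h3]

/-- The coefficient of the action on a bulk Bethe vector, in closed form. -/
theorem prod_flipFactor_mul (g : Generic hm η ξ y) (h : SiteOrder ε ε' i s)
    (hb : Admissible i s b) :
    (∏ j : Fin m, flipFactor hm η ξ y i s j b) * (∏ j : Fin m, restoreFactor hm η ξ y i s j b) =
      bulkCoeff hm η ξ y i s b := by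
  rw [prod_flipFactor h hb, prod_restoreFactor h hb g.xi, bulkCoeff, prod_aFun_div g hb.inj]
  have hflip : ∀ p : Fin m, (if (p : ℕ) < s then sinh η * aList η ξ (chain M (i p + 1)) (y (b p)) *
      ((∏ k ∈ alphaMinus b, exch (-η) (y (b p)) (y k)) *
        ∏ q : Fin m, if p < q ∧ (b q : ℕ) < N then exch (-η) (y (b p)) (y (b q)) else 1) else 1) =
      (if (p : ℕ) < s then ∏ k ∈ alphaMinus b, exch (-η) (y (b p)) (y k) else 1) *
      (if (p : ℕ) < s then sinh η * aList η ξ (chain M (i p + 1)) (y (b p)) *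
        ∏ q : Fin m, if p < q ∧ (b q : ℕ) < N then
          exch (-η) (y (b p)) (y (b q)) else 1 else 1) := by
    intro p; split_ifs
    · ring
    · rw [one_mul]
  have hrestore : ∀ p : Fin m, (if s ≤ (p : ℕ) then
      sinh η * aList η ξ (chain M (i p + 1)) (y (b p)) *
        (if b p = xiPos N (i p) then 1 else (sinh (ξ (Fin.castLE hm (i p)) - y (b p)))⁻¹) *
        ((∏ k ∈ alphaMinus b, exch (-η) (y (b p)) (y k)) *
          (∏ l ∈ gammaPlus b, if i p < l then
            exch (-η) (y (b p)) (ξ (Fin.castLE hm l)) else 1) *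
          ∏ q : Fin m, if p < q ∧ (b q : ℕ) + i p + 1 < N + m then
            exch (-η) (y (b p)) (y (b q)) else 1) else 1) =
      (if s ≤ (p : ℕ) then ∏ k ∈ alphaMinus b, exch (-η) (y (b p)) (y k) else 1) *
      (if s ≤ (p : ℕ) then sinh η * aList η ξ (chain M (i p + 1)) (y (b p)) *
        (if b p = xiPos N (i p) then 1 else (sinh (ξ (Fin.castLE hm (i p)) - y (b p)))⁻¹) *
        ((∏ l ∈ gammaPlus b, if i p < l then
            exch (-η) (y (b p)) (ξ (Fin.castLE hm l)) else 1) *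
          ∏ q : Fin m, if p < q ∧ (b q : ℕ) + i p + 1 < N + m then
            exch (-η) (y (b p)) (y (b q)) else 1) else 1) := by
    intro p; split_ifs
    · ring
    · ring
    · rw [one_mul]
  have hα : (∏ k ∈ alphaMinus b, ∏ j : Fin m, sinh (y k - ξ (Fin.castLE hm j))) *
      (∏ k ∈ alphaMinus b, ∏ j : Fin m, (sinh (y k - ξ (Fin.castLE hm j) + η))⁻¹) *
      ((∏ p : Fin m, if (p : ℕ) < s then ∏ k ∈ alphaMinus b, exch (-η) (y (b p)) (y k) else 1) *
        ∏ p : Fin m, if s ≤ (p : ℕ) then ∏ k ∈ alphaMinus b, exch (-η) (y (b p)) (y k) else 1) =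
      ∏ k ∈ alphaMinus b, ((∏ j ∈ alphaPlus b, sinh (y j - y k - η) / sinh (y j - y k)) *
      ∏ j ∈ gammaPlus b,
        sinh (ξ (Fin.castLE hm j) - y k) / sinh (ξ (Fin.castLE hm j) - y k - η)) := by
    refine Eq.trans ?_ (Finset.prod_congr rfl fun k hk => alphaMinus_row g hb.inj hk)
    rw [Finset.prod_mul_distrib, Finset.prod_mul_distrib, ← Finset.prod_mul_distrib (s := .univ)]
    congr 1
    rw [Finset.prod_comm]
    refine Finset.prod_congr rfl fun p _ => ?_
    by_cases hp : (p : ℕ) < s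
    · rw [if_pos hp, if_neg (not_le.2 hp), mul_one]
    · rw [if_neg hp, if_pos (not_lt.1 hp), one_mul]
  have hrow := Finset.prod_congr (rfl : (Finset.univ : Finset (Fin m)) = _) fun p _ =>
    selected_row_eq g h hb p
  simp only [Finset.prod_mul_distrib] at hrow
  have hplus : (∏ p : Fin m, if (b p : ℕ) < N then aFun η ξ (y (b p)) else 1) *
      (∏ k ∈ alphaPlus b, ((∏ j ∈ gammaPlus b,
        sinh (ξ (Fin.castLE hm j) - y k) / sinh (ξ (Fin.castLE hm j) - y k - η)) *
      ((∏ j ∈ alphaPlus b, sinh (y j - y k + η)) /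
        ∏ j ∈ (alphaPlus b).erase k, sinh (y j - y k)))) =
      (∏ p : Fin m, if (b p : ℕ) < N then sinh η * aList η ξ (chain M m) (y (b p)) *
        ∏ j : Fin m, sinh (y (b p) - ξ (Fin.castLE hm j)) else 1) *
      ∏ p : Fin m, if (b p : ℕ) < N then
        (∏ q : Fin m, if N ≤ (b q : ℕ) then exch (-η) (y (b q)) (y (b p)) else 1) *
        ∏ q : Fin m, if q ≠ p ∧ (b q : ℕ) < N then
          exch (-η) (y (b p)) (y (b q)) else 1 else 1 := by
    rw [prod_alphaPlus hb.inj, ← Finset.prod_mul_distrib, ← Finset.prod_mul_distrib]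
    refine Finset.prod_congr rfl fun p _ => ?_
    split_ifs with hp
    · rw [← mul_assoc, alphaPlus_aFun g hb.inj hp, alphaPlus_ratio η y hb.inj hp]
      ring
    · rfl
  have hlast : (∏ p ∈ Finset.univ.filter (fun p : Fin m => (p : ℕ) < s), minusFactor hm η ξ y i b p) *
      (∏ p ∈ Finset.univ.filter (fun p : Fin m => s ≤ (p : ℕ)), plusFactor hm η ξ y i b p) =
      ∏ p : Fin m, if (p : ℕ) < s then minusFactor hm η ξ y i b p else plusFactor hm η ξ y i b p := by
    rw [Finset.prod_ite]
    simp only [not_lt]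
  have hpairs := pairs_eq g hb.inj
  have key : ∀ A A' B C D R₁ R₂ R₃ R₄ R₅ F P G H L L₁ L₂ W X Y : ℂ,
      R₁ * R₂ * (R₃ * R₄) * R₅ = H * L * (X * Y) → F * P = H * W → D * W = X * Y → L₁ * L₂ = L →
      A * R₁ * (B * R₂) * (A' * G * (R₃ * R₄) * (C * R₅)) =
        F * G * D * (A * A' * (B * C)) * P * L₁ * L₂ := by
    intro A A' B C D R₁ R₂ R₃ R₄ R₅ F P G H L L₁ L₂ W X Y e₁ e₂ e₃ e₄
    rw [← e₄] at e₁
    linear_combination A * A' * B * C * G * (e₁ - D * L₁ * L₂ * e₂ - H * L₁ * L₂ * e₃)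
  rw [← hα, Finset.prod_congr rfl fun l _ => gammaPlus_row hm η ξ l]
  simp only [hflip, hrestore]
  rw [Finset.prod_mul_distrib (s := Finset.univ) (f := fun p : Fin m => if (p : ℕ) < s then
      ∏ k ∈ alphaMinus b, exch (-η) (y (b p)) (y k) else 1),
    Finset.prod_mul_distrib (s := Finset.univ) (f := fun p : Fin m => if s ≤ (p : ℕ) then
      ∏ k ∈ alphaMinus b, exch (-η) (y (b p)) (y k) else 1),
    Finset.prod_mul_distrib (s := Finset.univ) (f := fun p : Fin m => if N ≤ (b p : ℕ) then
      (aList η ξ (chain M (N + m - 1 - b p)) (y (b p)))⁻¹ else 1)]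
  rw [Finset.prod_mul_distrib (s := Finset.univ) (f := fun p : Fin m =>
    ∏ q : Fin m, if q < p ∧ N ≤ (b q : ℕ) then (exch (-η) (y (b p)) (y (b q)))⁻¹ else 1)] at hpairs
  exact key _ _ _ _ _ _ _ _ _ _ _ _ _ _ _ _ _ _ _ _ hrow hplus hpairs hlast

end rows

end

/-! ### Signs and generic parameters -/

section

variable {M N m : ℕ}

section signs

variable {ι : Type}

theorem mem_signsOn [Fintype ι] [DecidableEq ι] {S : Finset ι} {σ : ι → ℤˣ} :
    σ ∈ signsOn S ↔ ∀ k, k ∉ S → σ k = 1 := by simp [signsOn]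

/-- A choice of signs on a disjoint union is a pair of choices on the parts. -/
theorem sum_signsOn_union [Fintype ι] [DecidableEq ι] {E : Type*} [AddCommMonoid E]
    {A B : Finset ι} (h : Disjoint A B) (F : (ι → ℤˣ) → E) :
    ∑ σ ∈ signsOn (A ∪ B), F σ = ∑ σ₁ ∈ signsOn A, ∑ σ₂ ∈ signsOn B, F (σ₁ * σ₂) := by
  rw [← Finset.sum_product']
  have hB : ∀ k ∈ B, k ∉ A := fun k hk hk' => Finset.disjoint_left.1 h hk' hk
  refine Finset.sum_bij' (fun σ _ => (fun k => if k ∈ A then σ k else 1,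
    fun k => if k ∈ B then σ k else 1)) (fun τ _ => τ.1 * τ.2) ?_ ?_ ?_ ?_ ?_
  · intro σ _
    simp only [Finset.mem_product, mem_signsOn]
    exact ⟨fun k hk => if_neg hk, fun k hk => if_neg hk⟩
  · intro τ hτ
    simp only [Finset.mem_product, mem_signsOn] at hτ
    rw [mem_signsOn]
    intro k hk
    rw [Finset.mem_union, not_or] at hk
    rw [Pi.mul_apply, hτ.1 k hk.1, hτ.2 k hk.2, one_mul]
  · intro σ hσ
    rw [mem_signsOn] at hσ
    funext k
    by_cases hA : k ∈ A
    · have : k ∉ B := fun h => hB k h hA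
      simp [hA, this]
    · by_cases hkB : k ∈ B
      · simp [hA, hkB]
      · simp [hA, hkB, hσ k (by simp [hA, hkB])]
  · intro τ hτ
    simp only [Finset.mem_product, mem_signsOn] at hτ
    refine Prod.ext (funext fun k => ?_) (funext fun k => ?_)
    · by_cases hA : k ∈ A
      · have : k ∉ B := fun h => hB k h hA
        simp [hA, hτ.2 k this]
      · simp [hA, hτ.1 k hA]
    · by_cases hkB : k ∈ B
      · simp [hkB, hτ.1 k (hB k hkB)]
      · simp [hkB, hτ.2 k hkB]
  · intro σ hσ
    rw [mem_signsOn] at hσ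
    congr 1
    funext k
    by_cases hA : k ∈ A
    · have : k ∉ B := fun h => hB k h hA
      simp [hA, this]
    · by_cases hkB : k ∈ B
      · simp [hA, hkB]
      · simp [hA, hkB, hσ k (by simp [hA, hkB])]

variable [LinearOrder ι] {η ξp : ℂ} {ξ : Fin M → ℂ}

theorem HBplus_union {A B : Finset ι} (h : Disjoint A B) (σ : ι → ℤˣ) (x : ι → ℂ) :
    HBplus η ξp ξ (A ∪ B) σ x = HBplus η ξp ξ A σ x * HBplus η ξp ξ B σ x *
      ∏ k ∈ B, ∏ r ∈ A, pairFactor η (sgn σ x r) (sgn σ x k) := by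
  induction B using Finset.induction_on with
  | empty => simp [HBplus_empty]
  | insert k B hk ih =>
    rw [Finset.disjoint_insert_right] at h
    have hkAB : k ∉ A ∪ B := by simp [h.1, hk]
    rw [Finset.union_insert, HBplus_insert _ hkAB, HBplus_insert _ hk, ih h.2,
      Finset.prod_insert hk, Finset.prod_union h.2,
      Finset.prod_congr rfl fun r _ => pairFactor_comm η (sgn σ x k) (sgn σ x r)]
    ring

/-- The coefficient `H_σ` depends on the variables only, not on the labels. The order of the labels
does not matter because the factor of a pair is symmetric. -/
theorem HBplus_image {κ : Type} [LinearOrder κ] {f : κ → ι} (hf : Function.Injective f)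
    (S : Finset κ) {σ : ι → ℤˣ} {τ : κ → ℤˣ} {x : ι → ℂ} {z : κ → ℂ}
    (hσ : ∀ k ∈ S, σ (f k) = τ k) (hx : ∀ k ∈ S, x (f k) = z k) :
    HBplus η ξp ξ (S.image f) σ x = HBplus η ξp ξ S τ z := by
  induction S using Finset.induction_on with
  | empty => simp [HBplus_empty]
  | insert k S hk ih =>
    have hk' : f k ∉ S.image f := by
      rw [Finset.mem_image]; rintro ⟨r, hr, hrk⟩; exact hk (hf hrk ▸ hr)
    rw [Finset.image_insert, HBplus_insert _ hk', HBplus_insert _ hk,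
      ih (fun r hr => hσ r (Finset.mem_insert_of_mem hr))
        (fun r hr => hx r (Finset.mem_insert_of_mem hr)),
      Finset.prod_image fun _ _ _ _ h => hf h, hσ k (Finset.mem_insert_self _ _),
      hx k (Finset.mem_insert_self _ _)]
    congr 2
    refine Finset.prod_congr rfl fun r hr => ?_
    simp only [sgn, hσ k (Finset.mem_insert_self _ _), hx k (Finset.mem_insert_self _ _),
      hσ r (Finset.mem_insert_of_mem hr), hx r (Finset.mem_insert_of_mem hr)]

/-- The coefficient `H_σ` vanishes if a sign `-` is attached to an inhomogeneity, since
`d(ξ_j) = 0`. -/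
theorem HBplus_eq_zero {S : Finset ι} {σ : ι → ℤˣ} {x : ι → ℂ} {k : ι} (hk : k ∈ S)
    (hσ : σ k = -1) {j : Fin M} (hj : x k = ξ j) : HBplus η ξp ξ S σ x = 0 := by
  rw [HBplus, Finset.prod_eq_zero hk, zero_mul]
  have h : dFun ξ (-sgn σ x k) = 0 := by
    rw [dFun]
    refine Finset.prod_eq_zero (Finset.mem_univ j) ?_
    simp [sgn, hσ, hj]
  rw [h]; ring

end signs

/-- The genericity conditions on the parameters. -/
structure GenericParams (hm : m ≤ M) (η ξp : ℂ) (ξ : Fin M → ℂ) (lam : Fin N → ℂ) : Prop where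
  lam_two : ∀ k, sinh (2 * lam k) ≠ 0
  lam_lam : ∀ k l, k ≠ l → ∀ e : ℤˣ, sinh (lam k + ((e : ℤ) : ℂ) * lam l) ≠ 0
  lam_lam_eta : 2 ≤ m → ∀ k l, k ≠ l → ∀ e f : ℤˣ,
    sinh (lam k + ((e : ℤ) : ℂ) * lam l + ((f : ℤ) : ℂ) * η) ≠ 0
  xi_lam : ∀ (j : Fin m) (k : Fin N) (e : ℤˣ),
    sinh (ξ (Fin.castLE hm j) + ((e : ℤ) : ℂ) * lam k) ≠ 0
  xi_lam_sub : ∀ (j : Fin m) (k : Fin N) (e : ℤˣ),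
    sinh (ξ (Fin.castLE hm j) + ((e : ℤ) : ℂ) * lam k - η) ≠ 0
  xi_lam_add : 2 ≤ m → ∀ (j : Fin m) (k : Fin N) (e : ℤˣ),
    sinh (ξ (Fin.castLE hm j) + ((e : ℤ) : ℂ) * lam k + η) ≠ 0
  xi_sub : ∀ j l : Fin m, j ≠ l → sinh (ξ (Fin.castLE hm j) - ξ (Fin.castLE hm l)) ≠ 0
  xi_sub_eta : ∀ (j : Fin m) (i : Fin M), sinh (ξ (Fin.castLE hm j) - ξ i + η) ≠ 0
  xi_add : ∀ (j : Fin m) (i : Fin M), sinh (ξ (Fin.castLE hm j) + ξ i) ≠ 0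
  xi_add_eta : ∀ j l : Fin m, j ≠ l →
    sinh (ξ (Fin.castLE hm j) + ξ (Fin.castLE hm l) - η) ≠ 0
  xi_two : ∀ j : Fin m, sinh (2 * ξ (Fin.castLE hm j) + η) ≠ 0
  xi_bdry : ∀ j : Fin m, sinh (ξ (Fin.castLE hm j) + ξp - η / 2) ≠ 0

section params

variable {hm : m ≤ M} {η ξp : ℂ} {ξ : Fin M → ℂ} {lam : Fin N → ℂ}

theorem extVar_castAdd (hm : m ≤ M) (ξ : Fin M → ℂ) (lam : Fin N → ℂ) (k : Fin N) :
    extVar hm ξ lam (Fin.castAdd m k) = lam k := by simp [extVar]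

theorem extVar_xiPos (hm : m ≤ M) (ξ : Fin M → ℂ) (lam : Fin N → ℂ) (j : Fin m) :
    extVar hm ξ lam (xiPos N j) = ξ (Fin.castLE hm j) := by simp [extVar, xiPos]

theorem castAdd_or_xiPos (k : Fin (N + m)) :
    (∃ l : Fin N, Fin.castAdd m l = k) ∨ ∃ j : Fin m, xiPos N j = k := by
  rcases Nat.lt_or_ge (k : ℕ) N with h | h
  · exact Or.inl ⟨⟨k, h⟩, rfl⟩
  · exact Or.inr (exists_xiPos k h)

theorem mem_posSet_self (k : Fin (N + m)) : k ∈ posSet N m m ↔ (k : ℕ) < N := by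
  rw [mem_posSet]; omega

theorem sgn_xiPos {S : Finset (Fin (N + m))} (hS : ∀ k ∈ S, (k : ℕ) < N)
    {σ : Fin (N + m) → ℤˣ} (hσ : σ ∈ signsOn S) (j : Fin m) :
    sgn σ (extVar hm ξ lam) (xiPos N j) = ξ (Fin.castLE hm j) := by
  have h : σ (xiPos N j) = 1 := mem_signsOn.1 hσ _ fun h =>
    absurd (hS _ h) (not_lt.2 (le_xiPos j))
  rw [sgn, h, extVar_xiPos]
  simp

/-- For all signs of the `λ_k`, the signed variables are generic for the bulk formula. -/
theorem GenericParams.generic (g : GenericParams hm η ξp ξ lam) {σ : Fin (N + m) → ℤˣ}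
    (hσ : σ ∈ signsOn (posSet N m m)) : Generic hm η ξ (sgn σ (extVar hm ξ lam)) := by
  have hxi : ∀ j, sgn σ (extVar hm ξ lam) (xiPos N j) = ξ (Fin.castLE hm j) :=
    sgn_xiPos (fun k hk => (mem_posSet_self k).1 hk) hσ
  have hlam : ∀ l, sgn σ (extVar hm ξ lam) (Fin.castAdd m l) =
      ((σ (Fin.castAdd m l) : ℤ) : ℂ) * lam l := fun l => by rw [sgn, extVar_castAdd]
  have hsub : ∀ (j : Fin m) (l : Fin N) (e : ℤˣ),
      sinh (((e : ℤ) : ℂ) * lam l - ξ (Fin.castLE hm j)) ≠ 0 := by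
    intro j l e
    have := g.xi_lam j l (-e)
    rw [← neg_ne_zero, ← sinh_neg] at this
    convert this using 2
    push_cast; ring
  have hsubη : ∀ (j : Fin m) (l : Fin N) (e : ℤˣ),
      sinh (((e : ℤ) : ℂ) * lam l - ξ (Fin.castLE hm j) + η) ≠ 0 := by
    intro j l e
    have := g.xi_lam_sub j l (-e)
    rw [← neg_ne_zero, ← sinh_neg] at this
    convert this using 2
    push_cast; ring
  refine ⟨hxi, ?_, ?_, ?_, g.xi_sub_eta⟩
  · intro k k' hkk
    rcases castAdd_or_xiPos k with ⟨l, rfl⟩ | ⟨j, rfl⟩ <;>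
      rcases castAdd_or_xiPos k' with ⟨l', rfl⟩ | ⟨j', rfl⟩
    · rw [hlam, hlam]
      have := sinh_sign_ne_zero (g.lam_lam l l' fun h => hkk (by rw [h]))
        (σ (Fin.castAdd m l)) (-σ (Fin.castAdd m l'))
      convert this using 2
      push_cast; ring
    · rw [hlam, hxi]; exact hsub _ _ _
    · rw [hlam, hxi, ← neg_ne_zero, ← sinh_neg, neg_sub]; exact hsub _ _ _
    · rw [hxi, hxi]; exact g.xi_sub _ _ fun h => hkk (by rw [h])
  · intro k j
    rcases castAdd_or_xiPos k with ⟨l, rfl⟩ | ⟨j', rfl⟩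
    · rw [hlam]; exact hsubη _ _ _
    · rw [hxi]; exact g.xi_sub_eta _ _
  · intro h2 k k' hkk
    rcases castAdd_or_xiPos k with ⟨l, rfl⟩ | ⟨j, rfl⟩ <;>
      rcases castAdd_or_xiPos k' with ⟨l', rfl⟩ | ⟨j', rfl⟩
    · rw [hlam, hlam]
      have hl : l ≠ l' := fun h => hkk (by rw [h])
      rcases Int.units_eq_one_or (σ (Fin.castAdd m l)) with h | h
      · convert g.lam_lam_eta h2 l l' hl (-σ (Fin.castAdd m l')) 1 using 2
        rw [h]; push_cast; ring
      · have := g.lam_lam_eta h2 l l' hl (σ (Fin.castAdd m l')) (-1)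
        rw [← neg_ne_zero, ← sinh_neg] at this
        convert this using 2
        rw [h]; push_cast; ring
    · rw [hlam, hxi]; exact hsubη _ _ _
    · rw [hlam, hxi]
      convert g.xi_lam_add h2 j l' (-σ (Fin.castAdd m l')) using 2
      push_cast; ring
    · rw [hxi, hxi]; exact g.xi_sub_eta _ _

theorem GenericParams.two_ne (g : GenericParams hm η ξp ξ lam) (k : Fin (N + m)) :
    sinh (2 * extVar hm ξ lam k) ≠ 0 := by
  rcases castAdd_or_xiPos k with ⟨l, rfl⟩ | ⟨j, rfl⟩
  · rw [extVar_castAdd]; exact g.lam_two l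
  · rw [extVar_xiPos, two_mul]; exact g.xi_add j _

theorem GenericParams.add_ne (g : GenericParams hm η ξp ξ lam) (k k' : Fin (N + m)) (hkk : k ≠ k')
    (e : ℤˣ) : sinh (extVar hm ξ lam k + ((e : ℤ) : ℂ) * extVar hm ξ lam k') ≠ 0 := by
  rcases castAdd_or_xiPos k with ⟨l, rfl⟩ | ⟨j, rfl⟩ <;>
    rcases castAdd_or_xiPos k' with ⟨l', rfl⟩ | ⟨j', rfl⟩
  · rw [extVar_castAdd, extVar_castAdd]; exact g.lam_lam l l' (fun h => hkk (by rw [h])) e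
  · rw [extVar_castAdd, extVar_xiPos]
    have := sinh_sign_ne_zero (g.xi_lam j' l) e 1
    convert this using 2
    push_cast; ring
  · rw [extVar_castAdd, extVar_xiPos]; exact g.xi_lam j l' e
  · rw [extVar_xiPos, extVar_xiPos]
    rcases Int.units_eq_one_or e with rfl | rfl
    · simpa using g.xi_add j (Fin.castLE hm j')
    · simpa [← sub_eq_add_neg] using g.xi_sub j j' fun h => hkk (by rw [h])

theorem GenericParams.HBplus_ne (g : GenericParams hm η ξp ξ lam) (S : Finset (Fin m)) :
    HBplus η ξp ξ S (fun _ => 1) (fun j => ξ (Fin.castLE hm j)) ≠ 0 := by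
  have h1 : ∀ j, sgn (fun _ => 1) (fun j : Fin m => ξ (Fin.castLE hm j)) j =
      ξ (Fin.castLE hm j) := fun j => by simp [sgn]
  rw [HBplus]
  simp only [h1]
  refine mul_ne_zero (Finset.prod_ne_zero_iff.2 fun j _ => ?_)
    (Finset.prod_ne_zero_iff.2 fun j _ => Finset.prod_ne_zero_iff.2 fun l hl => ?_)
  · refine mul_ne_zero (mul_ne_zero (mul_ne_zero (by simp) ?_) (div_ne_zero (g.xi_two j) ?_))
      (g.xi_bdry j)
    · rw [dFun]
      refine Finset.prod_ne_zero_iff.2 fun i _ => ?_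
      rw [← neg_add', sinh_neg, neg_ne_zero]
      exact g.xi_add j i
    · rw [two_mul]; exact g.xi_add j _
  · exact div_ne_zero (g.xi_add_eta j l (Finset.mem_filter.1 hl).2.ne) (g.xi_add j _)

/-- The boundary-bulk relation for the right-hand side: only the signs of the variables from
`α_-` are summed over. -/
theorem GenericParams.rhs_vector (g : GenericParams hm η ξp ξ lam) (b : Fin m → Fin (N + m)) :
    (((List.finRange (N + m)).filter (fun k => k ∉ bSet b)).map
      (fun k => Bplus η ξp ξ (extVar hm ξ lam k))).prod *ᵥ vacuum M =
    ∑ σ ∈ signsOn (alphaMinus b), HBplus η ξp ξ (Finset.univ \ bSet b) σ (extVar hm ξ lam) •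
      bethe η ξ (List.nodup_finRange M) (sgn σ (extVar hm ξ lam)) (Finset.univ \ bSet b) := by
  have hL : ((List.finRange (N + m)).filter (fun k => k ∉ bSet b)).toFinset =
      Finset.univ \ bSet b := by ext; simp
  rw [boundary_bulk ξp (extVar hm ξ lam) ((List.nodup_finRange _).filter _)
    (fun k _ => g.two_ne k) (fun k _ r _ h e => g.add_ne k r h e), hL]
  symm
  refine Finset.sum_subset ?_ ?_
  · intro σ hσ
    rw [mem_signsOn] at hσ ⊢
    intro k hk
    refine hσ k fun hk' => hk ?_
    rw [Finset.mem_sdiff, mem_bSet]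
    exact ⟨Finset.mem_univ _, fun ⟨p, hp⟩ => alphaMinus_ne hk' p hp⟩
  · intro σ hσ hσ'
    rw [mem_signsOn] at hσ hσ'
    push Not at hσ'
    obtain ⟨k, hk, hk1⟩ := hσ'
    have hkS : k ∈ Finset.univ \ bSet b := by
      by_contra h; exact hk1 (hσ k h)
    have hkN : N ≤ (k : ℕ) := by
      by_contra h
      refine hk ?_
      rw [alphaMinus, Finset.mem_filter]
      exact ⟨Finset.mem_univ _, not_le.1 h, (Finset.mem_sdiff.1 hkS).2⟩
    obtain ⟨j, rfl⟩ := exists_xiPos k hkN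
    rw [HBplus_eq_zero hkS ((Int.units_eq_one_or _).resolve_left hk1)
      (extVar_xiPos hm ξ lam j), zero_smul]

/-- The boundary-bulk relation for the left-hand side. -/
theorem GenericParams.lhs_vector (g : GenericParams hm η ξp ξ lam) :
    (List.ofFn fun k : Fin N => Bplus η ξp ξ (lam k)).prod *ᵥ vacuum M =
    ∑ σ ∈ signsOn (posSet N m m), HBplus η ξp ξ (posSet N m m) σ (extVar hm ξ lam) •
      bethe η ξ (List.nodup_finRange M) (sgn σ (extVar hm ξ lam)) (posSet N m m) := by
  have hL : ((List.finRange N).map (Fin.castAdd m)).toFinset = posSet N m m := by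
    ext k
    rw [List.mem_toFinset, List.mem_map, mem_posSet_self]
    constructor
    · rintro ⟨l, _, rfl⟩; exact l.isLt
    · intro h; exact ⟨⟨k, h⟩, List.mem_finRange _, rfl⟩
  have h := boundary_bulk (η := η) (ξ := ξ) ξp (extVar hm ξ lam)
    (L := (List.finRange N).map (Fin.castAdd m))
    ((List.nodup_finRange N).map (Fin.castAdd_injective N m))
    (fun k _ => g.two_ne k) (fun k _ r _ h e => g.add_ne k r h e)
  rw [hL] at h
  have hl : (List.ofFn fun k : Fin N => Bplus η ξp ξ (lam k)) =
      ((List.finRange N).map (Fin.castAdd m)).map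
        fun k => Bplus η ξp ξ (extVar hm ξ lam k) := by
    rw [List.map_map, List.ofFn_eq_map]
    exact List.map_congr_left fun k _ => by rw [Function.comp_apply, extVar_castAdd]
  rw [hl, h]

end params

end

/-! ### From the bulk to the boundary coefficient -/

section

variable {M N m : ℕ}

theorem posSet_eq_union (b : Fin m → Fin (N + m)) :
    posSet N m m = alphaPlus b ∪ alphaMinus b := by
  ext k
  rw [mem_posSet_self, Finset.mem_union, alphaPlus, alphaMinus, Finset.mem_filter,
    Finset.mem_filter]
  have := Finset.mem_univ k
  tauto

theorem compl_bSet_eq_union (b : Fin m → Fin (N + m)) :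
    Finset.univ \ bSet b = (gammaPlus b).image (xiPos N) ∪ alphaMinus b := by
  ext k
  simp only [Finset.mem_sdiff, Finset.mem_univ, true_and, Finset.mem_union, Finset.mem_image,
    alphaMinus, gammaPlus, Finset.mem_filter]
  constructor
  · intro hk
    rcases Nat.lt_or_ge (k : ℕ) N with h | h
    · exact Or.inr ⟨h, hk⟩
    · obtain ⟨j, rfl⟩ := exists_xiPos k h
      exact Or.inl ⟨j, hk, rfl⟩
  · rintro (⟨j, hj, rfl⟩ | ⟨_, h⟩)
    exacts [hj, h]

theorem alphaPlus_disjoint (b : Fin m → Fin (N + m)) : Disjoint (alphaPlus b) (alphaMinus b) := by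
  rw [Finset.disjoint_left]
  intro k hk hk'
  rw [alphaPlus, Finset.mem_filter] at hk
  rw [alphaMinus, Finset.mem_filter] at hk'
  exact hk'.2.2 hk.2.2

theorem gammaPlus_disjoint (b : Fin m → Fin (N + m)) :
    Disjoint ((gammaPlus b).image (xiPos N)) (alphaMinus b) := by
  rw [Finset.disjoint_left]
  intro k hk hk'
  obtain ⟨j, _, rfl⟩ := Finset.mem_image.1 hk
  exact absurd (alphaMinus_lt hk') (not_lt.2 (le_xiPos j))

section params

variable {hm : m ≤ M} {η ξp : ℂ} {ξ : Fin M → ℂ} {lam : Fin N → ℂ}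
  {b : Fin m → Fin (N + m)} {σ τ : Fin (N + m) → ℤˣ}

/-- The term of the signs `σ` in the coefficient `𝓕⁺`. -/
noncomputable def FplusSummand (hm : m ≤ M) (η ξp : ℂ) (ξ : Fin M → ℂ) (lam : Fin N → ℂ)
    (i : Fin m → Fin m) (s : ℕ) (b : Fin m → Fin (N + m)) (σ : Fin (N + m) → ℤˣ) : ℂ :=
  let x : Fin (N + m) → ℂ := extVar hm ξ lam
  let z : Fin m → ℂ := fun j => ξ (Fin.castLE hm j)
  let y : Fin (N + m) → ℂ := sgn σ x
  (∏ j, aFun η ξ (y (b j)) / aFun η ξ (z j))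
    * (HBplus η ξp ξ (alphaPlus b) σ x / HBplus η ξp ξ (gammaPlus b) (fun _ => 1) z)
    * (∏ p, ∏ q with p < q, sinh (y (b p) - y (b q)) / sinh (y (b p) - y (b q) + η))
    * (∏ k ∈ alphaMinus b, ∏ e : ℤˣ,
        ((∏ j ∈ alphaPlus b,
            sinh (y j + ((e : ℤ) : ℂ) * x k - η) / sinh (y j + ((e : ℤ) : ℂ) * x k))
        * ∏ j ∈ gammaPlus b,
            sinh (z j + ((e : ℤ) : ℂ) * x k) / sinh (z j + ((e : ℤ) : ℂ) * x k - η)))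
    * (∏ k ∈ alphaPlus b,
        ((∏ j ∈ gammaPlus b, sinh (z j - y k) / sinh (z j - y k - η))
        * ((∏ j ∈ alphaPlus b, sinh (y j - y k + η))
            / ∏ j ∈ (alphaPlus b).erase k, sinh (y j - y k))))
    * (∏ p ∈ Finset.univ.filter (fun p : Fin m => (p : ℕ) < s), minusFactor hm η ξ y i b p)
    * ∏ p ∈ Finset.univ.filter (fun p : Fin m => s ≤ (p : ℕ)), plusFactor hm η ξ y i b p

theorem Fplus_eq_sum (ε ε' : Fin m → Fin 2) (hs : (betaMinus ε').card + (betaPlus ε).card = m) :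
    Fplus hm η ξp ξ lam ε ε' hs b = ∑ σ ∈ signsOn (alphaPlus b),
      FplusSummand hm η ξp ξ lam (siteSeq ε ε' hs) (betaMinus ε').card b σ := by
  have h : signsOn (alphaPlus b) = signChoices b := by
    ext σ
    simp [signsOn, signChoices]
  rw [h]
  rfl

/-- Only in the factors with `α_-` does the bulk coefficient depend on the variables outside
`β_m`. -/
theorem bulkCoeff_congr {i : Fin m → Fin m} {s : ℕ} {y y' : Fin (N + m) → ℂ}
    (hb : ∀ p, y (b p) = y' (b p)) (hp : ∀ k ∈ alphaPlus b, y k = y' k) :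
    bulkCoeff hm η ξ y i s b =
      (∏ j : Fin m, aFun η ξ (y' (b j)) / aFun η ξ (ξ (Fin.castLE hm j))) *
      (∏ p : Fin m, ∏ q : Fin m with p < q,
        sinh (y' (b p) - y' (b q)) / sinh (y' (b p) - y' (b q) + η)) *
      (∏ k ∈ alphaMinus b, ((∏ j ∈ alphaPlus b, sinh (y' j - y k - η) / sinh (y' j - y k)) *
        ∏ j ∈ gammaPlus b,
          sinh (ξ (Fin.castLE hm j) - y k) / sinh (ξ (Fin.castLE hm j) - y k - η))) *
      (∏ k ∈ alphaPlus b, ((∏ j ∈ gammaPlus b,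
          sinh (ξ (Fin.castLE hm j) - y' k) / sinh (ξ (Fin.castLE hm j) - y' k - η)) *
        ((∏ j ∈ alphaPlus b, sinh (y' j - y' k + η)) /
          ∏ j ∈ (alphaPlus b).erase k, sinh (y' j - y' k)))) *
      (∏ p ∈ Finset.univ.filter (fun p : Fin m => (p : ℕ) < s), minusFactor hm η ξ y' i b p) *
      ∏ p ∈ Finset.univ.filter (fun p : Fin m => s ≤ (p : ℕ)), plusFactor hm η ξ y' i b p := by
  have h1 : ∀ k ∈ alphaMinus b, (∏ j ∈ alphaPlus b, sinh (y j - y k - η) / sinh (y j - y k)) =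
      ∏ j ∈ alphaPlus b, sinh (y' j - y k - η) / sinh (y' j - y k) := fun k _ =>
    Finset.prod_congr rfl fun j hj => by rw [hp j hj]
  have h2 : ∀ k ∈ alphaPlus b, ((∏ j ∈ gammaPlus b,
      sinh (ξ (Fin.castLE hm j) - y k) / sinh (ξ (Fin.castLE hm j) - y k - η)) *
      ((∏ j ∈ alphaPlus b, sinh (y j - y k + η)) /
        ∏ j ∈ (alphaPlus b).erase k, sinh (y j - y k))) =
      (∏ j ∈ gammaPlus b,
        sinh (ξ (Fin.castLE hm j) - y' k) / sinh (ξ (Fin.castLE hm j) - y' k - η)) *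
      ((∏ j ∈ alphaPlus b, sinh (y' j - y' k + η)) /
        ∏ j ∈ (alphaPlus b).erase k, sinh (y' j - y' k)) := by
    intro k hk
    rw [hp k hk]
    congr 2
    · exact Finset.prod_congr rfl fun j hj => by rw [hp j hj]
    · exact Finset.prod_congr rfl fun j hj => by rw [hp j (Finset.mem_of_mem_erase hj)]
  unfold bulkCoeff minusFactor plusFactor
  simp only [hb]
  rw [Finset.prod_congr rfl h2]
  congr 4
  exact Finset.prod_congr rfl fun k hk => by rw [h1 k hk]

/-- The factors from the boundary-bulk relation on both sides turn the coefficient of the bulk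
action into that of the action on boundary Bethe vectors. -/
theorem GenericParams.coeff_eq (g : GenericParams hm η ξp ξ lam) (i : Fin m → Fin m) (s : ℕ)
    (hσ : σ ∈ signsOn (alphaPlus b)) (hτ : τ ∈ signsOn (alphaMinus b)) :
    HBplus η ξp ξ (posSet N m m) (σ * τ) (extVar hm ξ lam) *
        bulkCoeff hm η ξ (sgn (σ * τ) (extVar hm ξ lam)) i s b =
      FplusSummand hm η ξp ξ lam i s b σ *
        HBplus η ξp ξ (Finset.univ \ bSet b) τ (extVar hm ξ lam) := by
  have hσ₁ := mem_signsOn.1 hσ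
  have hτ₁ := mem_signsOn.1 hτ
  have hplus : ∀ k, k ∉ alphaMinus b → (σ * τ) k = σ k := fun k hk => by
    rw [Pi.mul_apply, hτ₁ k hk, mul_one]
  have hminus : ∀ k, k ∉ alphaPlus b → (σ * τ) k = τ k := fun k hk => by
    rw [Pi.mul_apply, hσ₁ k hk, one_mul]
  have hdp : ∀ k ∈ alphaPlus b, k ∉ alphaMinus b := fun _ hk =>
    Finset.disjoint_left.1 (alphaPlus_disjoint b) hk
  have hdm : ∀ k ∈ alphaMinus b, k ∉ alphaPlus b := fun _ hk =>
    Finset.disjoint_right.1 (alphaPlus_disjoint b) hk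
  have hyp : ∀ k, k ∉ alphaMinus b → sgn (σ * τ) (extVar hm ξ lam) k =
      sgn σ (extVar hm ξ lam) k := fun k hk => by rw [sgn, hplus k hk, sgn]
  have hym : ∀ k ∈ alphaMinus b, sgn (σ * τ) (extVar hm ξ lam) k =
      sgn τ (extVar hm ξ lam) k := fun k hk => by rw [sgn, hminus k (hdm k hk), sgn]
  have hxi : ∀ j, sgn τ (extVar hm ξ lam) (xiPos N j) = ξ (Fin.castLE hm j) :=
    sgn_xiPos (fun k hk => alphaMinus_lt hk) hτ
  have hpos : ∀ j, xiPos N j ∉ alphaMinus b := fun j h =>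
    absurd (alphaMinus_lt h) (not_lt.2 (le_xiPos j))
  have hP : HBplus η ξp ξ (posSet N m m) (σ * τ) (extVar hm ξ lam) =
      HBplus η ξp ξ (alphaPlus b) σ (extVar hm ξ lam) *
      HBplus η ξp ξ (alphaMinus b) τ (extVar hm ξ lam) *
      ∏ k ∈ alphaMinus b, ∏ j ∈ alphaPlus b,
        pairFactor η (sgn σ (extVar hm ξ lam) j) (sgn τ (extVar hm ξ lam) k) := by
    rw [posSet_eq_union b, HBplus_union (alphaPlus_disjoint b),
      HBplus_congr (τ := σ) ξp _ fun k hk => hplus k (hdp k hk),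
      HBplus_congr (τ := τ) ξp _ fun k hk => hminus k (hdm k hk)]
    congr 1
    exact Finset.prod_congr rfl fun k hk => Finset.prod_congr rfl fun j hj => by
      rw [hym k hk, hyp j (hdp j hj)]
  have hC : HBplus η ξp ξ (Finset.univ \ bSet b) τ (extVar hm ξ lam) =
      HBplus η ξp ξ (gammaPlus b) (fun _ => 1) (fun j => ξ (Fin.castLE hm j)) *
      HBplus η ξp ξ (alphaMinus b) τ (extVar hm ξ lam) *
      ∏ k ∈ alphaMinus b, ∏ j ∈ gammaPlus b,
        pairFactor η (ξ (Fin.castLE hm j)) (sgn τ (extVar hm ξ lam) k) := by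
    rw [compl_bSet_eq_union b, HBplus_union (gammaPlus_disjoint b),
      HBplus_image xiPos_injective (gammaPlus b) (fun j _ => hτ₁ _ (hpos j))
        (fun j _ => extVar_xiPos hm ξ lam j)]
    congr 1
    refine Finset.prod_congr rfl fun k hk => ?_
    rw [Finset.prod_image fun _ _ _ _ h => xiPos_injective h]
    exact Finset.prod_congr rfl fun j _ => by rw [hxi]
  -- For `k ∈ α_-`, the bulk coefficient has the factor of `-τ_k`; that of `τ_k` is the quotient
  -- of the factors of pairs in the two coefficients `H`.
  have hα : ∀ k ∈ alphaMinus b, ∀ F : ℂ → ℂ, ∏ e : ℤˣ, F (((e : ℤ) : ℂ) * extVar hm ξ lam k) =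
      F (-sgn τ (extVar hm ξ lam) k) * F (sgn τ (extVar hm ξ lam) k) := by
    intro k _ F
    have huniv : (Finset.univ : Finset ℤˣ) = {1, -1} := rfl
    rw [huniv, Finset.prod_pair (by decide), sgn]
    rcases Int.units_eq_one_or (τ k) with h | h <;> rw [h] <;> simp [mul_comm]
  have hγ0 : ∀ k ∈ alphaMinus b, (∏ j ∈ gammaPlus b,
      pairFactor η (ξ (Fin.castLE hm j)) (sgn τ (extVar hm ξ lam) k)) ≠ 0 := by
    intro k hk
    obtain ⟨l, rfl⟩ : ∃ l : Fin N, Fin.castAdd m l = k := ⟨⟨k, alphaMinus_lt hk⟩, rfl⟩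
    refine Finset.prod_ne_zero_iff.2 fun j _ => ?_
    rw [sgn, extVar_castAdd]
    exact div_ne_zero (g.xi_lam_sub _ _ _) (g.xi_lam _ _ _)
  have hrow : (∏ k ∈ alphaMinus b, ∏ e : ℤˣ,
        ((∏ j ∈ alphaPlus b, sinh (sgn σ (extVar hm ξ lam) j +
            ((e : ℤ) : ℂ) * extVar hm ξ lam k - η) /
            sinh (sgn σ (extVar hm ξ lam) j + ((e : ℤ) : ℂ) * extVar hm ξ lam k))
        * ∏ j ∈ gammaPlus b,
            sinh (ξ (Fin.castLE hm j) + ((e : ℤ) : ℂ) * extVar hm ξ lam k) /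
              sinh (ξ (Fin.castLE hm j) + ((e : ℤ) : ℂ) * extVar hm ξ lam k - η))) *
      (∏ k ∈ alphaMinus b, ∏ j ∈ gammaPlus b,
        pairFactor η (ξ (Fin.castLE hm j)) (sgn τ (extVar hm ξ lam) k)) =
      (∏ k ∈ alphaMinus b, ((∏ j ∈ alphaPlus b, sinh (sgn σ (extVar hm ξ lam) j -
          sgn (σ * τ) (extVar hm ξ lam) k - η) / sinh (sgn σ (extVar hm ξ lam) j -
          sgn (σ * τ) (extVar hm ξ lam) k)) *
        ∏ j ∈ gammaPlus b, sinh (ξ (Fin.castLE hm j) - sgn (σ * τ) (extVar hm ξ lam) k) /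
          sinh (ξ (Fin.castLE hm j) - sgn (σ * τ) (extVar hm ξ lam) k - η))) *
      ∏ k ∈ alphaMinus b, ∏ j ∈ alphaPlus b,
        pairFactor η (sgn σ (extVar hm ξ lam) j) (sgn τ (extVar hm ξ lam) k) := by
    rw [← Finset.prod_mul_distrib, ← Finset.prod_mul_distrib]
    refine Finset.prod_congr rfl fun k hk => ?_
    rw [hα k hk fun w => (∏ j ∈ alphaPlus b, sinh (sgn σ (extVar hm ξ lam) j + w - η) /
        sinh (sgn σ (extVar hm ξ lam) j + w)) *
        ∏ j ∈ gammaPlus b, sinh (ξ (Fin.castLE hm j) + w) / sinh (ξ (Fin.castLE hm j) + w - η),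
      hym k hk]
    have hinv : ∏ j ∈ gammaPlus b, sinh (ξ (Fin.castLE hm j) + sgn τ (extVar hm ξ lam) k) /
        sinh (ξ (Fin.castLE hm j) + sgn τ (extVar hm ξ lam) k - η) =
        (∏ j ∈ gammaPlus b,
          pairFactor η (ξ (Fin.castLE hm j)) (sgn τ (extVar hm ξ lam) k))⁻¹ := by
      rw [← Finset.prod_inv_distrib]
      exact Finset.prod_congr rfl fun j _ => by rw [pairFactor, inv_div]
    rw [hinv, mul_assoc, mul_assoc (∏ j ∈ alphaPlus b, _) (_⁻¹), inv_mul_cancel₀ (hγ0 k hk), mul_one]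
    simp only [← sub_eq_add_neg, pairFactor]
  rw [bulkCoeff_congr (y' := sgn σ (extVar hm ξ lam)) (fun p => hyp _ fun h => alphaMinus_ne h p rfl)
    (fun k hk => hyp k (hdp k hk)), hP, hC, FplusSummand]
  have key : ∀ A H₁ H₂ H₃ X Y Z W P Q L₁ L₂ : ℂ, H₃ ≠ 0 → Z * Y = W * X →
      H₁ * H₂ * X * (A * P * W * Q * L₁ * L₂) =
        A * (H₁ / H₃) * P * Z * Q * L₁ * L₂ * (H₃ * H₂ * Y) := by
    intro A H₁ H₂ H₃ X Y Z W P Q L₁ L₂ h0 h1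
    have h2 : H₁ / H₃ * H₃ = H₁ := div_mul_cancel₀ _ h0
    linear_combination (-H₁ * H₂ * A * P * Q * L₁ * L₂) * h1 -
      A * P * Z * Q * L₁ * L₂ * H₂ * Y * h2
  exact key _ _ _ _ _ _ _ _ _ _ _ _ (g.HBplus_ne _) hrow

end params

end

/-! ### Index families and the factorization of the local operators -/

section

variable {M N m : ℕ}

theorem siteOrder_siteSeq (ε ε' : Fin m → Fin 2)
    (hs : (betaMinus ε').card + (betaPlus ε).card = m) :
    SiteOrder ε ε' (siteSeq ε ε' hs) (betaMinus ε').card where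
  lt_of_lt p q hpq hq := by
    have hp : (p : ℕ) < (betaMinus ε').card := lt_trans hpq hq
    rw [siteSeq, siteSeq, dif_pos hp, dif_pos hq]
    exact (Finset.orderEmbOfFin _ _).strictMono hpq
  gt_of_lt p q hpq hp := by
    have hq : (betaMinus ε').card ≤ (q : ℕ) := hp.trans (le_of_lt hpq)
    rw [siteSeq, siteSeq, dif_neg (not_lt.2 hp), dif_neg (not_lt.2 hq)]
    refine (Finset.orderEmbOfFin _ _).strictMono (Fin.rev_lt_rev.2 ?_)
    have : (p : ℕ) < q := hpq
    rw [Fin.mk_lt_mk]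
    omega
  mem_minus j := by
    have h1 : ε' j = 1 ↔ j ∈ Set.range ((betaMinus ε').orderEmbOfFin rfl) := by
      rw [Finset.range_orderEmbOfFin]; simp [betaMinus]
    rw [h1]
    constructor
    · rintro ⟨a, rfl⟩
      refine ⟨⟨a, by have := a.isLt; omega⟩, a.isLt, ?_⟩
      rw [siteSeq, dif_pos a.isLt]
    · rintro ⟨p, hp, rfl⟩
      rw [siteSeq, dif_pos hp]
      exact ⟨_, rfl⟩
  mem_plus j := by
    have h1 : ε j = 0 ↔ j ∈ Set.range ((betaPlus ε).orderEmbOfFin rfl) := by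
      rw [Finset.range_orderEmbOfFin]; simp [betaPlus]
    rw [h1]
    constructor
    · rintro ⟨a, rfl⟩
      have ha := a.rev.isLt
      refine ⟨⟨(betaMinus ε').card + a.rev, by omega⟩, Nat.le_add_right _ _, ?_⟩
      rw [siteSeq, dif_neg (by simp)]
      congr 1
      ext
      have := a.isLt
      simp only [Fin.val_rev]
      omega
    · rintro ⟨p, hp, rfl⟩
      rw [siteSeq, dif_neg (not_lt.2 hp)]
      exact ⟨_, rfl⟩

/-- The families arising from the successive choices are those of the sum. -/
theorem famOn_choiceSet (ε ε' : Fin m → Fin 2)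
    (hs : (betaMinus ε').card + (betaPlus ε).card = m) (b₀ : Fin m → Fin (N + m)) :
    famOn (choiceSet N (siteSeq ε ε' hs) (betaMinus ε').card) b₀ Finset.univ =
      indexFamilies N ε ε' hs := by
  ext b
  simp only [famOn, indexFamilies, Finset.mem_filter, Finset.mem_univ, true_and, forall_const,
    not_true_eq_false, false_imp_iff, implies_true, and_true]
  refine and_congr_right fun _ => forall_congr' fun p => ?_
  rw [choiceSet]
  split_ifs
  · rw [mem_posSet_self]
  · rw [mem_posSet]

theorem admissible_of_mem {ε ε' : Fin m → Fin 2}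
    {hs : (betaMinus ε').card + (betaPlus ε).card = m} {b : Fin m → Fin (N + m)}
    (hb : b ∈ indexFamilies N ε ε' hs) :
    Admissible (siteSeq ε ε' hs) (betaMinus ε').card b := by
  rw [indexFamilies, Finset.mem_filter] at hb
  refine ⟨fun p q h => hb.2.1 p q h, fun p hp => ?_, fun p hp => ?_⟩
  · have := hb.2.2 p
    rwa [if_pos hp] at this
  · have := hb.2.2 p
    rwa [if_neg (not_lt.2 hp)] at this

/-- In a product of `f a * g a` the second factors can be collected on the right, in reverse
order. -/
theorem prod_map_mul_of_commute {α R : Type*} [Monoid R] {f g : α → R} {l : List α} (hl : l.Nodup)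
    (h : ∀ a ∈ l, ∀ b ∈ l, a ≠ b → Commute (g a) (f b))
    (h' : ∀ a ∈ l, ∀ b ∈ l, a ≠ b → Commute (g a) (g b)) :
    (l.map fun a => f a * g a).prod = (l.map f).prod * (l.map g).reverse.prod := by
  induction l with
  | nil => simp
  | cons a l ih =>
    rw [List.nodup_cons] at hl
    have hc : Commute (g a) (l.map f).prod := by
      refine Commute.list_prod_right _ _ fun c hc => ?_
      obtain ⟨b, hb, rfl⟩ := List.mem_map.1 hc
      exact h a List.mem_cons_self b (List.mem_cons_of_mem _ hb) fun e => hl.1 (e ▸ hb)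
    have hc' : Commute (g a) (l.map g).reverse.prod := by
      refine Commute.list_prod_right _ _ fun c hc => ?_
      obtain ⟨b, hb, rfl⟩ := List.mem_map.1 (List.mem_reverse.1 hc)
      exact h' a List.mem_cons_self b (List.mem_cons_of_mem _ hb) fun e => hl.1 (e ▸ hb)
    rw [List.map_cons, List.prod_cons, ih hl.2
      (fun b hb c hcl => h b (List.mem_cons_of_mem _ hb) c (List.mem_cons_of_mem _ hcl))
      (fun b hb c hcl => h' b (List.mem_cons_of_mem _ hb) c (List.mem_cons_of_mem _ hcl))]
    simp only [List.map_cons, List.prod_cons, List.reverse_cons, List.prod_append, List.prod_nil,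
      mul_one]
    rw [mul_assoc, ← mul_assoc (g a), hc.eq, mul_assoc _ (g a), hc'.eq, mul_assoc]

/-- The local operators first flip all spins up and then put them into the configuration `ε`, by
`E^{εε'} = E^{ε1} E^{1ε'}`. -/
theorem prod_elemOp_eq (hm : m ≤ M) (ε ε' : Fin m → Fin 2) :
    (List.ofFn fun j : Fin m => elemOp (Fin.castLE hm j) (ε j) (ε' j)).prod =
      setSpins hm ε 0 * flipUp hm ε' m := by
  have h := prod_map_mul_of_commute (f := fun j : Fin m => elemOp (Fin.castLE hm j) (ε j) 0)
    (g := fun j : Fin m => elemOp (Fin.castLE hm j) 0 (ε' j)) (List.nodup_finRange m)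
    (fun a _ b _ hab => elemOp_commute (fun h => hab (Fin.castLE_injective hm h)) _ _ _ _)
    (fun a _ b _ hab => elemOp_commute (fun h => hab (Fin.castLE_injective hm h)) _ _ _ _)
  simp only [elemOp_mul, if_true] at h
  rw [List.ofFn_eq_map, h, setSpins, flipUp, List.drop_zero, List.take_of_length_le (by simp)]

end

end OpenXXZ

theorem mainTheorem5 {M N m : ℕ} (hm : m ≤ M) (η ξp : ℂ) (ξ : Fin M → ℂ) (lam : Fin N → ℂ)
    (ε ε' : Fin m → Fin 2)
    (hs : (OpenXXZ.betaMinus ε').card + (OpenXXZ.betaPlus ε).card = m)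
    (h_lam : ∀ k, Complex.sinh (2 * lam k) ≠ 0)
    (h_lam_lam : ∀ k l, k ≠ l → ∀ e : ℤˣ, Complex.sinh (lam k + ((e : ℤ) : ℂ) * lam l) ≠ 0)
    (h_lam_lam_eta : 2 ≤ m → ∀ k l, k ≠ l → ∀ e f : ℤˣ,
      Complex.sinh (lam k + ((e : ℤ) : ℂ) * lam l + ((f : ℤ) : ℂ) * η) ≠ 0)
    (h_xi_lam : ∀ (j : Fin m) (k : Fin N) (e : ℤˣ),
      Complex.sinh (ξ (Fin.castLE hm j) + ((e : ℤ) : ℂ) * lam k) ≠ 0)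
    (h_xi_lam_sub : ∀ (j : Fin m) (k : Fin N) (e : ℤˣ),
      Complex.sinh (ξ (Fin.castLE hm j) + ((e : ℤ) : ℂ) * lam k - η) ≠ 0)
    (h_xi_lam_add : 2 ≤ m → ∀ (j : Fin m) (k : Fin N) (e : ℤˣ),
      Complex.sinh (ξ (Fin.castLE hm j) + ((e : ℤ) : ℂ) * lam k + η) ≠ 0)
    (h_xi_sub : ∀ j l : Fin m, j ≠ l →
      Complex.sinh (ξ (Fin.castLE hm j) - ξ (Fin.castLE hm l)) ≠ 0)
    (h_xi_sub_eta : ∀ (j : Fin m) (i : Fin M), Complex.sinh (ξ (Fin.castLE hm j) - ξ i + η) ≠ 0)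
    (h_xi_add : ∀ (j : Fin m) (i : Fin M), Complex.sinh (ξ (Fin.castLE hm j) + ξ i) ≠ 0)
    (h_xi_add_eta : ∀ j l : Fin m, j ≠ l →
      Complex.sinh (ξ (Fin.castLE hm j) + ξ (Fin.castLE hm l) - η) ≠ 0)
    (h_xi_two : ∀ j : Fin m, Complex.sinh (2 * ξ (Fin.castLE hm j) + η) ≠ 0)
    (h_xi_bdry : ∀ j : Fin m, Complex.sinh (ξ (Fin.castLE hm j) + ξp - η / 2) ≠ 0) :
    Matrix.mulVec
      ((List.ofFn fun j : Fin m => OpenXXZ.elemOp (Fin.castLE hm j) (ε j) (ε' j)).prod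
        * (List.ofFn fun k : Fin N => OpenXXZ.Bplus η ξp ξ (lam k)).prod)
      (OpenXXZ.vacuum M)
    = ∑ b ∈ OpenXXZ.indexFamilies N ε ε' hs,
        OpenXXZ.Fplus hm η ξp ξ lam ε ε' hs b •
          Matrix.mulVec
            (((List.finRange (N + m)).filter (fun k => k ∉ OpenXXZ.bSet b)).map
              (fun k => OpenXXZ.Bplus η ξp ξ (OpenXXZ.extVar hm ξ lam k))).prod
            (OpenXXZ.vacuum M) := by
  open OpenXXZ in
  have g : GenericParams hm η ξp ξ lam := ⟨h_lam, h_lam_lam, h_lam_lam_eta, h_xi_lam,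
    h_xi_lam_sub, h_xi_lam_add, h_xi_sub, h_xi_sub_eta, h_xi_add, h_xi_add_eta, h_xi_two,
    h_xi_bdry⟩
  rw [← Matrix.mulVec_mulVec, g.lhs_vector, prod_elemOp_eq, Matrix.mulVec_sum]
  -- the action on each bulk vector in the expansion of the boundary vector
  have hact : ∀ σ ∈ signsOn (posSet N m m),
      Matrix.mulVec (setSpins hm ε 0 * flipUp hm ε' m)
        (HBplus η ξp ξ (posSet N m m) σ (extVar hm ξ lam) •
          bethe η ξ (List.nodup_finRange M) (sgn σ (extVar hm ξ lam)) (posSet N m m)) =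
      ∑ b ∈ indexFamilies N ε ε' hs,
        (HBplus η ξp ξ (posSet N m m) σ (extVar hm ξ lam) *
          bulkCoeff hm η ξ (sgn σ (extVar hm ξ lam)) (siteSeq ε ε' hs) (betaMinus ε').card b) •
          bethe η ξ (List.nodup_finRange M) (sgn σ (extVar hm ξ lam)) (Finset.univ \ bSet b) := by
    intro σ hσ
    have gσ := g.generic hσ
    have hchain : chain M 0 = List.finRange M := List.drop_zero
    have hdec : chosenRestoring (siteSeq ε ε' hs) (betaMinus ε').card 0 = Finset.univ := by
      ext p; simp [chosenRestoring]
    have hpos : posSet N m 0 = Finset.univ := by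
      ext k; simp [mem_posSet]
    have h := setSpins_betheFrom (hm := hm) (siteOrder_siteSeq ε ε' hs) (xiPos N) gσ.sub gσ.xi
      gσ.sub_eta (fun j => gσ.aList_ne j _) 0 (Nat.zero_le m)
    rw [hdec, famOn_choiceSet] at h
    simp only [betheFrom, bethe_list_congr hchain _ (List.nodup_finRange M), hpos] at h
    rw [Matrix.mulVec_smul, ← Matrix.mulVec_mulVec, h, Finset.smul_sum]
    refine Finset.sum_congr rfl fun b hb => ?_
    rw [smul_smul, ← prod_flipFactor_mul gσ (siteOrder_siteSeq ε ε' hs)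
      (admissible_of_mem hb), bSet,
      Finset.filter_true_of_mem fun j _ => Nat.zero_le _]
  rw [Finset.sum_congr rfl hact, Finset.sum_comm]
  refine Finset.sum_congr rfl fun b _ => ?_
  -- The signs `σ` of `α_+` are those summed over in the coefficient; the signs `τ` of `α_-` are
  -- those of the expansion of the boundary vector on the right.
  rw [g.rhs_vector, Fplus_eq_sum, posSet_eq_union b, sum_signsOn_union (alphaPlus_disjoint b),
    Finset.sum_smul]
  refine Finset.sum_congr rfl fun σ hσ => ?_
  rw [Finset.smul_sum]
  refine Finset.sum_congr rfl fun τ hτ => ?_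
  rw [smul_smul, ← g.coeff_eq _ _ hσ hτ, posSet_eq_union b]
  congr 1
  refine bethe_congr _ fun k hk => ?_
  have hk1 : k ∉ alphaPlus b := fun h =>
    (Finset.mem_sdiff.1 hk).2 (Finset.mem_filter.1 h).2.2
  rw [sgn, sgn, Pi.mul_apply, mem_signsOn.1 hσ k hk1, one_mul]
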